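/- For a compact almost complex $4$-manifold $(M,J)$ with a Hermitian metric $g$ let $h^{1,0}_d$ be the complex dimension of the space of smooth $(1,0)$-forms $\alpha$ with $\Delta_d\alpha=0$, where $\Delta_d=dd^*+d^*d$ is the Hodge Laplacian of $g$. **Theorem.** The number $h^{1,0}_d$ is not an almost complex invariant in dimension $4$: there are a compact connected almost complex $4$-manifold $(M,J)$ and two Hermitian metrics on it with different values of $h^{1,0}_d$. Examples are given by each of the following compact connected quotients $M=\Gamma\backslash G$, where $G=\mathbb{R}^4$ with the indicated group law and $E_1,\dots,E_4$ is the indicated left-invariant frame. 1. (Primary Kodaira surface.) $G=\mathbb{R}\times H_3(\mathbb{R})$ with coordinates $(t,x,y,z)$ and product $(t,x,y,z)(t',x',y',z')=(t+t',x+x',y+y',z+z'+xy')$, $\Gamma=\mathbb{Z}^4$, frame $\partial_x,\ \partial_y+x\partial_z,\ \partial_z,\ \partial_t$. 2. $G=\mathrm{Nil}^4$ with product $(a,b,c,d)(x,y,z,t)=(x+a,\,y+b,\,z+ay+c,\,t+\tfrac12a^2y+az+d)$ in coordinates $(x,y,z,t)$, $\Gamma=2\mathbb{Z}^4$, frame $\partial_x,\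 \partial_y+x\partial_z+\tfrac12x^2\partial_t,\ \partial_z+x\partial_t,\ \partial_t$. 3. $G=\mathbb{R}\times\mathrm{Sol}^3$ with product $(s,a,b,c)(t,x,y,z)=(s+t,\,a+x,\,b+e^sy,\,c+e^{-s}z)$ in coordinates $(t,x,y,z)$, and $\Gamma=\Gamma_A$ generated by $(\kappa,0,0,0)$, $(0,1,0,0)$, $(0,0,p,q)$, $(0,0,r,s)$, where $A\in SL_2(\mathbb{Z})$, $\operatorname{tr}A\ge 3$, $\kappa>0$, and $P=\begin{pmatrix}p&r\\q&s\end{pmatrix}$ is an invertible real matrix with $A=P^{-1}\operatorname{diag}(e^\kappa,e^{-\kappa})P$ (such $\kappa,P$ exist for every such $A$); frame $\partial_t,\ \partial_x,\ e^t\partial_y,\ e^{-t}\partial_z$. In each case let $E^1,\dots,E^4$ be the dual coframe and let $J$ be the left-invariant almost complex structure for which $\varphi^1=E^1+iE^2$ and $\varphi^2=E^3+iE^4$ form a coframe of $(1,0)$-forms. Then: (a) a smooth $(1,0)$-form $\sigma$ on $M$ satisfies $d\sigma=0$ if and only if $\sigma=c\,\varphi^1$ with $c\in\mathbb{C}$ constant;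 (b) left-invariant Hermitian metrics exist on $(M,J)$, and $h^{1,0}_d=1$ for every one of them; (c) let $F$ be a smooth real function on $M$ depending only on the first two coordinates of $G$ (that is, on $(t,x)$, $(x,y)$, $(t,x)$ respectively), $s=e^F$, $r$ a smooth positive function on $M$, and $u\in\mathbb{C}$ a constant with $rs>|u|$ everywhere. Then there is a Hermitian metric with fundamental form $\omega=g(J\cdot,\cdot)$ given by $$2\omega=ir^2\,\varphi^1\wedge\bar\varphi^1+is^2\,\varphi^2\wedge\bar\varphi^2+u\,\varphi^1\wedge\bar\varphi^2-\bar u\,\varphi^2\wedge\bar\varphi^1,$$ and for it $h^{1,0}_d=0$ if and only if $\bar V_1F=\tfrac12(E_1+iE_2)F$ is not identically zero; (d) there is a Hermitian metric on $(M,J)$ that is not left-invariant and has $h^{1,0}_d=0$. -/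

import Mathlib

open scoped Manifold ContDiff Matrix Topology

/-- The model space `ℝ⁴`. -/
abbrev R4 : Type := EuclideanSpace ℝ (Fin 4)

/-! ### Complex differential forms on a smooth 4-manifold -/

section Forms

variable (M : Type*) [TopologicalSpace M] [ChartedSpace R4 M]

/-- Complex-valued `k`-forms on `M`: families of `ℝ`-multilinear alternating maps
`T_pM × ⋯ × T_pM → ℂ`. Smoothness is the separate predicate `CForm.IsSmooth`. -/
abbrev CForm (k : ℕ) : Type _ :=
  (p : M) → (TangentSpace 𝓘(ℝ, R4) p) [⋀^Fin k]→L[ℝ] ℂ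

variable {M}

/-- The expression of a form in the preferred chart at `p`, i.e. its pullback under the inverse
of that chart. -/
noncomputable def CForm.inChart {k : ℕ} (α : CForm M k) (p : M) (y : R4) : R4 [⋀^Fin k]→L[ℝ] ℂ :=
  (α ((extChartAt 𝓘(ℝ, R4) p).symm y)).compContinuousLinearMap
    (mfderiv 𝓘(ℝ, R4) 𝓘(ℝ, R4) (extChartAt 𝓘(ℝ, R4) p).symm y)

/-- A form is smooth when all its chart expressions are. -/
def CForm.IsSmooth {k : ℕ} (α : CForm M k) : Prop :=
  ∀ p : M, ContDiffOn ℝ ∞ (α.inChart p) (extChartAt 𝓘(ℝ, R4) p).target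

/-- The exterior derivative, computed at `p` in the preferred chart at `p`. -/
noncomputable def CForm.d {k : ℕ} (α : CForm M k) : CForm M (k + 1) := fun p =>
  (extDeriv (α.inChart p) (extChartAt 𝓘(ℝ, R4) p p)).compContinuousLinearMap
    (mfderiv 𝓘(ℝ, R4) 𝓘(ℝ, R4) (extChartAt 𝓘(ℝ, R4) p) p)

/-- The value of a `1`-form on a tangent vector. -/
noncomputable def CForm.eval (α : CForm M 1) (p : M) (v : TangentSpace 𝓘(ℝ, R4) p) : ℂ := α p (fun _ => v)

/-- `(α ∧ β̄)(v, w)` for `1`-forms `α`, `β`. -/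
noncomputable def CForm.wedgeConj (α β : CForm M 1) (p : M) (v w : TangentSpace 𝓘(ℝ, R4) p) : ℂ :=
  α.eval p v * (starRingEnd ℂ) (β.eval p w) - α.eval p w * (starRingEnd ℂ) (β.eval p v)

end Forms

/-! ### Almost complex structures and Hermitian metrics -/

section AlmostComplex

variable (M : Type*) [TopologicalSpace M] [ChartedSpace R4 M] [IsManifold 𝓘(ℝ, R4) ∞ M]

/-- A smooth almost complex structure: a smooth section `J` of `End(TM)` with `J² = -1`. -/
structure AlmostComplexStructure where
  toFun : (p : M) → TangentSpace 𝓘(ℝ, R4) p →L[ℝ] TangentSpace 𝓘(ℝ, R4) p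
  sq : ∀ (p : M) (v : TangentSpace 𝓘(ℝ, R4) p), toFun p (toFun p v) = -v
  contMDiff : ContMDiff 𝓘(ℝ, R4) (𝓘(ℝ, R4).prod 𝓘(ℝ, R4 →L[ℝ] R4)) ∞
    (fun p => Bundle.TotalSpace.mk' (R4 →L[ℝ] R4)
      (E := fun p : M => TangentSpace 𝓘(ℝ, R4) p →L[ℝ] TangentSpace 𝓘(ℝ, R4) p) p (toFun p))

variable {M}

/-- `α` is of type `(1,0)`: `α(Jv) = i α(v)`, i.e. `α` vanishes on `T^{0,1} = {v + iJv}`. -/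
def AlmostComplexStructure.IsType10 (J : AlmostComplexStructure M) (α : CForm M 1) : Prop :=
  ∀ (p : M) (v : TangentSpace 𝓘(ℝ, R4) p), α.eval p (J.toFun p v) = Complex.I * α.eval p v

/-- A Hermitian metric on `(M, J)`: a smooth Riemannian metric for which `J` is an isometry. -/
structure HermitianMetric (J : AlmostComplexStructure M) extends
    Bundle.ContMDiffRiemannianMetric 𝓘(ℝ, R4) ∞ R4
      (fun p : M => TangentSpace 𝓘(ℝ, R4) p) where
  isometry : ∀ (p : M) (v w : TangentSpace 𝓘(ℝ, R4) p),
    inner p (J.toFun p v) (J.toFun p w) = inner p v w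

end AlmostComplex

/-- In a Hermitian real 4-dimensional vector space there is an orthonormal basis
`(e₀, Je₀, e₂, Je₂)`. -/
theorem exists_adapted_frame (B : R4 →L[ℝ] R4 →L[ℝ] ℝ) (J : R4 →L[ℝ] R4)
    (hsymm : ∀ v w, B v w = B w v) (hpos : ∀ v, v ≠ 0 → 0 < B v v)
    (hJ : ∀ v, J (J v) = -v) (hBJ : ∀ v w, B (J v) (J w) = B v w) :
    ∃ e : Fin 4 → R4, (∀ i j, B (e i) (e j) = if i = j then 1 else 0) ∧
      e 1 = J (e 0) ∧ e 3 = J (e 2) := by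
  have skew : ∀ v, B v (J v) = 0 := by
    intro v
    have h := hBJ v (J v)
    rw [hJ, map_neg, hsymm (J v) v] at h
    linarith
  have skew2 : ∀ v w, B v (J w) = - B (J v) w := by
    intro v w
    have h := hBJ v (J w)
    rw [hJ, map_neg] at h
    linarith
  have unit : ∀ v, v ≠ 0 → ∃ c : ℝ, B (c • v) (c • v) = 1 := by
    intro v hv
    refine ⟨(Real.sqrt (B v v))⁻¹, ?_⟩
    have h1 := hpos v hv
    have h2 := Real.mul_self_sqrt h1.le
    have h3 : Real.sqrt (B v v) ≠ 0 := (Real.sqrt_pos.mpr h1).ne'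
    simp only [map_smul, smul_apply, smul_eq_mul]
    field_simp
    nlinarith
  obtain ⟨v, hv⟩ := exists_ne (0 : R4)
  obtain ⟨c, hc⟩ := unit v hv
  set a := c • v
  let L : R4 →ₗ[ℝ] (Fin 2 → ℝ) := LinearMap.pi ![(B a).toLinearMap, (B (J a)).toLinearMap]
  have hker : LinearMap.ker L ≠ ⊥ := by
    apply LinearMap.ker_ne_bot_of_finrank_lt
    simp
  obtain ⟨w, hw, hw0⟩ := (Submodule.ne_bot_iff _).mp hker
  have hw1 : B a w = 0 := by
    have := congrFun (LinearMap.mem_ker.mp hw) 0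
    simpa [L] using this
  have hw2 : B (J a) w = 0 := by
    have := congrFun (LinearMap.mem_ker.mp hw) 1
    simpa [L] using this
  obtain ⟨c', hc'⟩ := unit w hw0
  set b := c' • w
  have hb1 : B a b = 0 := by simp [b, hw1]
  have hb2 : B (J a) b = 0 := by simp [b, hw2]
  have hb3 : B a (J b) = 0 := by rw [skew2, hb2, neg_zero]
  refine ⟨![a, J a, b, J b], ?_, rfl, rfl⟩
  intro i j
  fin_cases i <;> fin_cases j <;>
    simp [hc, hc', hBJ, skew, hb1, hb2, hb3, hsymm (J a) a, hsymm (J b) b, hsymm b, hsymm (J b)]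

section Hodge

variable {M : Type*} [TopologicalSpace M] [ChartedSpace R4 M] [IsManifold 𝓘(ℝ, R4) ∞ M]
  {J : AlmostComplexStructure M}

/-- The value of the metric on two tangent vectors. -/
noncomputable def HermitianMetric.val (g : HermitianMetric J) (p : M) (v w : TangentSpace 𝓘(ℝ, R4) p) : ℝ :=
  g.inner p v w

/-- The fundamental form `ω(v, w) = g(Jv, w)`. -/
noncomputable def HermitianMetric.fundamentalForm (g : HermitianMetric J) (p : M)
    (v w : TangentSpace 𝓘(ℝ, R4) p) : ℝ :=
  g.val p (J.toFun p v) w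

theorem HermitianMetric.exists_frame (g : HermitianMetric J) (p : M) :
    ∃ e : Fin 4 → TangentSpace 𝓘(ℝ, R4) p,
      (∀ i j, g.val p (e i) (e j) = if i = j then 1 else 0) ∧
        e 1 = J.toFun p (e 0) ∧ e 3 = J.toFun p (e 2) :=
  exists_adapted_frame (g.inner p) (J.toFun p) (g.symm p) (g.pos p) (J.sq p) (g.isometry p)

/-- A `g`-orthonormal basis `(e₀, Je₀, e₂, Je₂)` of `T_pM`; it is positively oriented for the
orientation induced by `J`. -/
noncomputable def HermitianMetric.frame (g : HermitianMetric J) (p : M) :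
    Fin 4 → TangentSpace 𝓘(ℝ, R4) p :=
  Classical.choose (g.exists_frame p)

/-- The coframe dual to `g.frame p`, as complex-valued covectors: `eⁱ = g(eᵢ, ·)`. -/
noncomputable def HermitianMetric.coframe (g : HermitianMetric J) (p : M) (i : Fin 4) :
    TangentSpace 𝓘(ℝ, R4) p →L[ℝ] ℂ :=
  Complex.ofRealCLM.comp (g.inner p (g.frame p i))

/-- The wedge product `θ₀ ∧ ⋯ ∧ θ_{l-1}` of complex-valued covectors:
`(v₀, …) ↦ ∑_σ sign σ ∏ θ_b(v_{σ b}) = det (θ_b (v_c))`. -/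
noncomputable def wedgeCovectors {V : Type*} [AddCommGroup V] [Module ℝ V] [TopologicalSpace V]
    {l : ℕ} (θ : Fin l → V →L[ℝ] ℂ) : V [⋀^Fin l]→L[ℝ] ℂ :=
  ContinuousMultilinearMap.alternatization
    ((ContinuousMultilinearMap.mkPiAlgebra ℝ (Fin l) ℂ).compContinuousLinearMap θ)

/-- The complex-linear Hodge operator `* : Λᵏ → Λˡ`, `k + l = 4`, of the metric `g` and the
orientation of `J`; in the oriented orthonormal basis `e` it reads
`*β = 1/(k! l!) ∑_{σ ∈ S₄} sign σ · β(e_{σ 0}, …, e_{σ (k-1)}) e^{σ k} ∧ ⋯ ∧ e^{σ 3}`, so that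
`*(e^{σ 0} ∧ ⋯ ∧ e^{σ (k-1)}) = sign σ · e^{σ k} ∧ ⋯ ∧ e^{σ 3}`. -/
noncomputable def HermitianMetric.hodgeStar (g : HermitianMetric J) {k l : ℕ} (h : k + l = 4)
    (β : CForm M k) : CForm M l := fun p =>
  ((k.factorial * l.factorial : ℕ) : ℂ)⁻¹ • ∑ σ : Equiv.Perm (Fin 4),
    (((Equiv.Perm.sign σ : ℤ) : ℂ) *
      β p (fun a => g.frame p (σ (Fin.cast h (Fin.castAdd l a))))) •
    wedgeCovectors (fun b => g.coframe p (σ (Fin.cast h (Fin.natAdd k b))))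

/-- The codifferential `d^* = -* d *` on `(k+1)`-forms. -/
noncomputable def HermitianMetric.codiff (g : HermitianMetric J) {k l : ℕ}
    (h : k + 1 + l = 4) (β : CForm M (k + 1)) : CForm M k :=
  -(g.hodgeStar (show l + 1 + k = 4 by omega) (g.hodgeStar h β).d)

/-- The Hodge Laplacian `Δ_d = d d^* + d^* d` on `1`-forms. -/
noncomputable def HermitianMetric.laplacian (g : HermitianMetric J) (α : CForm M 1) : CForm M 1 :=
  (g.codiff (k := 0) (l := 3) rfl α).d + g.codiff (k := 1) (l := 2) rfl α.d

/-- The space `ℋ^{1,0}_d` of smooth `(1,0)`-forms `α` with `Δ_d α = 0`. (These forms are a complex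
subspace, so taking the span adds nothing.) -/
noncomputable def HermitianMetric.harmonic10 (g : HermitianMetric J) : Submodule ℂ (CForm M 1) :=
  Submodule.span ℂ {α | α.IsSmooth ∧ J.IsType10 α ∧ g.laplacian α = 0}

/-- `h^{1,0}_d`, the complex dimension of the space of `d`-harmonic `(1,0)`-forms. -/
noncomputable def HermitianMetric.h10d (g : HermitianMetric J) : Cardinal :=
  Module.rank ℂ g.harmonic10

/-- `2ω = i r² φ₁∧φ̄₁ + i s² φ₂∧φ̄₂ + u φ₁∧φ̄₂ - ū φ₂∧φ̄₁`. -/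
def HermitianMetric.HasCoefficients (g : HermitianMetric J) (φ₁ φ₂ : CForm M 1)
    (r s : M → ℝ) (u : M → ℂ) : Prop :=
  ∀ (p : M) (v w : TangentSpace 𝓘(ℝ, R4) p),
    2 * (g.fundamentalForm p v w : ℂ) =
      Complex.I * (r p : ℂ) ^ 2 * φ₁.wedgeConj φ₁ p v w
        + Complex.I * (s p : ℂ) ^ 2 * φ₂.wedgeConj φ₂ p v w
        + u p * φ₁.wedgeConj φ₂ p v w - (starRingEnd ℂ) (u p) * φ₂.wedgeConj φ₁ p v w

end Hodge

/-- `h^{1,0}_d` is an almost complex invariant in dimension 4: on every compact (connected) almost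
complex 4-manifold it has the same value for all Hermitian metrics. -/
def H10dIsAlmostComplexInvariant : Prop :=
  ∀ (M : Type) [TopologicalSpace M] [ChartedSpace R4 M] [IsManifold 𝓘(ℝ, R4) ∞ M]
    [T2Space M] [CompactSpace M] [ConnectedSpace M]
    (J : AlmostComplexStructure M) (g g' : HermitianMetric J), g.h10d = g'.h10d

/-! ### Quotients `Γ \ G` with `G` a Lie group structure on `ℝ⁴` and `Γ` discrete -/

/-- A Lie group structure on the manifold `ℝ⁴`, a discrete subgroup `Γ`, and a left-invariant
frame of vector fields `E₀, …, E₃`. -/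
structure FramedQuotient where
  [group : Group R4]
  contDiff_mul : ContDiff ℝ ∞ (fun p : R4 × R4 => p.1 * p.2)
  contDiff_inv : ContDiff ℝ ∞ (fun p : R4 => p⁻¹)
  Γ : Subgroup R4
  discrete : IsDiscrete (Γ : Set R4)
  E : Fin 4 → R4 → R4
  basis : ∀ a, LinearIndependent ℝ (fun j => E j a)
  invariant : ∀ b a j, fderiv ℝ (fun x => b * x) a (E j a) = E j (b * a)

namespace FramedQuotient

variable (S : FramedQuotient)

/-- Left translation in the group. -/
def leftMul (b a : R4) : R4 := S.group.mul b a

/-- The space `Γ \ G` of orbits of `Γ` acting by left translations. -/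
def Quot : Type :=
  letI := S.group
  Quotient (QuotientGroup.rightRel S.Γ)

/-- The projection `G → Γ \ G`. -/
def proj (a : R4) : S.Quot :=
  letI := S.group
  Quotient.mk (QuotientGroup.rightRel S.Γ) a

instance : TopologicalSpace S.Quot :=
  letI := S.group
  inferInstanceAs (TopologicalSpace (Quotient (QuotientGroup.rightRel S.Γ)))

theorem isTopologicalGroup :
    letI := S.group
    IsTopologicalGroup R4 :=
  letI := S.group
  { continuous_mul := S.contDiff_mul.continuous
    continuous_inv := S.contDiff_inv.continuous }

theorem proj_eq_iff {a b : R4} :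
    S.proj a = S.proj b ↔ ∃ γ, γ ∈ S.Γ ∧ S.leftMul γ a = b := by
  let := S.group
  have h : S.proj a = S.proj b ↔ b * a⁻¹ ∈ S.Γ :=
    Quotient.eq''.trans QuotientGroup.rightRel_apply
  rw [h]
  constructor
  · intro hab
    exact ⟨_, hab, inv_mul_cancel_right b a⟩
  · rintro ⟨γ, hγ, rfl⟩
    have : S.leftMul γ a * a⁻¹ = γ := mul_inv_cancel_right γ a
    rwa [this]

theorem isQuotientCoveringMap :
    letI := S.group
    IsQuotientCoveringMap S.proj S.Γ :=
  letI := S.group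
  haveI := S.isTopologicalGroup
  Topology.IsQuotientMap.isQuotientCoveringMap_of_subgroup
    (isQuotientMap_quotient_mk' (s := QuotientGroup.rightRel S.Γ)) S.Γ S.discrete
    (Quotient.eq''.trans QuotientGroup.rightRel_apply)

theorem isLocalHomeomorph : IsLocalHomeomorph S.proj :=
  letI := S.group
  S.isQuotientCoveringMap.isCoveringMap.isLocalHomeomorph

theorem proj_surjective : Function.Surjective S.proj := fun q => Quotient.exists_rep q

/-- The charts of `Γ \ G` are the local inverses of the projection `G → Γ \ G`. -/
noncomputable instance : ChartedSpace R4 S.Quot :=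
  S.isLocalHomeomorph.chartedSpace S.proj_surjective

theorem contDiff_leftMul (b : R4) : ContDiff ℝ ∞ (S.leftMul b) :=
  S.contDiff_mul.comp (contDiff_const.prodMk contDiff_id)

instance : IsManifold 𝓘(ℝ, R4) ∞ S.Quot := by
  refine isManifold_of_contDiffOn _ _ _ ?_
  rintro e e' ⟨q, rfl⟩ ⟨q', rfl⟩
  set hf := S.isLocalHomeomorph
  set a := (S.proj_surjective.hasRightInverse).choose q
  set a' := (S.proj_surjective.hasRightInverse).choose q'
  simp only [modelWithCornersSelf_coe, modelWithCornersSelf_coe_symm, Function.comp_id,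
    Function.id_comp, Set.range_id, Set.inter_univ, Set.preimage_id, chartAt_self_eq,
    OpenPartialHomeomorph.trans_refl]
  set T := (hf.localInverseAt a).symm.trans (hf.localInverseAt a') with hT
  have hT1 : ∀ y, T y = hf.localInverseAt a' (S.proj y) := by
    intro y
    simp [hT]
  have hT2 : ∀ y ∈ T.source, S.proj (T y) = S.proj y := by
    intro y hy
    rw [hT1]
    apply hf.apply_localInverseAt_of_mem
    simpa [hT] using hy.2
  intro y hy
  let := S.group
  obtain ⟨γ, hγ, hγy⟩ := S.proj_eq_iff.mp (hT2 y hy).symm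
  obtain ⟨U, hU, hdisj⟩ := S.isQuotientCoveringMap.disjoint (T y)
  have h1 : ∀ᶠ z in 𝓝 y, T z ∈ U := (T.continuousAt hy).eventually hU
  have h2 : ∀ᶠ z in 𝓝 y, S.leftMul γ z ∈ U := by
    have := (S.contDiff_leftMul γ).continuous.continuousAt (x := y)
    exact this.eventually (by rwa [hγy])
  have h3 : ∀ᶠ z in 𝓝 y, z ∈ T.source := T.open_source.mem_nhds hy
  have h4 : T =ᶠ[𝓝 y] S.leftMul γ := by
    filter_upwards [h1, h2, h3] with z hz1 hz2 hz3
    obtain ⟨δ, hδ, hδz⟩ := S.proj_eq_iff.mp (hT2 z hz3).symm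
    have key := hdisj (⟨δ, hδ⟩ * ⟨γ, hγ⟩⁻¹) ⟨T z, ⟨S.leftMul γ z, hz2, ?_⟩, hz1⟩
    · have h5 : δ = γ := by simpa [mul_inv_eq_one] using key
      rw [← hδz, h5]
    · change (δ * γ⁻¹) * (γ * z) = T z
      rw [← hδz]
      change _ = δ * z
      simp [mul_assoc]
  exact (((S.contDiff_leftMul γ).contDiffAt).congr_of_eventuallyEq h4).contDiffWithinAt

/-- The differential at `a` of the projection `G → Γ \ G`. -/
noncomputable def dproj (a v : R4) : TangentSpace 𝓘(ℝ, R4) (S.proj a) :=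
  mfderiv 𝓘(ℝ, R4) 𝓘(ℝ, R4) S.proj a v

/-- The pullbacks of `φ₁`, `φ₂` to `G` are `E⁰ + i E¹` and `E² + i E³`, where `(Eʲ)` is the coframe
dual to the left-invariant frame `(E_j)`. -/
def IsCoframe (φ₁ φ₂ : CForm S.Quot 1) : Prop :=
  ∀ (a : R4) (j : Fin 4),
    φ₁.eval (S.proj a) (S.dproj a (S.E j a)) = ![1, Complex.I, 0, 0] j ∧
    φ₂.eval (S.proj a) (S.dproj a (S.E j a)) = ![0, 0, 1, Complex.I] j

/-- The metric is left-invariant: its pullback to `G` is invariant under all left translations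
of `G`. -/
def IsLeftInvariant {J : AlmostComplexStructure S.Quot} (g : HermitianMetric J) : Prop :=
  ∀ b a v w : R4,
    g.val (S.proj (S.leftMul b a)) (S.dproj (S.leftMul b a) (fderiv ℝ (S.leftMul b) a v))
        (S.dproj (S.leftMul b a) (fderiv ℝ (S.leftMul b) a w))
      = g.val (S.proj a) (S.dproj a v) (S.dproj a w)

/-- `V̄₁F = ½ (E₀ + i E₁) F`, computed at a point `a` of `G`; `V̄₁` is the conjugate of the first
vector of the frame dual to the `(1,0)`-coframe. -/
noncomputable def V1bar (F : S.Quot → ℝ) (a : R4) : ℂ :=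
  1 / 2 * ((fderiv ℝ (fun x => F (S.proj x)) a (S.E 0 a) : ℂ)
    + Complex.I * (fderiv ℝ (fun x => F (S.proj x)) a (S.E 1 a) : ℂ))

end FramedQuotient

/-! ### The three families of examples -/

theorem isDiscrete_integerPoints : IsDiscrete {a : R4 | ∀ i, ∃ n : ℤ, a i = n} := by
  rw [isDiscrete_iff_discreteTopology]
  refine DiscreteTopology.of_forall_le_dist (r := 1) one_pos ?_
  rintro ⟨a, ha⟩ ⟨b, hb⟩ hab
  have hne : a ≠ b := fun h => hab (Subtype.ext h)
  obtain ⟨i, hi⟩ : ∃ i, a i ≠ b i := by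
    by_contra! h
    exact hne (PiLp.ext h)
  obtain ⟨m, hm⟩ := ha i
  obtain ⟨n, hn⟩ := hb i
  have h1 : (1 : ℝ) ≤ |(m : ℝ) - n| := by
    have : m ≠ n := by
      rintro rfl
      exact hi (hm.trans hn.symm)
    exact_mod_cast Int.one_le_abs (sub_ne_zero.mpr this)
  have h2 : ‖(a - b) i‖ ≤ ‖a - b‖ := PiLp.norm_apply_le (a - b) i
  rw [Subtype.dist_eq, dist_eq_norm]
  refine le_trans ?_ h2
  simpa [hm, hn] using h1

theorem fderiv_eq_of_affine_along {f : R4 → R4} (hf : Differentiable ℝ f) {a v w : R4}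
    (h : ∀ t : ℝ, f (a + t • v) = f a + t • w) : fderiv ℝ f a v = w := by
  rw [← (hf a).lineDeriv_eq_fderiv, lineDeriv]
  simp_rw [h]
  have := ((hasDerivAt_id (0 : ℝ)).smul_const w).const_add (f a)
  simpa using this.deriv

theorem linearIndependent_of_coframe {v : Fin 4 → R4} (θ : Fin 4 → R4 →ₗ[ℝ] ℝ)
    (h : ∀ i j, θ i (v j) = if i = j then 1 else 0) : LinearIndependent ℝ v := by
  rw [Fintype.linearIndependent_iff]
  intro c hc i
  have := congrArg (θ i) hc
  simpa [map_sum, h] using this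

/-- The multiplication of `ℝ × H₃(ℝ)` in the coordinates `(t, x, y, z)`, where `(x, y, z)` stands
for the upper triangular unipotent matrix with entries `x`, `y` next to the diagonal and `z` in
the corner. -/
noncomputable def kodairaMul (a b : R4) : R4 :=
  !₂[a 0 + b 0, a 1 + b 1, a 2 + b 2, a 3 + b 3 + a 1 * b 2]

noncomputable def kodairaInv (a : R4) : R4 := !₂[-a 0, -a 1, -a 2, -a 3 + a 1 * a 2]

/-- The group `ℝ × H₃(ℝ)`. -/
noncomputable abbrev kodairaGroup : Group R4 where
  mul := kodairaMul
  one := !₂[0, 0, 0, 0]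
  inv := kodairaInv
  mul_assoc a b c := by
    change kodairaMul (kodairaMul a b) c = kodairaMul a (kodairaMul b c)
    ext i; fin_cases i <;> simp [kodairaMul] <;> ring
  one_mul a := by
    change kodairaMul !₂[0, 0, 0, 0] a = a
    ext i; fin_cases i <;> simp [kodairaMul]
  mul_one a := by
    change kodairaMul a !₂[0, 0, 0, 0] = a
    ext i; fin_cases i <;> simp [kodairaMul]
  inv_mul_cancel a := by
    change kodairaMul (kodairaInv a) a = !₂[0, 0, 0, 0]
    ext i; fin_cases i <;> simp [kodairaMul, kodairaInv]

/-- The left-invariant frame `∂_x, ∂_y + x ∂_z, ∂_z, ∂_t`. -/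
noncomputable def kodairaFrame : Fin 4 → R4 → R4 :=
  ![fun _ => !₂[0, 1, 0, 0], fun a => !₂[0, 0, 1, a 1], fun _ => !₂[0, 0, 0, 1],
    fun _ => !₂[1, 0, 0, 0]]

/-- The primary Kodaira surface `S¹ × (H₃(ℤ) \ H₃(ℝ))`, with the left-invariant frame
`∂_x, ∂_y + x ∂_z, ∂_z, ∂_t`. -/
noncomputable def kodaira : FramedQuotient where
  group := kodairaGroup
  contDiff_mul := by
    change ContDiff ℝ ∞ (fun p : R4 × R4 => kodairaMul p.1 p.2)
    rw [contDiff_euclidean]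
    intro i; fin_cases i <;> simp [kodairaMul] <;> fun_prop
  contDiff_inv := by
    change ContDiff ℝ ∞ kodairaInv
    rw [contDiff_euclidean]
    intro i; fin_cases i <;> simp [kodairaInv] <;> fun_prop
  Γ :=
    letI := kodairaGroup
    { carrier := {a | ∀ i, ∃ n : ℤ, a i = n}
      mul_mem' := by
        intro a b ha hb i
        choose m hm using ha
        choose n hn using hb
        change ∃ k : ℤ, kodairaMul a b i = k
        fin_cases i
        · exact ⟨m 0 + n 0, by simp [kodairaMul, hm, hn]⟩
        · exact ⟨m 1 + n 1, by simp [kodairaMul, hm, hn]⟩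
        · exact ⟨m 2 + n 2, by simp [kodairaMul, hm, hn]⟩
        · exact ⟨m 3 + n 3 + m 1 * n 2, by simp [kodairaMul, hm, hn]⟩
      one_mem' := by
        intro i
        change ∃ k : ℤ, (!₂[0, 0, 0, 0] : R4) i = k
        exact ⟨0, by fin_cases i <;> simp⟩
      inv_mem' := by
        intro a ha i
        choose m hm using ha
        change ∃ k : ℤ, kodairaInv a i = k
        fin_cases i
        · exact ⟨-m 0, by simp [kodairaInv, hm]⟩
        · exact ⟨-m 1, by simp [kodairaInv, hm]⟩
        · exact ⟨-m 2, by simp [kodairaInv, hm]⟩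
        · exact ⟨-m 3 + m 1 * m 2, by simp [kodairaInv, hm]⟩ }
  discrete := isDiscrete_integerPoints
  E := kodairaFrame
  basis a := by
    refine linearIndependent_of_coframe
      ![EuclideanSpace.projₗ 1, EuclideanSpace.projₗ 2,
        EuclideanSpace.projₗ 3 - a 1 • EuclideanSpace.projₗ 2, EuclideanSpace.projₗ 0] ?_
    intro i j
    fin_cases i <;> fin_cases j <;> simp [kodairaFrame]
  invariant b a j := by
    refine fderiv_eq_of_affine_along (f := kodairaMul b) ?_ ?_
    · rw [differentiable_euclidean]
      intro i; fin_cases i <;> simp [kodairaMul] <;> fun_prop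
    · intro t
      change kodairaMul b (a + t • kodairaFrame j a) = kodairaMul b a + t • kodairaFrame j (kodairaMul b a)
      fin_cases j <;> ext i <;> fin_cases i <;> simp [kodairaFrame, kodairaMul] <;> ring

/-- The multiplication of `Nil⁴`, in the coordinates `(x, y, z, t)`. -/
noncomputable def nil4Mul (a b : R4) : R4 :=
  !₂[b 0 + a 0, b 1 + a 1, b 2 + a 0 * b 1 + a 2,
    b 3 + 1 / 2 * a 0 ^ 2 * b 1 + a 0 * b 2 + a 3]

noncomputable def nil4Inv (a : R4) : R4 :=
  !₂[-a 0, -a 1, -a 2 + a 0 * a 1, -a 3 + a 0 * a 2 - 1 / 2 * a 0 ^ 2 * a 1]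

/-- The group `Nil⁴`. -/
noncomputable abbrev nil4Group : Group R4 where
  mul := nil4Mul
  one := !₂[0, 0, 0, 0]
  inv := nil4Inv
  mul_assoc a b c := by
    change nil4Mul (nil4Mul a b) c = nil4Mul a (nil4Mul b c)
    ext i; fin_cases i <;> simp [nil4Mul] <;> ring
  one_mul a := by
    change nil4Mul !₂[0, 0, 0, 0] a = a
    ext i; fin_cases i <;> simp [nil4Mul]
  mul_one a := by
    change nil4Mul a !₂[0, 0, 0, 0] = a
    ext i; fin_cases i <;> simp [nil4Mul]
  inv_mul_cancel a := by
    change nil4Mul (nil4Inv a) a = !₂[0, 0, 0, 0]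
    ext i; fin_cases i <;> simp [nil4Mul, nil4Inv] <;> ring

/-- The left-invariant frame `∂_x, ∂_y + x ∂_z + x²/2 ∂_t, ∂_z + x ∂_t, ∂_t`. -/
noncomputable def nil4Frame : Fin 4 → R4 → R4 :=
  ![fun _ => !₂[1, 0, 0, 0], fun a => !₂[0, 1, a 0, 1 / 2 * a 0 ^ 2],
    fun a => !₂[0, 0, 1, a 0], fun _ => !₂[0, 0, 0, 1]]

/-- The nilmanifold `2ℤ⁴ \ Nil⁴`, with the left-invariant frame
`∂_x, ∂_y + x ∂_z + x²/2 ∂_t, ∂_z + x ∂_t, ∂_t`. -/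
noncomputable def nil4 : FramedQuotient where
  group := nil4Group
  contDiff_mul := by
    change ContDiff ℝ ∞ (fun p : R4 × R4 => nil4Mul p.1 p.2)
    rw [contDiff_euclidean]
    intro i; fin_cases i <;> simp [nil4Mul] <;> fun_prop
  contDiff_inv := by
    change ContDiff ℝ ∞ nil4Inv
    rw [contDiff_euclidean]
    intro i; fin_cases i <;> simp [nil4Inv] <;> fun_prop
  Γ :=
    letI := nil4Group
    { carrier := {a | ∀ i, ∃ n : ℤ, a i = 2 * n}
      mul_mem' := by
        intro a b ha hb i
        choose m hm using ha
        choose n hn using hb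
        change ∃ k : ℤ, nil4Mul a b i = 2 * k
        fin_cases i
        · exact ⟨n 0 + m 0, by simp [nil4Mul, hm, hn]; ring⟩
        · exact ⟨n 1 + m 1, by simp [nil4Mul, hm, hn]; ring⟩
        · exact ⟨n 2 + 2 * m 0 * n 1 + m 2, by simp [nil4Mul, hm, hn]; ring⟩
        · exact ⟨n 3 + 2 * m 0 ^ 2 * n 1 + 2 * m 0 * n 2 + m 3, by
            simp [nil4Mul, hm, hn]; ring⟩
      one_mem' := by
        intro i
        change ∃ k : ℤ, (!₂[0, 0, 0, 0] : R4) i = 2 * k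
        exact ⟨0, by fin_cases i <;> simp⟩
      inv_mem' := by
        intro a ha i
        choose m hm using ha
        change ∃ k : ℤ, nil4Inv a i = 2 * k
        fin_cases i
        · exact ⟨-m 0, by simp [nil4Inv, hm]⟩
        · exact ⟨-m 1, by simp [nil4Inv, hm]⟩
        · exact ⟨-m 2 + 2 * m 0 * m 1, by simp [nil4Inv, hm]; ring⟩
        · exact ⟨-m 3 + 2 * m 0 * m 2 - 2 * m 0 ^ 2 * m 1, by
            simp [nil4Inv, hm]; ring⟩ }
  discrete := by
    refine isDiscrete_integerPoints.mono ?_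
    intro a ha i
    obtain ⟨n, hn⟩ := ha i
    exact ⟨2 * n, by rw [hn]; push_cast; ring⟩
  E := nil4Frame
  basis a := by
    refine linearIndependent_of_coframe
      ![EuclideanSpace.projₗ 0, EuclideanSpace.projₗ 1,
        EuclideanSpace.projₗ 2 - a 0 • EuclideanSpace.projₗ 1,
        EuclideanSpace.projₗ 3 + (1 / 2 * a 0 ^ 2) • EuclideanSpace.projₗ 1
          - a 0 • EuclideanSpace.projₗ 2] ?_
    intro i j
    fin_cases i <;> fin_cases j <;> simp [nil4Frame]
    ring
  invariant b a j := by
    refine fderiv_eq_of_affine_along (f := nil4Mul b) ?_ ?_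
    · rw [differentiable_euclidean]
      intro i; fin_cases i <;> simp [nil4Mul] <;> fun_prop
    · intro t
      change nil4Mul b (a + t • nil4Frame j a) = nil4Mul b a + t • nil4Frame j (nil4Mul b a)
      fin_cases j <;> ext i <;> fin_cases i <;> simp [nil4Frame, nil4Mul] <;> ring

/-- The multiplication of `ℝ × Sol³`, in the coordinates `(t, x, y, z)`. -/
noncomputable def solMul (a b : R4) : R4 :=
  !₂[a 0 + b 0, a 1 + b 1, a 2 + Real.exp (a 0) * b 2, a 3 + Real.exp (-a 0) * b 3]

noncomputable def solInv (a : R4) : R4 :=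
  !₂[-a 0, -a 1, -(Real.exp (-a 0) * a 2), -(Real.exp (a 0) * a 3)]

/-- The group `ℝ × Sol³`. -/
noncomputable abbrev solGroup : Group R4 where
  mul := solMul
  one := !₂[0, 0, 0, 0]
  inv := solInv
  mul_assoc a b c := by
    change solMul (solMul a b) c = solMul a (solMul b c)
    ext i; fin_cases i <;> simp [solMul, Real.exp_add] <;> ring
  one_mul a := by
    change solMul !₂[0, 0, 0, 0] a = a
    ext i; fin_cases i <;> simp [solMul]
  mul_one a := by
    change solMul a !₂[0, 0, 0, 0] = a
    ext i; fin_cases i <;> simp [solMul]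
  inv_mul_cancel a := by
    change solMul (solInv a) a = !₂[0, 0, 0, 0]
    ext i; fin_cases i <;> simp [solMul, solInv]

/-- A matrix `A ∈ SL₂(ℤ)` with `tr A ≥ 3`, together with `κ > 0` and an invertible real matrix
`P` such that `A = P⁻¹ diag(e^κ, e^{-κ}) P`. -/
structure SolParameters where
  A : Matrix.SpecialLinearGroup (Fin 2) ℤ
  trace_ge : 3 ≤ A.1.trace
  κ : ℝ
  κ_pos : 0 < κ
  P : Matrix (Fin 2) (Fin 2) ℝ
  det_ne_zero : P.det ≠ 0
  conj : A.1.map (Int.cast : ℤ → ℝ) = P⁻¹ * !![Real.exp κ, 0; 0, Real.exp (-κ)] * P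

/-- `Γ_A`, generated by `(κ,0,0,0)`, `(0,1,0,0)` and the elements `(0,0,·,·)` given by the two
columns of `P`. -/
noncomputable def SolParameters.lattice (D : SolParameters) : @Subgroup R4 solGroup :=
  letI := solGroup
  Subgroup.closure {!₂[D.κ, 0, 0, 0], !₂[0, 1, 0, 0], !₂[0, 0, D.P 0 0, D.P 1 0],
    !₂[0, 0, D.P 0 1, D.P 1 1]}

theorem SolParameters.intertwine (D : SolParameters) :
    !![Real.exp D.κ, 0; 0, Real.exp (-D.κ)] * D.P = D.P * D.A.1.map (Int.cast : ℤ → ℝ) := by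
  rw [D.conj, Matrix.mul_assoc D.P⁻¹, ← Matrix.mul_assoc D.P,
    Matrix.mul_nonsing_inv _ (isUnit_iff_ne_zero.mpr D.det_ne_zero), Matrix.one_mul]

/-- Every element of `Γ_A` is `(mκ, n, Pv)` with `m, n ∈ ℤ`, `v ∈ ℤ²`. -/
theorem SolParameters.mem_lattice (D : SolParameters) {a : R4} (ha : a ∈ D.lattice) :
    ∃ (m n : ℤ) (v : Fin 2 → ℤ), a = !₂[m * D.κ, n, D.P 0 0 * v 0 + D.P 0 1 * v 1,
      D.P 1 0 * v 0 + D.P 1 1 * v 1] := by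
  let := solGroup
  have h : ∃ (m n : ℤ) (v : Fin 2 → ℤ) (B : Matrix.SpecialLinearGroup (Fin 2) ℤ),
      a = !₂[m * D.κ, n, D.P 0 0 * v 0 + D.P 0 1 * v 1, D.P 1 0 * v 0 + D.P 1 1 * v 1] ∧
      ∀ i j, Real.exp ((![1, -1] i : ℝ) * (m * D.κ)) * D.P i j
        = D.P i 0 * B.1 0 j + D.P i 1 * B.1 1 j := by
    refine Subgroup.closure_induction (p := fun a _ => ∃ (m n : ℤ) (v : Fin 2 → ℤ)
      (B : Matrix.SpecialLinearGroup (Fin 2) ℤ), a = !₂[m * D.κ, n,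
      D.P 0 0 * v 0 + D.P 0 1 * v 1, D.P 1 0 * v 0 + D.P 1 1 * v 1] ∧
      ∀ i j, Real.exp ((![1, -1] i : ℝ) * (m * D.κ)) * D.P i j
        = D.P i 0 * B.1 0 j + D.P i 1 * B.1 1 j) ?_ ?_ ?_ ?_ ha
    · rintro x (rfl | rfl | rfl | rfl)
      · refine ⟨1, 0, 0, D.A, by simp, ?_⟩
        intro i j
        have := congrFun (congrFun D.intertwine i) j
        fin_cases i <;> simpa [Matrix.mul_apply, Fin.sum_univ_two] using this
      · refine ⟨0, 1, 0, 1, by simp, ?_⟩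
        intro i j
        fin_cases j <;> simp
      · refine ⟨0, 0, ![1, 0], 1, by simp, ?_⟩
        intro i j
        fin_cases j <;> simp
      · refine ⟨0, 0, ![0, 1], 1, by simp, ?_⟩
        intro i j
        fin_cases j <;> simp
    · refine ⟨0, 0, 0, 1, ?_, ?_⟩
      · change !₂[0, 0, 0, 0] = _
        simp
      · intro i j
        fin_cases j <;> simp
    · rintro x y - - ⟨m, n, v, B, rfl, hB⟩ ⟨m', n', v', B', rfl, hB'⟩
      refine ⟨m + m', n + n', v + B.1.mulVec v', B * B', ?_, ?_⟩
      · change solMul _ _ = _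
        have h00 := hB 0 0
        have h01 := hB 0 1
        have h10 := hB 1 0
        have h11 := hB 1 1
        simp only [Matrix.cons_val_zero, Matrix.cons_val_one, one_mul, neg_one_mul]
          at h00 h01 h10 h11
        ext i
        fin_cases i <;> simp [solMul]
        · ring
        · linear_combination v' 0 * h00 + v' 1 * h01
        · linear_combination v' 0 * h10 + v' 1 * h11
      · intro i j
        have e1 : Real.exp ((![1, -1] i : ℝ) * (((m + m' : ℤ) : ℝ) * D.κ))
            = Real.exp ((![1, -1] i : ℝ) * (m * D.κ))
              * Real.exp ((![1, -1] i : ℝ) * (m' * D.κ)) := by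
          rw [← Real.exp_add]
          push_cast
          ring_nf
        rw [e1, mul_assoc, hB' i j]
        simp only [Matrix.SpecialLinearGroup.coe_mul, Matrix.mul_apply, Fin.sum_univ_two]
        push_cast
        linear_combination (B'.1 0 j : ℝ) * hB i 0 + (B'.1 1 j : ℝ) * hB i 1
    · rintro x - ⟨m, n, v, B, rfl, hB⟩
      have hdet : (B.1 0 0 : ℝ) * B.1 1 1 - B.1 0 1 * B.1 1 0 = 1 := by
        have := B.2
        rw [Matrix.det_fin_two] at this
        exact_mod_cast this
      have key : ∀ i j, Real.exp ((![1, -1] i : ℝ) * (((-m : ℤ) : ℝ) * D.κ)) * D.P i j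
          = D.P i 0 * (B⁻¹).1 0 j + D.P i 1 * (B⁻¹).1 1 j := by
        intro i j
        have e1 : Real.exp ((![1, -1] i : ℝ) * (((-m : ℤ) : ℝ) * D.κ))
            * Real.exp ((![1, -1] i : ℝ) * (m * D.κ)) = 1 := by
          rw [← Real.exp_add, ← Real.exp_zero]
          push_cast
          ring_nf
        set x := Real.exp ((![1, -1] i : ℝ) * (((-m : ℤ) : ℝ) * D.κ))
        set y := Real.exp ((![1, -1] i : ℝ) * (m * D.κ))
        have h0 : y * D.P i 0 = _ := hB i 0
        have h1 : y * D.P i 1 = _ := hB i 1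
        have p0 : D.P i 0 = x * (D.P i 0 * B.1 0 0 + D.P i 1 * B.1 1 0) := by
          rw [← h0, ← mul_assoc, e1, one_mul]
        have p1 : D.P i 1 = x * (D.P i 0 * B.1 0 1 + D.P i 1 * B.1 1 1) := by
          rw [← h1, ← mul_assoc, e1, one_mul]
        rw [Matrix.SpecialLinearGroup.coe_inv, Matrix.adjugate_fin_two]
        fin_cases j
        · simp
          linear_combination (-B.1 1 1 : ℝ) * p0 + (B.1 1 0 : ℝ) * p1 - x * D.P i 0 * hdet
        · simp
          linear_combination (B.1 0 1 : ℝ) * p0 - (B.1 0 0 : ℝ) * p1 - x * D.P i 1 * hdet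
      refine ⟨-m, -n, -((B⁻¹).1.mulVec v), B⁻¹, ?_, key⟩
      change solInv _ = _
      have h00 := key 0 0
      have h01 := key 0 1
      have h10 := key 1 0
      have h11 := key 1 1
      simp only [Matrix.cons_val_zero, Matrix.cons_val_one, one_mul, neg_one_mul]
        at h00 h01 h10 h11
      push_cast at h00 h01 h10 h11
      simp only [neg_mul, neg_neg] at h00 h01 h10 h11
      ext i
      fin_cases i <;> simp [solInv,
        -Matrix.SpecialLinearGroup.coe_inv]
      · linear_combination (-v 0 : ℝ) * h00 - v 1 * h01
      · linear_combination (-v 0 : ℝ) * h10 - v 1 * h11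
  obtain ⟨m, n, v, -, h, -⟩ := h
  exact ⟨m, n, v, h⟩

theorem SolParameters.discrete_lattice (D : SolParameters) :
    IsDiscrete (D.lattice : Set R4) := by
  have hdet := D.det_ne_zero
  obtain ⟨δ, hδ⟩ : ∃ δ, δ = D.P 0 0 * D.P 1 1 - D.P 0 1 * D.P 1 0 := ⟨_, rfl⟩
  rw [Matrix.det_fin_two, ← hδ] at hdet
  have hκ := D.κ_pos.ne'
  let Q : R4 → R4 := fun a => !₂[a 0 / D.κ, a 1,
    (D.P 1 1 * a 2 - D.P 0 1 * a 3) / δ,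
    (D.P 0 0 * a 3 - D.P 1 0 * a 2) / δ]
  have hQ : Continuous Q := by
    have : ContDiff ℝ ∞ Q := by
      rw [contDiff_euclidean]
      intro i; fin_cases i <;> simp [Q] <;> fun_prop
    exact this.continuous
  have hinj : Function.Injective Q := by
    intro a b hab
    have h0 : Q a 0 = Q b 0 := by rw [hab]
    have h1 : Q a 1 = Q b 1 := by rw [hab]
    have h2 : Q a 2 = Q b 2 := by rw [hab]
    have h3 : Q a 3 = Q b 3 := by rw [hab]
    simp [Q] at h0 h1 h2 h3
    field_simp at h0 h2 h3
    have e2 : δ * (a 2 - b 2) = 0 := by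
      rw [hδ]
      linear_combination D.P 0 0 * h2 + D.P 0 1 * h3
    have e3 : δ * (a 3 - b 3) = 0 := by
      rw [hδ]
      linear_combination D.P 1 0 * h2 + D.P 1 1 * h3
    have f2 := sub_eq_zero.mp ((mul_eq_zero.mp e2).resolve_left hdet)
    have f3 := sub_eq_zero.mp ((mul_eq_zero.mp e3).resolve_left hdet)
    ext i
    fin_cases i <;> simp [*]
  refine (isDiscrete_integerPoints.preimage hQ.continuousOn hinj).mono ?_
  intro a ha
  obtain ⟨m, n, v, rfl⟩ := D.mem_lattice ha
  intro i
  fin_cases i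
  · exact ⟨m, by simp [Q]; field_simp⟩
  · exact ⟨n, by simp [Q]⟩
  · exact ⟨v 0, by simp [Q]; field_simp; rw [hδ]; ring⟩
  · exact ⟨v 1, by simp [Q]; field_simp; rw [hδ]; ring⟩

/-- The left-invariant frame `∂_t, ∂_x, e^t ∂_y, e^{-t} ∂_z`. -/
noncomputable def solFrame : Fin 4 → R4 → R4 :=
  ![fun _ => !₂[1, 0, 0, 0], fun _ => !₂[0, 1, 0, 0], fun a => !₂[0, 0, Real.exp (a 0), 0],
    fun a => !₂[0, 0, 0, Real.exp (-a 0)]]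

/-- The solvmanifold `M_A = Γ_A \ (ℝ × Sol³)`, with the left-invariant frame
`∂_t, ∂_x, e^t ∂_y, e^{-t} ∂_z`. -/
noncomputable def solR (D : SolParameters) : FramedQuotient where
  group := solGroup
  contDiff_mul := by
    change ContDiff ℝ ∞ (fun p : R4 × R4 => solMul p.1 p.2)
    rw [contDiff_euclidean]
    intro i; fin_cases i <;> simp [solMul] <;> fun_prop
  contDiff_inv := by
    change ContDiff ℝ ∞ solInv
    rw [contDiff_euclidean]
    intro i; fin_cases i <;> simp [solInv] <;> fun_prop
  Γ := D.lattice
  discrete := D.discrete_lattice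
  E := solFrame
  basis a := by
    refine linearIndependent_of_coframe
      ![EuclideanSpace.projₗ 0, EuclideanSpace.projₗ 1,
        Real.exp (-a 0) • EuclideanSpace.projₗ 2, Real.exp (a 0) • EuclideanSpace.projₗ 3] ?_
    intro i j
    fin_cases i <;> fin_cases j <;> simp [solFrame, ← Real.exp_add]
  invariant b a j := by
    refine fderiv_eq_of_affine_along (f := solMul b) ?_ ?_
    · rw [differentiable_euclidean]
      intro i; fin_cases i <;> simp [solMul] <;> fun_prop
    · intro t
      change solMul b (a + t • solFrame j a) = solMul b a + t • solFrame j (solMul b a)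
      fin_cases j <;> ext i <;> fin_cases i <;> simp [solFrame, solMul, Real.exp_add] <;> ring

/-! On a compact manifold a `d`-harmonic form is closed and coclosed: pairing `Δ_d α` with `α` and
integrating by parts gives `‖dα‖² + ‖d^*α‖² = 0` (`closed_of_harmonic`). Closedness does not see the
metric. In the three examples the closed `(1,0)`-forms are the line spanned by `φ¹`, so `h^{1,0}_d`
is 1 or 0 according to whether `φ¹` is coclosed, and this does depend on the metric.

Coclosedness. Put `A = g(E₀,E₀)`, `C = g(E₂,E₂)`, `w = g(E₀,E₂) + i g(E₁,E₂)`. The volume density in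
the left-invariant frame is `AC - |w|²`, and the vector dual to `φ¹`, multiplied by this density, is
`C(E₀ + iE₁) - w(E₂ + iE₃)`. Since `G` is unimodular, `d^*φ¹` is, up to a nonvanishing factor, `(E₀
+ iE₁)C - (E₂ + iE₃)w` (`dens_mul_codiff_phi₁`, `divPhi₁`). This vanishes for constant coefficients,
which gives the value 1 for left-invariant metrics; for `C = e^{2F}` and `w` constant it equals
`4e^{2F} V̄₁F`.

Closed forms. For `σ = fφ¹ + hφ²` the equation `dσ = 0` is a first-order system. The tool is
`lder_eq_zero_of_dbar`: if `(X + iY)h = 0` and `XYh = YXh`, then `X²h + Y²h = 0`, and integration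
against the conjugate of `h` gives `Xh = Yh = 0`. In the two nilpotent cases this makes `h`
constant; the equation `iE₀f - E₁f = h` exhibits that constant as a divergence, so it is 0, and then
`f` is constant. For `ℝ × Sol³` the function `f` is constant first, and then `E₀h = h` and `E₀h =
-h`.

Integration. Integrals are Lebesgue integrals over a bounded fundamental domain in `G`. The flows of
the frame fields are volume-preserving shears commuting with `Γ`, so every `E_j f` has integral zero
(`HasBoundedDomain.isInvariantIntegral`); with unimodularity this yields the two cases of Stokes'
theorem that are needed. Functions and forms on the quotient are handled through components in the
left-invariant frame, viewed as `Γ`-invariant functions on `G`, and Cartan's formula (`comp_d`)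
expresses `d` by the structure constants. -/

namespace FramedQuotient

variable (S : FramedQuotient)

/-! ### Lifts to the group, the frame on the quotient, and pullbacks of forms -/

/-- The preferred lift of a point of `Γ \ G` to `G`. -/
noncomputable def rep (p : S.Quot) : R4 := extChartAt 𝓘(ℝ, R4) p p

/-- The charts are local inverses of one map, so all chart inverses coincide with the projection. A
form can therefore be pulled back to `G` once, instead of chart by chart. -/
theorem coe_extChartAt_symm (p : S.Quot) : ⇑(extChartAt 𝓘(ℝ, R4) p).symm = S.proj := by
  funext y
  rw [extChartAt_coe_symm]
  change (((S.isLocalHomeomorph.localInverseAt _).trans (chartAt R4 _)).symm) y = _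
  simp only [chartAt_self_eq, OpenPartialHomeomorph.trans_refl,
    IsLocalHomeomorph.localInverseAt_symm]

theorem proj_rep (p : S.Quot) : S.proj (S.rep p) = p := by
  rw [← S.coe_extChartAt_symm p]
  exact extChartAt_to_inv p

theorem rep_mem_target (p : S.Quot) : S.rep p ∈ (extChartAt 𝓘(ℝ, R4) p).target :=
  mem_extChartAt_target p

theorem exists_leftMul_eq_rep (a : R4) :
    ∃ γ ∈ S.Γ, S.leftMul γ a = S.rep (S.proj a) :=
  S.proj_eq_iff.mp (S.proj_rep (S.proj a)).symm

theorem proj_leftMul {γ : R4} (hγ : γ ∈ S.Γ) (a : R4) : S.proj (S.leftMul γ a) = S.proj a :=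
  (S.proj_eq_iff.mpr ⟨γ, hγ, rfl⟩).symm

theorem differentiable_leftMul (b : R4) : Differentiable ℝ (S.leftMul b) :=
  (S.contDiff_leftMul b).differentiable (by simp)

theorem fderiv_leftMul_frame (b a : R4) (j : Fin 4) :
    fderiv ℝ (S.leftMul b) a (S.E j a) = S.E j (S.leftMul b a) :=
  S.invariant b a j

/-- Smoothness at a preferred lift is that of a chart inverse; a deck transformation carries any
other point to a preferred lift. -/
theorem contMDiff_proj : ContMDiff 𝓘(ℝ, R4) 𝓘(ℝ, R4) ∞ S.proj := by
  intro a
  obtain ⟨γ, hγ, h⟩ := S.exists_leftMul_eq_rep a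
  have h1 : S.proj = S.proj ∘ S.leftMul γ := funext fun x => (S.proj_leftMul hγ x).symm
  have h2 : ContMDiffAt 𝓘(ℝ, R4) 𝓘(ℝ, R4) ∞ S.proj (S.leftMul γ a) := by
    have := contMDiffOn_extChartAt_symm (I := 𝓘(ℝ, R4)) (n := ∞) (S.proj a)
    rw [S.coe_extChartAt_symm] at this
    rw [h]
    exact this.contMDiffAt ((isOpen_extChartAt_target (I := 𝓘(ℝ, R4)) (S.proj a)).mem_nhds
      (S.rep_mem_target _))
  rw [h1]
  exact h2.comp a (S.contDiff_leftMul γ).contMDiff.contMDiffAt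

theorem mdifferentiable_proj : MDifferentiable 𝓘(ℝ, R4) 𝓘(ℝ, R4) S.proj :=
  S.contMDiff_proj.mdifferentiable (by simp)

/-- In the preferred trivialization the differential of the projection is the differential of
the deck transformation which moves the point to the preferred lift. -/
theorem dproj_eq_fderiv {a γ : R4} (hγ : γ ∈ S.Γ) (h : S.leftMul γ a = S.rep (S.proj a))
    (v : R4) : (S.dproj a v : R4) = fderiv ℝ (S.leftMul γ) a v := by
  refine (DFunLike.congr_fun (S.mdifferentiable_proj a).mfderiv v).trans ?_
  -- Near `a` the translates by `γ` lie in the target of the chart at `proj a`, where the chart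
  -- inverts the projection; so the projection read in this chart is left translation by `γ`.
  have h3 : writtenInExtChartAt 𝓘(ℝ, R4) 𝓘(ℝ, R4) a S.proj =ᶠ[𝓝 a] S.leftMul γ := by
    have h4 : ∀ᶠ x in 𝓝 a, S.leftMul γ x ∈ (extChartAt 𝓘(ℝ, R4) (S.proj a)).target := by
      refine (S.contDiff_leftMul γ).continuous.continuousAt.eventually ?_
      rw [h]
      exact (isOpen_extChartAt_target (I := 𝓘(ℝ, R4)) (S.proj a)).mem_nhds (S.rep_mem_target _)
    filter_upwards [h4] with x hx
    have := (extChartAt 𝓘(ℝ, R4) (S.proj a)).right_inv hx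
    rw [S.coe_extChartAt_symm, S.proj_leftMul hγ] at this
    exact this
  simp only [modelWithCornersSelf_coe, Set.range_id, fderivWithin_univ]
  exact DFunLike.congr_fun h3.fderiv_eq v

/-- The left-invariant frame, as a frame of `Γ \ G`. -/
noncomputable def fr (p : S.Quot) (j : Fin 4) : TangentSpace 𝓘(ℝ, R4) p := S.E j (S.rep p)

/-- Left-invariance makes the frame descend: the deck transformation of `dproj_eq_fderiv` carries
`E_j` at `a` to `E_j` at the preferred lift. -/
theorem dproj_frame (a : R4) (j : Fin 4) : S.dproj a (S.E j a) = S.fr (S.proj a) j := by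
  obtain ⟨γ, hγ, h⟩ := S.exists_leftMul_eq_rep a
  refine (S.dproj_eq_fderiv hγ h _).trans ?_
  rw [S.fderiv_leftMul_frame, h]
  rfl

/-- The left-invariant frame as a basis of `ℝ⁴`. -/
noncomputable def frameBasis (a : R4) : Module.Basis (Fin 4) ℝ R4 :=
  basisOfLinearIndependentOfCardEqFinrank (S.basis a) (by simp)

@[simp] theorem frameBasis_apply (a : R4) (j : Fin 4) : S.frameBasis a j = S.E j a := by
  simp [frameBasis]

/-- The left-invariant frame as a basis of a tangent space of `Γ \ G`. -/
noncomputable def frBasis (p : S.Quot) : Module.Basis (Fin 4) ℝ (TangentSpace 𝓘(ℝ, R4) p) :=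
  S.frameBasis (S.rep p)

@[simp] theorem frBasis_apply (p : S.Quot) (j : Fin 4) : S.frBasis p j = S.fr p j :=
  S.frameBasis_apply _ j

/-- The components of a form in the left-invariant frame. -/
noncomputable def comp {k : ℕ} (β : CForm S.Quot k) (I : Fin k → Fin 4) (p : S.Quot) : ℂ :=
  β p (fun i => S.fr p (I i))

/-- The derivative of a function on `Γ \ G` along a vector field of the left-invariant frame. -/
noncomputable def lder (j : Fin 4) (f : S.Quot → ℂ) (p : S.Quot) : ℂ :=
  fderiv ℝ (fun x => f (S.proj x)) (S.rep p) (S.E j (S.rep p))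

/-- Smoothness of functions on `Γ \ G`, expressed on `G`. -/
def SmoothFn (f : S.Quot → ℂ) : Prop := ContDiff ℝ ∞ (fun x => f (S.proj x))

/-- The pullback of a form to `G`. -/
noncomputable def pull {k : ℕ} (β : CForm S.Quot k) (a : R4) : R4 [⋀^Fin k]→L[ℝ] ℂ :=
  (β (S.proj a)).compContinuousLinearMap (mfderiv 𝓘(ℝ, R4) 𝓘(ℝ, R4) S.proj a)

theorem inChart_eq_pull {k : ℕ} (β : CForm S.Quot k) (p : S.Quot) : β.inChart p = S.pull β := by
  funext y
  unfold CForm.inChart pull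
  rw [S.coe_extChartAt_symm]

theorem pull_apply {k : ℕ} (β : CForm S.Quot k) (a : R4) (v : Fin k → R4) :
    S.pull β a v = β (S.proj a) (fun i => S.dproj a (v i)) := rfl

theorem pull_frame {k : ℕ} (β : CForm S.Quot k) (a : R4) (I : Fin k → Fin 4) :
    S.pull β a (fun i => S.E (I i) a) = S.comp β I (S.proj a) := by
  rw [pull_apply]
  simp only [dproj_frame]
  rfl

/-- The derivative is defined at the preferred lift but may be computed at any lift, because `f ∘
proj` is `Γ`-invariant and `E_j` is left-invariant. -/
theorem lder_proj {f : S.Quot → ℂ} (hf : S.SmoothFn f) (j : Fin 4) (a : R4) :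
    S.lder j f (S.proj a) = fderiv ℝ (fun x => f (S.proj x)) a (S.E j a) := by
  obtain ⟨γ, hγ, h⟩ := S.exists_leftMul_eq_rep a
  unfold lder
  have h1 : (fun x => f (S.proj x)) = (fun x => f (S.proj x)) ∘ S.leftMul γ :=
    funext fun x => congrArg f (S.proj_leftMul hγ x).symm
  conv_rhs => rw [h1]
  rw [fderiv_comp a (hf.differentiable (by simp) _) (S.differentiable_leftMul γ a), ← h,
    ← S.fderiv_leftMul_frame]
  rfl

theorem mfderiv_extChartAt_self (p : S.Quot) (v : R4) :
    (mfderiv 𝓘(ℝ, R4) 𝓘(ℝ, R4) (extChartAt 𝓘(ℝ, R4) p) p v : R4) = v := by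
  refine (DFunLike.congr_fun (mdifferentiableAt_extChartAt (mem_chart_source R4 p)).mfderiv v).trans ?_
  exact DFunLike.congr_fun (fderivWithin_extChartAt_comp_extChartAt_symm_range (I := 𝓘(ℝ, R4))
    (x := p)) v

theorem d_eq {k : ℕ} (β : CForm S.Quot k) (p : S.Quot) (v : Fin (k + 1) → R4) :
    β.d p v = extDeriv (S.pull β) (S.rep p) v := by
  unfold CForm.d
  rw [S.inChart_eq_pull]
  refine congrArg (extDeriv (S.pull β) (S.rep p)) ?_
  funext i
  exact S.mfderiv_extChartAt_self p (v i)

end FramedQuotient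

/-! ### Smoothness of forms through components, and Cartan's formula -/

/-- The space of alternating forms on a finite-dimensional space is finite-dimensional. -/
instance finiteDimensional_continuousAlternatingMap (k : ℕ) :
    FiniteDimensional ℝ (R4 [⋀^Fin k]→L[ℝ] ℂ) := by
  let Φ : (R4 [⋀^Fin k]→L[ℝ] ℂ) →ₗ[ℝ] MultilinearMap ℝ (fun _ : Fin k => R4) ℂ :=
    { toFun := fun f => f.toMultilinearMap
      map_add' := fun _ _ => rfl
      map_smul' := fun _ _ => rfl }
  refine FiniteDimensional.of_injective Φ ?_
  intro f g h
  ext v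
  exact DFunLike.congr_fun h v

/-- A family of alternating forms is smooth if its values on a fixed basis are. -/
theorem contDiff_alternating_of_apply {k : ℕ} {f : R4 → R4 [⋀^Fin k]→L[ℝ] ℂ}
    (b : Module.Basis (Fin 4) ℝ R4)
    (h : ∀ I : Fin k → Fin 4, ContDiff ℝ ∞ (fun a => f a (fun i => b (I i)))) :
    ContDiff ℝ ∞ f := by
  let Φ : (R4 [⋀^Fin k]→L[ℝ] ℂ) →ₗ[ℝ] ((Fin k → Fin 4) → ℂ) :=
    { toFun := fun f I => f (fun i => b (I i))
      map_add' := fun _ _ => rfl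
      map_smul' := fun _ _ => rfl }
  have hinj : Function.Injective Φ := by
    intro f g hfg
    have : f.toMultilinearMap = g.toMultilinearMap :=
      Module.Basis.ext_multilinear (fun _ => b) fun I => congrFun hfg I
    ext v
    exact DFunLike.congr_fun this v
  -- Evaluation on tuples of basis vectors is injective; a fixed linear left inverse recovers `f`
  -- from its smooth components.
  obtain ⟨Ψ, hΨ⟩ := Φ.exists_leftInverse_of_injective (LinearMap.ker_eq_bot.mpr hinj)
  have h1 : ContDiff ℝ ∞ (fun a => Φ (f a)) := contDiff_pi.mpr h
  have h2 : f = fun a => Ψ.toContinuousLinearMap (Φ (f a)) := by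
    funext a
    exact (DFunLike.congr_fun hΨ (f a)).symm
  rw [h2]
  exact Ψ.toContinuousLinearMap.contDiff.comp h1

theorem contDiffAt_alternating_apply_const {k : ℕ} {f : R4 → R4 [⋀^Fin k]→L[ℝ] ℂ} {a : R4}
    (h : ContDiffAt ℝ ∞ f a) (v : Fin k → R4) : ContDiffAt ℝ ∞ (fun a => f a v) a := by
  let Φ : (R4 [⋀^Fin k]→L[ℝ] ℂ) →ₗ[ℝ] ℂ :=
    { toFun := fun f => f v
      map_add' := fun _ _ => rfl
      map_smul' := fun _ _ => rfl }
  exact Φ.toContinuousLinearMap.contDiff.contDiffAt.comp a h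

/-- Expansion of an alternating form in a basis with given coordinate functions. -/
theorem alternating_expand {k : ℕ} (f : R4 [⋀^Fin k]→L[ℝ] ℂ) {e : Fin 4 → R4}
    {θ : Fin 4 → R4 → ℝ} (h : ∀ v, v = ∑ j, θ j v • e j) (v : Fin k → R4) :
    f v = ∑ I : Fin k → Fin 4, ((∏ i, θ (I i) (v i) : ℝ) : ℂ) * f (fun i => e (I i)) := by
  have h1 : v = fun i => ∑ j, θ j (v i) • e j := funext fun i => h (v i)
  conv_lhs => rw [h1]
  have h2 := f.toMultilinearMap.map_sum (fun i j => θ j (v i) • e j)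
  refine h2.trans (Finset.sum_congr rfl fun I _ => ?_)
  refine (f.toMultilinearMap.map_smul_univ (fun i => θ (I i) (v i)) (fun i => e (I i))).trans ?_
  rw [Complex.real_smul]
  rfl

theorem contDiffAt_alternating_apply {k : ℕ} {f : R4 → R4 [⋀^Fin k]→L[ℝ] ℂ}
    {v : Fin k → R4 → R4} {a : R4} (h : ContDiffAt ℝ ∞ f a) (hv : ∀ i, ContDiffAt ℝ ∞ (v i) a) :
    ContDiffAt ℝ ∞ (fun a => f a (fun i => v i a)) a := by
  have h1 : ∀ w : R4, w = ∑ j, w j • EuclideanSpace.basisFun (Fin 4) ℝ j := by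
    intro w
    exact ((EuclideanSpace.basisFun (Fin 4) ℝ).sum_repr w).symm
  have h2 : (fun a => f a (fun i => v i a)) = fun a => ∑ I : Fin k → Fin 4,
      ((∏ i, v i a (I i) : ℝ) : ℂ) * f a (fun i => EuclideanSpace.basisFun (Fin 4) ℝ (I i)) := by
    funext a
    exact alternating_expand (f a) (θ := fun j w => w j) h1 _
  rw [h2]
  refine ContDiffAt.sum fun I _ => ContDiffAt.mul ?_ (contDiffAt_alternating_apply_const h _)
  have h3 : ContDiffAt ℝ ∞ (fun a => ∏ i, v i a (I i)) a :=
    contDiffAt_prod fun i _ => (EuclideanSpace.proj (𝕜 := ℝ) (I i)).contDiff.contDiffAt.comp a (hv i)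
  exact Complex.ofRealCLM.contDiff.contDiffAt.comp a h3

namespace FramedQuotient

variable (S : FramedQuotient)

/-- Smoothness of the frame follows from invariance: `E_j(b)` is the differential at the identity of
left translation by `b`, applied to the fixed vector `E_j(1)`. -/
theorem contDiff_frame (j : Fin 4) : ContDiff ℝ ∞ (S.E j) := by
  let := S.group
  have h1 : S.E j = fun b => fderiv ℝ (fun x => b * x) 1 (S.E j 1) := by
    funext b
    rw [S.invariant b 1 j, mul_one]
  rw [h1]
  refine ContDiff.clm_apply ?_ contDiff_const
  exact ContDiff.fderiv (f := fun b x : R4 => b * x) (g := fun _ => (1 : R4))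
    S.contDiff_mul contDiff_const (by simp)

/-- The linear map which takes the standard basis to the left-invariant frame. -/
noncomputable def frameMap (a : R4) : R4 →L[ℝ] R4 :=
  ∑ j, (EuclideanSpace.proj (𝕜 := ℝ) j : R4 →L[ℝ] ℝ).smulRight (S.E j a)

theorem frameMap_apply (a v : R4) : S.frameMap a v = ∑ j, v j • S.E j a := by
  simp [frameMap]

theorem contDiff_frameMap : ContDiff ℝ ∞ S.frameMap := by
  rw [contDiff_clm_apply_iff]
  intro v
  simp only [frameMap_apply]
  exact ContDiff.sum fun j _ => (S.contDiff_frame j).const_smul (v j)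

/-- `frameMap` as an equivalence. -/
noncomputable def frameEquiv (a : R4) : R4 ≃L[ℝ] R4 :=
  LinearEquiv.toContinuousLinearEquiv
    ((WithLp.linearEquiv 2 ℝ (Fin 4 → ℝ)).trans (S.frameBasis a).equivFun.symm)

theorem coe_frameEquiv (a : R4) : (S.frameEquiv a : R4 →L[ℝ] R4) = S.frameMap a := by
  ext1 v
  rw [frameMap_apply]
  change (S.frameBasis a).equivFun.symm v = _
  rw [Module.Basis.equivFun_symm_apply]
  simp

/-- The coframe dual to the left-invariant frame. -/
noncomputable def coframeG (j : Fin 4) (a : R4) : R4 →L[ℝ] ℝ :=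
  (EuclideanSpace.proj (𝕜 := ℝ) j : R4 →L[ℝ] ℝ).comp (S.frameMap a).inverse

theorem contDiff_coframeG (j : Fin 4) : ContDiff ℝ ∞ (S.coframeG j) := by
  refine ContDiff.clm_comp (g := fun _ => (EuclideanSpace.proj (𝕜 := ℝ) j : R4 →L[ℝ] ℝ))
    contDiff_const ?_
  rw [contDiff_iff_contDiffAt]
  intro a
  have h : ContDiffAt ℝ ∞ (ContinuousLinearMap.inverse : (R4 →L[ℝ] R4) → R4 →L[ℝ] R4)
      (S.frameMap a) := by
    rw [← S.coe_frameEquiv]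
    exact contDiffAt_map_inverse _
  exact h.comp a S.contDiff_frameMap.contDiffAt

theorem coframeG_frame (a : R4) (i j : Fin 4) :
    S.coframeG i a (S.E j a) = if i = j then 1 else 0 := by
  have h1 : S.E j a = S.frameEquiv a (EuclideanSpace.single j 1) := by
    change _ = (S.frameEquiv a : R4 →L[ℝ] R4) _
    rw [coe_frameEquiv, frameMap_apply]
    simp
  unfold coframeG
  rw [← coe_frameEquiv, ContinuousLinearMap.inverse_equiv, h1]
  simp

theorem sum_coframeG (a v : R4) : v = ∑ j, S.coframeG j a v • S.E j a := by
  have h : LinearMap.id = ∑ j, (S.coframeG j a : R4 →ₗ[ℝ] ℝ).smulRight (S.E j a) := by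
    refine (S.frameBasis a).ext fun i => ?_
    simp [coframeG_frame]
  simpa using DFunLike.congr_fun h v

theorem pull_expand {k : ℕ} (β : CForm S.Quot k) (a : R4) (v : Fin k → R4) :
    S.pull β a v = ∑ I : Fin k → Fin 4,
      ((∏ i, S.coframeG (I i) a (v i) : ℝ) : ℂ) * S.comp β I (S.proj a) := by
  rw [alternating_expand (S.pull β a) (S.sum_coframeG a)]
  simp only [pull_frame]

theorem contDiff_pull_of_comp {k : ℕ} {β : CForm S.Quot k}
    (h : ∀ I, S.SmoothFn (S.comp β I)) : ContDiff ℝ ∞ (S.pull β) := by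
  refine contDiff_alternating_of_apply (EuclideanSpace.basisFun (Fin 4) ℝ).toBasis fun J => ?_
  simp only [pull_expand]
  refine ContDiff.sum fun I _ => ContDiff.mul ?_ (h I)
  have h3 : ContDiff ℝ ∞ (fun a => ∏ i, S.coframeG (I i) a
      ((EuclideanSpace.basisFun (Fin 4) ℝ).toBasis (J i))) :=
    contDiff_prod fun i _ => (S.contDiff_coframeG (I i)).clm_apply contDiff_const
  exact Complex.ofRealCLM.contDiff.comp h3

/-- This trades smoothness in charts for smoothness of `Γ`-invariant functions on `G`. In the direct
implication a deck transformation moves the given point to its preferred lift, which lies in a chart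
target. -/
theorem isSmooth_iff_comp {k : ℕ} {β : CForm S.Quot k} :
    β.IsSmooth ↔ ∀ I, S.SmoothFn (S.comp β I) := by
  constructor
  · intro h I
    unfold SmoothFn
    rw [contDiff_iff_contDiffAt]
    intro a
    obtain ⟨γ, hγ, hγa⟩ := S.exists_leftMul_eq_rep a
    have h1 : (fun x => S.comp β I (S.proj x)) = (fun x => S.comp β I (S.proj x)) ∘ S.leftMul γ :=
      funext fun x => congrArg _ (S.proj_leftMul hγ x).symm
    rw [h1]
    refine ContDiffAt.comp a ?_ (S.contDiff_leftMul γ).contDiffAt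
    rw [hγa]
    simp only [← pull_frame]
    refine contDiffAt_alternating_apply ?_ fun i => (S.contDiff_frame _).contDiffAt
    have h2 := h (S.proj a)
    rw [inChart_eq_pull] at h2
    exact h2.contDiffAt ((isOpen_extChartAt_target (I := 𝓘(ℝ, R4)) (S.proj a)).mem_nhds
      (S.rep_mem_target _))
  · intro h p
    rw [inChart_eq_pull]
    exact (S.contDiff_pull_of_comp h).contDiffOn

theorem contDiff_pull {k : ℕ} {β : CForm S.Quot k} (h : β.IsSmooth) : ContDiff ℝ ∞ (S.pull β) :=
  S.contDiff_pull_of_comp (S.isSmooth_iff_comp.mp h)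

theorem smoothFn_lder {f : S.Quot → ℂ} (hf : S.SmoothFn f) (j : Fin 4) :
    S.SmoothFn (S.lder j f) := by
  unfold SmoothFn
  simp only [S.lder_proj hf]
  exact (ContDiff.fderiv_right hf (by simp)).clm_apply (S.contDiff_frame j)

/-- Forms with equal components are equal. -/
theorem form_ext {k : ℕ} {β β' : CForm S.Quot k} (h : ∀ I, S.comp β I = S.comp β' I) : β = β' := by
  funext p
  have : (β p).toMultilinearMap = (β' p).toMultilinearMap := by
    refine Module.Basis.ext_multilinear (fun _ => S.frBasis p) fun I => ?_
    simp only [frBasis_apply]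
    exact congrFun (h I) p
  ext v
  exact DFunLike.congr_fun this v

/-- The brackets of the left-invariant frame have structure constants `c`. -/
def HasStructureConstants (c : Fin 4 → Fin 4 → Fin 4 → ℝ) : Prop :=
  ∀ i j a, VectorField.lieBracket ℝ (S.E i) (S.E j) a = ∑ k, c i j k • S.E k a

variable {S} in
/-- Cartan's formula for the exterior derivative in the left-invariant frame. -/
theorem comp_d {c : Fin 4 → Fin 4 → Fin 4 → ℝ} (hc : S.HasStructureConstants c) {k : ℕ}
    {β : CForm S.Quot (k + 1)} (hβ : β.IsSmooth) (J : Fin (k + 2) → Fin 4) (p : S.Quot) :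
    S.comp β.d J p = ∑ i : Fin (k + 2), (-1) ^ (i : ℕ) * S.lder (J i) (S.comp β (i.removeNth J)) p -
      ∑ i : Fin (k + 1), ∑ j ≥ i, (-1) ^ (i + j : ℕ) * ∑ l, (c (J i.castSucc) (J j.succ) l : ℂ) *
        S.comp β (Matrix.vecCons l (j.removeNth (i.castSucc.removeNth J))) p := by
  have h0 : S.comp β.d J p = extDeriv (S.pull β) (S.rep p) (fun i => S.E (J i) (S.rep p)) :=
    S.d_eq β p _
  have h1 := extDeriv_apply_vectorField (V := fun i => S.E (J i))
    ((S.contDiff_pull hβ).differentiable (by simp) (S.rep p))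
    (fun i => (S.contDiff_frame (J i)).differentiable (by simp) (S.rep p))
  rw [h0, h1]
  congr 1
  · refine Finset.sum_congr rfl fun i _ => ?_
    have h2 : (fun x => S.pull β x (i.removeNth fun i => S.E (J i) x)) =
        fun x => S.comp β (i.removeNth J) (S.proj x) := by
      funext x
      exact S.pull_frame β x (i.removeNth J)
    rw [h2, zsmul_eq_mul]
    push_cast
    rfl
  · refine Finset.sum_congr rfl fun i _ => Finset.sum_congr rfl fun j _ => ?_
    rw [zsmul_eq_mul, hc]
    push_cast
    congr 1
    set v : Fin k → R4 := j.removeNth (i.castSucc.removeNth fun i => S.E (J i) (S.rep p)) with hv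
    -- The bracket occupies the first slot; currying separates that slot from the rest, so that the
    -- bracket can be expanded in the frame by linearity.
    have h3 : ∀ l, S.comp β (Matrix.vecCons l (j.removeNth (i.castSucc.removeNth J))) p =
        (S.pull β (S.rep p)).curryLeft (S.E l (S.rep p)) v := by
      intro l
      have h4 := S.pull_frame β (S.rep p)
        (Matrix.vecCons l (j.removeNth (i.castSucc.removeNth J)))
      rw [S.proj_rep] at h4
      rw [← h4, ContinuousAlternatingMap.curryLeft_apply_apply]
      congr 1
      funext m
      refine Fin.cases ?_ (fun m => ?_) m
      · rfl
      · rfl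
    simp only [h3]
    rw [← ContinuousAlternatingMap.curryLeft_apply_apply, map_sum,
      ContinuousAlternatingMap.sum_apply]
    refine Finset.sum_congr rfl fun l _ => ?_
    rw [map_smul, ContinuousAlternatingMap.smul_apply, Complex.real_smul]

end FramedQuotient

/-! ### The pointwise Hodge operator and its behaviour under change of frame -/

/-- Makes signed sums over `S₄` explicit, so that Hodge operators can be evaluated by
simplification. The list of pairs (sign, permutation) is a finite statement for `decide`; the
summand is mapped over it afterwards. -/
theorem sum_perm_four (F : (Fin 4 → Fin 4) → ℂ) :
    ∑ σ : Equiv.Perm (Fin 4), ((Equiv.Perm.sign σ : ℤ) : ℂ) * F σ =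
      F ![0, 1, 2, 3] - F ![0, 1, 3, 2] - F ![0, 2, 1, 3] + F ![0, 2, 3, 1] + F ![0, 3, 1, 2]
      - F ![0, 3, 2, 1] - F ![1, 0, 2, 3] + F ![1, 0, 3, 2] + F ![1, 2, 0, 3] - F ![1, 2, 3, 0]
      - F ![1, 3, 0, 2] + F ![1, 3, 2, 0] + F ![2, 0, 1, 3] - F ![2, 0, 3, 1] - F ![2, 1, 0, 3]
      + F ![2, 1, 3, 0] + F ![2, 3, 0, 1] - F ![2, 3, 1, 0] - F ![3, 0, 1, 2] + F ![3, 0, 2, 1]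
      + F ![3, 1, 0, 2] - F ![3, 1, 2, 0] - F ![3, 2, 0, 1] + F ![3, 2, 1, 0] := by
  have h : (Finset.univ : Finset (Equiv.Perm (Fin 4))).val.map
      (fun σ => ((Equiv.Perm.sign σ : ℤ), (σ : Fin 4 → Fin 4))) =
      {(1, ![0, 1, 2, 3]), (-1, ![0, 1, 3, 2]), (-1, ![0, 2, 1, 3]), (1, ![0, 2, 3, 1]),
       (1, ![0, 3, 1, 2]), (-1, ![0, 3, 2, 1]), (-1, ![1, 0, 2, 3]), (1, ![1, 0, 3, 2]),
       (1, ![1, 2, 0, 3]), (-1, ![1, 2, 3, 0]), (-1, ![1, 3, 0, 2]), (1, ![1, 3, 2, 0]),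
       (1, ![2, 0, 1, 3]), (-1, ![2, 0, 3, 1]), (-1, ![2, 1, 0, 3]), (1, ![2, 1, 3, 0]),
       (1, ![2, 3, 0, 1]), (-1, ![2, 3, 1, 0]), (-1, ![3, 0, 1, 2]), (1, ![3, 0, 2, 1]),
       (1, ![3, 1, 0, 2]), (-1, ![3, 1, 2, 0]), (-1, ![3, 2, 0, 1]), (1, ![3, 2, 1, 0])} := by
    decide
  have h2 := congrArg (fun m => (m.map (fun x : ℤ × (Fin 4 → Fin 4) => (x.1 : ℂ) * F x.2)).sum) h
  simp only [Multiset.map_map, Function.comp_def] at h2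
  refine Eq.trans (b := _) ?_ (h2.trans ?_)
  · rfl
  · simp
    ring

section Pointwise

variable {k l : ℕ}

/-- The pointwise Hodge operator of a frame and a family of covectors. -/
noncomputable def starAt (e : Fin 4 → R4) (θ : Fin 4 → R4 →L[ℝ] ℂ) (h : k + l = 4)
    (β : R4 [⋀^Fin k]→L[ℝ] ℂ) : R4 [⋀^Fin l]→L[ℝ] ℂ :=
  ((k.factorial * l.factorial : ℕ) : ℂ)⁻¹ • ∑ σ : Equiv.Perm (Fin 4),
    (((Equiv.Perm.sign σ : ℤ) : ℂ) * β (fun a => e (σ (Fin.cast h (Fin.castAdd l a))))) •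
    wedgeCovectors (fun b => θ (σ (Fin.cast h (Fin.natAdd k b))))

theorem wedgeCovectors_apply (θ : Fin l → R4 →L[ℝ] ℂ) (v : Fin l → R4) :
    wedgeCovectors θ v = Matrix.det (Matrix.of fun b c => θ b (v c)) := by
  unfold wedgeCovectors
  rw [ContinuousMultilinearMap.alternatization_apply_apply, ← Matrix.det_transpose,
    Matrix.det_apply]
  refine Finset.sum_congr rfl fun σ _ => ?_
  simp [Units.smul_def]

/-- A summand of the pointwise Hodge operator, up to sign. -/
noncomputable def starTerm (e : Fin 4 → R4) (θ : Fin 4 → R4 →L[ℝ] ℂ) (h : k + l = 4)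
    (β : R4 [⋀^Fin k]→L[ℝ] ℂ) (v : Fin l → R4) (f : Fin 4 → Fin 4) : ℂ :=
  β (fun a => e (f (Fin.cast h (Fin.castAdd l a)))) *
    Matrix.det (Matrix.of fun b c => θ (f (Fin.cast h (Fin.natAdd k b))) (v c))

theorem starAt_apply (e : Fin 4 → R4) (θ : Fin 4 → R4 →L[ℝ] ℂ) (h : k + l = 4)
    (β : R4 [⋀^Fin k]→L[ℝ] ℂ) (v : Fin l → R4) :
    starAt e θ h β v = ((k.factorial * l.factorial : ℕ) : ℂ)⁻¹ * ∑ σ : Equiv.Perm (Fin 4),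
      ((Equiv.Perm.sign σ : ℤ) : ℂ) * starTerm e θ h β v σ := by
  unfold starAt starTerm
  simp only [ContinuousAlternatingMap.smul_apply, ContinuousAlternatingMap.sum_apply,
    wedgeCovectors_apply, smul_eq_mul, mul_assoc]

theorem alternating_two (f : R4 [⋀^Fin 2]→L[ℝ] ℂ) (a b : R4) : f ![b, a] = -f ![a, b] := by
  refine Eq.trans (congrArg f ?_) (f.map_swap ![a, b] (i := 0) (j := 1) (by decide))
  funext i
  fin_cases i <;> rfl

theorem alternating_three (f : R4 [⋀^Fin 3]→L[ℝ] ℂ) (a b c : R4) :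
    f ![b, a, c] = -f ![a, b, c] ∧ f ![a, c, b] = -f ![a, b, c] := by
  constructor
  · refine Eq.trans (congrArg f ?_) (f.map_swap ![a, b, c] (i := 0) (j := 1) (by decide))
    funext i
    fin_cases i <;> rfl
  · refine Eq.trans (congrArg f ?_) (f.map_swap ![a, b, c] (i := 1) (j := 2) (by decide))
    funext i
    fin_cases i <;> rfl

theorem alternating_three_perms (f : R4 [⋀^Fin 3]→L[ℝ] ℂ) (a b c : R4) :
    f ![b, a, c] = -f ![a, b, c] ∧ f ![a, c, b] = -f ![a, b, c] ∧ f ![b, c, a] = f ![a, b, c] ∧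
      f ![c, a, b] = f ![a, b, c] ∧ f ![c, b, a] = -f ![a, b, c] := by
  have h1 := alternating_three f a b c
  have h2 := (alternating_three f b a c).2
  have h3 := (alternating_three f a c b).1
  have h4 := (alternating_three f b c a).1
  refine ⟨h1.1, h1.2, ?_, ?_, ?_⟩
  · rw [h2, h1.1, neg_neg]
  · rw [h3, h1.2, neg_neg]
  · rw [h4, h2, h1.1, neg_neg]

variable {e : Fin 4 → R4} {θ : Fin 4 → R4 →L[ℝ] ℂ}

/-- By antisymmetry each of the 24 permutations contributes `β e`, which the factor `1/(4! 0!)`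
compensates. -/
theorem starAt_four (β : R4 [⋀^Fin 4]→L[ℝ] ℂ) (v : Fin 0 → R4) :
    starAt e θ (show 4 + 0 = 4 from rfl) β v = β e := by
  rw [starAt_apply]
  have h : ∀ σ : Equiv.Perm (Fin 4), β (fun a => e (σ (Fin.cast (show 4 + 0 = 4 from rfl)
      (Fin.castAdd 0 a)))) = ((Equiv.Perm.sign σ : ℤ) : ℂ) * β e := by
    intro σ
    refine (β.map_perm e σ).trans ?_
    rw [Units.smul_def, zsmul_eq_mul]
    rfl
  have h2 : ∀ σ : Equiv.Perm (Fin 4),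
      ((Equiv.Perm.sign σ : ℤ) : ℂ) * ((Equiv.Perm.sign σ : ℤ) : ℂ) = 1 := by
    intro σ
    rw [← Int.cast_mul, Int.units_coe_mul_self, Int.cast_one]
  simp only [starTerm, h, Matrix.det_fin_zero, mul_one]
  simp only [← mul_assoc, h2, one_mul]
  simp [Fintype.card_perm, Nat.factorial]

/-- Together with `starAt_two` and `starAt_three` this is the table of `*` in an oriented
orthonormal frame. For each entry exactly `k! l!` permutations survive, and their contributions are
equal. -/
theorem starAt_one (hθ : ∀ i j, θ i (e j) = if i = j then 1 else 0) (α : R4 [⋀^Fin 1]→L[ℝ] ℂ) :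
    starAt e θ (show 1 + 3 = 4 from rfl) α ![e 1, e 2, e 3] = α ![e 0] ∧
    starAt e θ (show 1 + 3 = 4 from rfl) α ![e 0, e 2, e 3] = -α ![e 1] ∧
    starAt e θ (show 1 + 3 = 4 from rfl) α ![e 0, e 1, e 3] = α ![e 2] ∧
    starAt e θ (show 1 + 3 = 4 from rfl) α ![e 0, e 1, e 2] = -α ![e 3] := by
  obtain ⟨A, hA⟩ : ∃ A : R4 → ℂ, ∀ f, α f = A (f 0) :=
    ⟨fun x => α ![x], fun f => congrArg α (by funext i; fin_cases i; rfl)⟩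
  refine ⟨?_, ?_, ?_, ?_⟩ <;>
  · rw [starAt_apply, sum_perm_four]
    simp [starTerm, Matrix.det_fin_three, hθ, Nat.factorial, hA]
    ring

theorem starAt_two (hθ : ∀ i j, θ i (e j) = if i = j then 1 else 0) (β : R4 [⋀^Fin 2]→L[ℝ] ℂ) :
    starAt e θ (show 2 + 2 = 4 from rfl) β ![e 0, e 1] = β ![e 2, e 3] ∧
    starAt e θ (show 2 + 2 = 4 from rfl) β ![e 0, e 2] = -β ![e 1, e 3] ∧
    starAt e θ (show 2 + 2 = 4 from rfl) β ![e 0, e 3] = β ![e 1, e 2] ∧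
    starAt e θ (show 2 + 2 = 4 from rfl) β ![e 1, e 2] = β ![e 0, e 3] ∧
    starAt e θ (show 2 + 2 = 4 from rfl) β ![e 1, e 3] = -β ![e 0, e 2] ∧
    starAt e θ (show 2 + 2 = 4 from rfl) β ![e 2, e 3] = β ![e 0, e 1] := by
  obtain ⟨A, hA, hA'⟩ : ∃ A : R4 → R4 → ℂ, (∀ f, β f = A (f 0) (f 1)) ∧ ∀ x y, A y x = -A x y :=
    ⟨fun x y => β ![x, y], fun f => congrArg β (by funext i; fin_cases i <;> rfl),
      alternating_two β⟩
  refine ⟨?_, ?_, ?_, ?_, ?_, ?_⟩ <;>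
  · rw [starAt_apply, sum_perm_four]
    simp [starTerm, Matrix.det_fin_two, hθ, Nat.factorial, hA, hA' (e 0) (e 1), hA' (e 0) (e 2),
      hA' (e 0) (e 3), hA' (e 1) (e 2), hA' (e 1) (e 3), hA' (e 2) (e 3)]
    ring

theorem starAt_three (hθ : ∀ i j, θ i (e j) = if i = j then 1 else 0) (ξ : R4 [⋀^Fin 3]→L[ℝ] ℂ) :
    starAt e θ (show 3 + 1 = 4 from rfl) ξ ![e 0] = -ξ ![e 1, e 2, e 3] ∧
    starAt e θ (show 3 + 1 = 4 from rfl) ξ ![e 1] = ξ ![e 0, e 2, e 3] ∧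
    starAt e θ (show 3 + 1 = 4 from rfl) ξ ![e 2] = -ξ ![e 0, e 1, e 3] ∧
    starAt e θ (show 3 + 1 = 4 from rfl) ξ ![e 3] = ξ ![e 0, e 1, e 2] := by
  obtain ⟨A, hA, hA'⟩ : ∃ A : R4 → R4 → R4 → ℂ, (∀ f, ξ f = A (f 0) (f 1) (f 2)) ∧
      ∀ x y z, A y x z = -A x y z ∧ A x z y = -A x y z ∧ A y z x = A x y z ∧
        A z x y = A x y z ∧ A z y x = -A x y z :=
    ⟨fun x y z => ξ ![x, y, z], fun f => congrArg ξ (by funext i; fin_cases i <;> rfl),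
      alternating_three_perms ξ⟩
  have h0 := hA' (e 1) (e 2) (e 3)
  have h1 := hA' (e 0) (e 2) (e 3)
  have h2 := hA' (e 0) (e 1) (e 3)
  have h3 := hA' (e 0) (e 1) (e 2)
  refine ⟨?_, ?_, ?_, ?_⟩ <;>
  · rw [starAt_apply, sum_perm_four]
    simp [starTerm, hθ, Nat.factorial, hA, h0, h1, h2, h3]
    ring

end Pointwise

/-- A top-degree alternating map on two frames. -/
theorem alternating_top_transfer (b : Module.Basis (Fin 4) ℝ R4) (A : R4 [⋀^Fin 4]→ₗ[ℝ] ℂ)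
    (E : Fin 4 → R4) : A E = (b.det E : ℂ) * A b := by
  have hre := DFunLike.congr_fun ((Complex.reLm.compAlternatingMap A).eq_smul_basis_det b) E
  have him := DFunLike.congr_fun ((Complex.imLm.compAlternatingMap A).eq_smul_basis_det b) E
  simp only [LinearMap.compAlternatingMap_apply, AlternatingMap.smul_apply, smul_eq_mul,
    Complex.reLm_coe, Complex.imLm_coe] at hre him
  apply Complex.ext
  · rw [hre, Complex.re_ofReal_mul, mul_comm]
  · rw [him, Complex.im_ofReal_mul, mul_comm]

section

variable {k l : ℕ} (h : k + l = 4)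

/-- The product of two multilinear forms of complementary degrees. -/
noncomputable def multilinearProd (β : MultilinearMap ℝ (fun _ : Fin k => R4) ℂ)
    (δ : MultilinearMap ℝ (fun _ : Fin l => R4) ℂ) : MultilinearMap ℝ (fun _ : Fin 4 => R4) ℂ :=
  ((LinearMap.mul' ℝ ℂ).compMultilinearMap (β.domCoprod δ)).domDomCongr
    (finSumFinEquiv.trans (finCongr h))

theorem multilinearProd_apply (β : MultilinearMap ℝ (fun _ : Fin k => R4) ℂ)
    (δ : MultilinearMap ℝ (fun _ : Fin l => R4) ℂ) (x : Fin 4 → R4) :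
    multilinearProd h β δ x = β (fun a => x (Fin.cast h (Fin.castAdd l a))) *
      δ (fun b => x (Fin.cast h (Fin.natAdd k b))) := by
  rfl

/-- `x ↦ det (B (x_b, v_c))`. -/
noncomputable def detForm (B : R4 →L[ℝ] R4 →L[ℝ] ℝ) (v : Fin l → R4) :
    MultilinearMap ℝ (fun _ : Fin l => R4) ℂ :=
  Complex.ofRealCLM.toLinearMap.compMultilinearMap
    (((Matrix.detRowAlternating : (Fin l → ℝ) [⋀^Fin l]→ₗ[ℝ] ℝ).compLinearMap
      (LinearMap.pi fun c => (B.flip (v c)).toLinearMap)).toMultilinearMap)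

theorem detForm_apply (B : R4 →L[ℝ] R4 →L[ℝ] ℝ) (v x : Fin l → R4) :
    detForm B v x = Matrix.det (Matrix.of fun b c => (B (x b) (v c) : ℂ)) := by
  have h1 : detForm B v x = ((Matrix.det (Matrix.of fun b c => B (x b) (v c)) : ℝ) : ℂ) := rfl
  rw [h1, ← Complex.ofRealHom_eq_coe, RingHom.map_det]
  rfl

/-- The pointwise Hodge operator, computed in an arbitrary frame. -/
theorem starAt_change_frame (B : R4 →L[ℝ] R4 →L[ℝ] ℝ) (b : Module.Basis (Fin 4) ℝ R4)
    (E : Fin 4 → R4) (β : R4 [⋀^Fin k]→L[ℝ] ℂ) (v : Fin l → R4) :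
    (b.det E : ℂ) * starAt b (fun i => Complex.ofRealCLM.comp (B (b i))) h β v =
      starAt E (fun i => Complex.ofRealCLM.comp (B (E i))) h β v := by
  -- As a function of the frame `x` the sum is the alternatization of `β ⊗ det B(·, v)`, a form of
  -- top degree, so changing the frame only multiplies it by a determinant. The covectors are `B(xᵢ,
  -- ·)` and not the dual coframe; hence `E` need not be orthonormal.
  have key : ∀ x : Fin 4 → R4, ∑ σ : Equiv.Perm (Fin 4), ((Equiv.Perm.sign σ : ℤ) : ℂ) *
      starTerm x (fun i => Complex.ofRealCLM.comp (B (x i))) h β v σ =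
      MultilinearMap.alternatization
        (multilinearProd h β.toMultilinearMap (detForm B v)) x := by
    intro x
    rw [MultilinearMap.alternatization_apply]
    refine Finset.sum_congr rfl fun σ _ => ?_
    rw [Units.smul_def, zsmul_eq_mul, MultilinearMap.domDomCongr_apply, multilinearProd_apply,
      detForm_apply]
    rfl
  rw [starAt_apply, starAt_apply, key, key, alternating_top_transfer b _ E]
  ring

end

/-- `(τ ∧ κ)(v₀, …, v₃)` for a `1`-form `τ` and a `3`-form `κ`. -/
noncomputable def wedge13 (τ : R4 [⋀^Fin 1]→L[ℝ] ℂ) (κ : R4 [⋀^Fin 3]→L[ℝ] ℂ) (v : Fin 4 → R4) : ℂ :=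
  τ ![v 0] * κ ![v 1, v 2, v 3] - τ ![v 1] * κ ![v 0, v 2, v 3]
    + τ ![v 2] * κ ![v 0, v 1, v 3] - τ ![v 3] * κ ![v 0, v 1, v 2]

/-- `(β ∧ γ)(v₀, …, v₃)` for `2`-forms `β`, `γ`. -/
noncomputable def wedge22 (β γ : R4 [⋀^Fin 2]→L[ℝ] ℂ) (v : Fin 4 → R4) : ℂ :=
  β ![v 0, v 1] * γ ![v 2, v 3] - β ![v 0, v 2] * γ ![v 1, v 3] + β ![v 0, v 3] * γ ![v 1, v 2]
    + β ![v 1, v 2] * γ ![v 0, v 3] - β ![v 1, v 3] * γ ![v 0, v 2] + β ![v 2, v 3] * γ ![v 0, v 1]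

/-- A summand of the alternatization of a product, up to sign. -/
noncomputable def prodTerm {k l : ℕ} (h : k + l = 4)
    (β : MultilinearMap ℝ (fun _ : Fin k => R4) ℂ) (δ : MultilinearMap ℝ (fun _ : Fin l => R4) ℂ)
    (v : Fin 4 → R4) (f : Fin 4 → Fin 4) : ℂ :=
  β (fun a => v (f (Fin.cast h (Fin.castAdd l a)))) *
    δ (fun b => v (f (Fin.cast h (Fin.natAdd k b))))

theorem multilinear_alternatization_apply {k l : ℕ} (h : k + l = 4)
    (β : MultilinearMap ℝ (fun _ : Fin k => R4) ℂ) (δ : MultilinearMap ℝ (fun _ : Fin l => R4) ℂ)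
    (v : Fin 4 → R4) :
    MultilinearMap.alternatization (multilinearProd h β δ) v =
      ∑ σ : Equiv.Perm (Fin 4), ((Equiv.Perm.sign σ : ℤ) : ℂ) *
        prodTerm h β δ v σ := by
  rw [MultilinearMap.alternatization_apply]
  refine Finset.sum_congr rfl fun σ _ => ?_
  rw [Units.smul_def, zsmul_eq_mul, MultilinearMap.domDomCongr_apply, multilinearProd_apply,
    prodTerm]

/-- Top-degree forms scale by the determinant. This and `wedge22_transfer` carry identities checked
in an orthonormal frame to the left-invariant frame, in which `d` is computed. -/
theorem wedge13_transfer (b : Module.Basis (Fin 4) ℝ R4) (τ : R4 [⋀^Fin 1]→L[ℝ] ℂ)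
    (κ : R4 [⋀^Fin 3]→L[ℝ] ℂ) (E : Fin 4 → R4) :
    wedge13 τ κ E = (b.det E : ℂ) * wedge13 τ κ b := by
  -- The 24 terms of the alternatization repeat each `(1,3)`-shuffle `1! 3! = 6` times.
  have key : ∀ v, MultilinearMap.alternatization (multilinearProd (show 1 + 3 = 4 from rfl)
      τ.toMultilinearMap κ.toMultilinearMap) v = 6 * wedge13 τ κ v := by
    intro v
    rw [multilinear_alternatization_apply, sum_perm_four]
    obtain ⟨A, hA⟩ : ∃ A : R4 → ℂ, ∀ f, τ.toMultilinearMap f = A (f 0) :=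
      ⟨fun x => τ ![x], fun f => congrArg τ (by funext i; fin_cases i; rfl)⟩
    obtain ⟨K, hK, hK'⟩ : ∃ A : R4 → R4 → R4 → ℂ, (∀ f, κ.toMultilinearMap f = A (f 0) (f 1) (f 2)) ∧
        ∀ x y z, A y x z = -A x y z ∧ A x z y = -A x y z ∧ A y z x = A x y z ∧
          A z x y = A x y z ∧ A z y x = -A x y z :=
      ⟨fun x y z => κ ![x, y, z], fun f => congrArg κ (by funext i; fin_cases i <;> rfl),
        alternating_three_perms κ⟩
    have hA2 : ∀ f, τ f = A (f 0) := hA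
    have hK2 : ∀ f, κ f = K (f 0) (f 1) (f 2) := hK
    have h0 := hK' (v 1) (v 2) (v 3)
    have h1 := hK' (v 0) (v 2) (v 3)
    have h2 := hK' (v 0) (v 1) (v 3)
    have h3 := hK' (v 0) (v 1) (v 2)
    simp [prodTerm, wedge13, hA, hK, hA2, hK2, h0, h1, h2, h3]
    ring
  have h1 := alternating_top_transfer b (MultilinearMap.alternatization
    (multilinearProd (show 1 + 3 = 4 from rfl) τ.toMultilinearMap κ.toMultilinearMap)) E
  rw [key, key] at h1
  linear_combination h1 / 6

theorem wedge22_transfer (b : Module.Basis (Fin 4) ℝ R4) (β γ : R4 [⋀^Fin 2]→L[ℝ] ℂ)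
    (E : Fin 4 → R4) :
    wedge22 β γ E = (b.det E : ℂ) * wedge22 β γ b := by
  -- Each `(2,2)`-shuffle occurs `2! 2! = 4` times.
  have key : ∀ v, MultilinearMap.alternatization (multilinearProd (show 2 + 2 = 4 from rfl)
      β.toMultilinearMap γ.toMultilinearMap) v = 4 * wedge22 β γ v := by
    intro v
    rw [multilinear_alternatization_apply, sum_perm_four]
    have hex : ∀ β : R4 [⋀^Fin 2]→L[ℝ] ℂ, ∃ A : R4 → R4 → ℂ,
        (∀ f, β.toMultilinearMap f = A (f 0) (f 1)) ∧ ∀ x y, A y x = -A x y := fun β =>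
      ⟨fun x y => β ![x, y], fun f => congrArg β (by funext i; fin_cases i <;> rfl),
        alternating_two β⟩
    obtain ⟨A, hA, hA'⟩ := hex β
    obtain ⟨C, hC, hC'⟩ := hex γ
    have hA2 : ∀ f, β f = A (f 0) (f 1) := hA
    have hC2 : ∀ f, γ f = C (f 0) (f 1) := hC
    simp [prodTerm, wedge22, hA, hC, hA2, hC2, hA' (v 0) (v 1), hA' (v 0) (v 2), hA' (v 0) (v 3),
      hA' (v 1) (v 2), hA' (v 1) (v 3), hA' (v 2) (v 3), hC' (v 0) (v 1), hC' (v 0) (v 2),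
      hC' (v 0) (v 3), hC' (v 1) (v 2), hC' (v 1) (v 3), hC' (v 2) (v 3)]
    ring
  have h1 := alternating_top_transfer b (MultilinearMap.alternatization
    (multilinearProd (show 2 + 2 = 4 from rfl) β.toMultilinearMap γ.toMultilinearMap)) E
  rw [key, key] at h1
  linear_combination h1 / 4

section

variable {B : R4 →L[ℝ] R4 →L[ℝ] ℝ} {e : Fin 4 → R4}

theorem linearIndependent_of_orthonormal (he : ∀ i j, B (e i) (e j) = if i = j then 1 else 0) :
    LinearIndependent ℝ e :=
  linearIndependent_of_coframe (fun i => (B (e i)).toLinearMap) he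

/-- A basis of `ℝ⁴` which is orthonormal with respect to a bilinear form. -/
noncomputable def orthoBasis (he : ∀ i j, B (e i) (e j) = if i = j then 1 else 0) :
    Module.Basis (Fin 4) ℝ R4 :=
  basisOfLinearIndependentOfCardEqFinrank (linearIndependent_of_orthonormal he) (by simp)

theorem coe_orthoBasis (he : ∀ i j, B (e i) (e j) = if i = j then 1 else 0) :
    ⇑(orthoBasis he) = e := by
  simp [orthoBasis]

theorem orthoBasis_repr (he : ∀ i j, B (e i) (e j) = if i = j then 1 else 0) (v : R4)
    (i : Fin 4) : (orthoBasis he).repr v i = B (e i) v := by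
  conv_rhs => rw [← (orthoBasis he).sum_repr v]
  simp [coe_orthoBasis, he]

theorem ortho_expand (he : ∀ i j, B (e i) (e j) = if i = j then 1 else 0) (v : R4) :
    v = ∑ i, B (e i) v • e i := by
  conv_lhs => rw [← (orthoBasis he).sum_repr v]
  simp [coe_orthoBasis, orthoBasis_repr]

theorem ortho_inner (he : ∀ i j, B (e i) (e j) = if i = j then 1 else 0) (v w : R4) :
    B v w = ∑ i, B (e i) v * B (e i) w := by
  conv_lhs => rw [ortho_expand he v]
  simp

/-- The determinant of a frame of the form `(X, JX, Y, JY)` with respect to an orthonormal frame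
of the same form. -/
theorem adapted_det {J : R4 →L[ℝ] R4} (hJ : ∀ v, J (J v) = -v) (hBJ : ∀ v w, B (J v) (J w) = B v w)
    (he : ∀ i j, B (e i) (e j) = if i = j then 1 else 0) (he1 : e 1 = J (e 0)) (he3 : e 3 = J (e 2))
    {E : Fin 4 → R4} (hE1 : E 1 = J (E 0)) (hE3 : E 3 = J (E 2)) :
    (orthoBasis he).det E = B (E 0) (E 0) * B (E 2) (E 2) - B (E 0) (E 2) ^ 2 - B (E 1) (E 2) ^ 2 ∧
    0 ≤ (orthoBasis he).det E := by
  have skew : ∀ v w, B v (J w) = - B (J v) w := by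
    intro v w
    have h := hBJ v (J w)
    rw [hJ, map_neg] at h
    linarith
  have h0 : ∀ w, B (e 0) (J w) = -B (e 1) w := fun w => by rw [skew, he1]
  have h1 : ∀ w, B (e 1) (J w) = B (e 0) w := fun w => by rw [he1, hBJ]
  have h2 : ∀ w, B (e 2) (J w) = -B (e 3) w := fun w => by rw [skew, he3]
  have h3 : ∀ w, B (e 3) (J w) = B (e 2) w := fun w => by rw [he3, hBJ]
  -- The change of frame is complex linear, and the real determinant of a complex `2 × 2` matrix is
  -- `|det_ℂ|²`; the squares below come from the real and imaginary parts of `det_ℂ`. This gives the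
  -- sign, and a volume density that is polynomial in the metric, without a square root.
  have key : (orthoBasis he).det E = (B (e 0) (E 0) * B (e 2) (E 2) - B (e 1) (E 0) * B (e 3) (E 2)
      - B (e 2) (E 0) * B (e 0) (E 2) + B (e 3) (E 0) * B (e 1) (E 2)) ^ 2
      + (B (e 0) (E 0) * B (e 3) (E 2) + B (e 1) (E 0) * B (e 2) (E 2)
        - B (e 2) (E 0) * B (e 1) (E 2) - B (e 3) (E 0) * B (e 0) (E 2)) ^ 2 := by
    rw [Module.Basis.det_apply, Matrix.det_succ_row_zero]
    simp [Fin.sum_univ_four, Matrix.det_fin_three, Module.Basis.toMatrix_apply, orthoBasis_repr,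
      Fin.succAbove, hE1, hE3, h0, h1, h2, h3]
    ring
  constructor
  · rw [key, ortho_inner he (E 0) (E 0), ortho_inner he (E 2) (E 2), ortho_inner he (E 0) (E 2),
      ortho_inner he (E 1) (E 2)]
    simp only [Fin.sum_univ_four, hE1, h0, h1, h2, h3]
    ring
  · rw [key]
    positivity

end

/-! ### Calculus with components and the exterior derivative in each degree -/

namespace FramedQuotient

variable {S : FramedQuotient}

theorem SmoothFn.continuous {f : S.Quot → ℂ} (hf : S.SmoothFn f) :
    Continuous (fun x => f (S.proj x)) := ContDiff.continuous hf

theorem smoothFn_const (z : ℂ) : S.SmoothFn (fun _ => z) := contDiff_const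

theorem SmoothFn.add {f g : S.Quot → ℂ} (hf : S.SmoothFn f) (hg : S.SmoothFn g) :
    S.SmoothFn (fun p => f p + g p) := ContDiff.add hf hg

theorem SmoothFn.sub {f g : S.Quot → ℂ} (hf : S.SmoothFn f) (hg : S.SmoothFn g) :
    S.SmoothFn (fun p => f p - g p) := ContDiff.sub hf hg

theorem SmoothFn.neg {f : S.Quot → ℂ} (hf : S.SmoothFn f) :
    S.SmoothFn (fun p => -f p) := ContDiff.neg hf

theorem SmoothFn.mul {f g : S.Quot → ℂ} (hf : S.SmoothFn f) (hg : S.SmoothFn g) :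
    S.SmoothFn (fun p => f p * g p) := ContDiff.mul hf hg

theorem SmoothFn.sum {ι : Type*} {s : Finset ι} {f : ι → S.Quot → ℂ}
    (hf : ∀ i ∈ s, S.SmoothFn (f i)) : S.SmoothFn (fun p => ∑ i ∈ s, f i p) := ContDiff.sum hf

theorem SmoothFn.prod {ι : Type*} {s : Finset ι} {f : ι → S.Quot → ℂ}
    (hf : ∀ i ∈ s, S.SmoothFn (f i)) : S.SmoothFn (fun p => ∏ i ∈ s, f i p) := contDiff_prod hf

theorem SmoothFn.inv {f : S.Quot → ℂ} (hf : S.SmoothFn f) (h : ∀ p, f p ≠ 0) :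
    S.SmoothFn (fun p => (f p)⁻¹) := ContDiff.inv hf fun x => h (S.proj x)

theorem SmoothFn.conj {f : S.Quot → ℂ} (hf : S.SmoothFn f) :
    S.SmoothFn (fun p => (starRingEnd ℂ) (f p)) :=
  Complex.conjCLE.toContinuousLinearMap.contDiff.comp hf

theorem SmoothFn.det {l : ℕ} {m : Fin l → Fin l → S.Quot → ℂ}
    (hm : ∀ i j, S.SmoothFn (m i j)) :
    S.SmoothFn (fun p => Matrix.det (Matrix.of fun i j => m i j p)) := by
  simp only [Matrix.det_apply']
  exact SmoothFn.sum fun σ _ => (smoothFn_const _).mul (SmoothFn.prod fun i _ => hm (σ i) i)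

theorem SmoothFn.differentiableAt {f : S.Quot → ℂ} (hf : S.SmoothFn f) (a : R4) :
    DifferentiableAt ℝ (fun x => f (S.proj x)) a := ContDiff.differentiable hf (by simp) a

theorem lder_add {f g : S.Quot → ℂ} (hf : S.SmoothFn f) (hg : S.SmoothFn g) (j : Fin 4)
    (p : S.Quot) : S.lder j (fun p => f p + g p) p = S.lder j f p + S.lder j g p := by
  unfold lder
  rw [fderiv_fun_add (hf.differentiableAt _) (hg.differentiableAt _)]
  rfl

theorem lder_sub {f g : S.Quot → ℂ} (hf : S.SmoothFn f) (hg : S.SmoothFn g) (j : Fin 4)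
    (p : S.Quot) : S.lder j (fun p => f p - g p) p = S.lder j f p - S.lder j g p := by
  unfold lder
  rw [fderiv_fun_sub (hf.differentiableAt _) (hg.differentiableAt _)]
  rfl

theorem lder_mul {f g : S.Quot → ℂ} (hf : S.SmoothFn f) (hg : S.SmoothFn g) (j : Fin 4)
    (p : S.Quot) : S.lder j (fun p => f p * g p) p = f p * S.lder j g p + S.lder j f p * g p := by
  unfold lder
  rw [fderiv_fun_mul (hf.differentiableAt _) (hg.differentiableAt _)]
  simp only [add_apply, smul_apply, smul_eq_mul, S.proj_rep]
  ring

theorem lder_const (z : ℂ) (j : Fin 4) (p : S.Quot) : S.lder j (fun _ => z) p = 0 := by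
  simp [lder]

theorem lder_const_mul {f : S.Quot → ℂ} (hf : S.SmoothFn f) (z : ℂ) (j : Fin 4) (p : S.Quot) :
    S.lder j (fun p => z * f p) p = z * S.lder j f p := by
  rw [lder_mul (smoothFn_const z) hf, lder_const]
  ring

theorem lder_conj {f : S.Quot → ℂ} (hf : S.SmoothFn f) (j : Fin 4) (p : S.Quot) :
    S.lder j (fun p => (starRingEnd ℂ) (f p)) p = (starRingEnd ℂ) (S.lder j f p) := by
  unfold lder
  have h := (Complex.conjCLE.toContinuousLinearMap.hasFDerivAt.comp (S.rep p)
    (hf.differentiableAt (S.rep p)).hasFDerivAt).fderiv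
  exact DFunLike.congr_fun h _

/-- The exterior derivative of a function. -/
theorem comp_d_zero {u : CForm S.Quot 0} (hu : u.IsSmooth) (j : Fin 4) (p : S.Quot) :
    S.comp u.d ![j] p = S.lder j (S.comp u ![]) p := by
  have h0 : S.comp u.d ![j] p = extDeriv (S.pull u) (S.rep p) (fun i => S.E (![j] i) (S.rep p)) :=
    S.d_eq u p _
  have h1 := (S.contDiff_pull hu).differentiable (by simp) (S.rep p)
  rw [h0, extDeriv_apply h1]
  simp only [Nat.reduceAdd, Finset.univ_unique, Fin.default_eq_zero, Finset.sum_singleton,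
    Fin.val_zero, pow_zero, one_smul]
  unfold lder
  have h2 : (fun x => S.comp u ![] (S.proj x)) = fun x => S.pull u x ![] := by
    funext x
    rw [← S.pull_frame]
    exact congrArg _ (Subsingleton.elim _ _)
  rw [h2]
  refine congrArg (fun F : R4 → ℂ => fderiv ℝ F (S.rep p) (S.E j (S.rep p))) (funext fun x => ?_)
  exact congrArg _ (Subsingleton.elim _ _)

/-- The complex conjugate of a form. -/
noncomputable def conjForm {k : ℕ} (β : CForm S.Quot k) : CForm S.Quot k := fun p =>
  Complex.conjCLE.toContinuousLinearMap.compContinuousAlternatingMap (β p)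

theorem comp_conjForm {k : ℕ} (β : CForm S.Quot k) (I : Fin k → Fin 4) :
    S.comp (conjForm β) I = fun p => (starRingEnd ℂ) (S.comp β I p) := rfl

theorem isSmooth_conjForm {k : ℕ} {β : CForm S.Quot k} (h : β.IsSmooth) :
    (conjForm β).IsSmooth :=
  S.isSmooth_iff_comp.mpr fun I => (S.isSmooth_iff_comp.mp h I).conj

/-- The structure constants are real, so Cartan's formula commutes with conjugation. Conjugates
enter because the `L²` pairing of complex forms is Hermitian. -/
theorem d_conjForm {c : Fin 4 → Fin 4 → Fin 4 → ℝ} (hc : S.HasStructureConstants c) {k : ℕ}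
    {β : CForm S.Quot (k + 1)} (hβ : β.IsSmooth) : (conjForm β).d = conjForm β.d := by
  refine S.form_ext fun I => funext fun p => ?_
  rw [comp_conjForm, comp_d hc (isSmooth_conjForm hβ)]
  dsimp only
  rw [comp_d hc hβ]
  simp only [comp_conjForm, lder_conj (S.isSmooth_iff_comp.mp hβ _), map_sub, map_sum, map_mul,
    map_pow, map_neg, map_one, Complex.conj_ofReal]

theorem isSmooth_d {c : Fin 4 → Fin 4 → Fin 4 → ℝ} (hc : S.HasStructureConstants c) {k : ℕ}
    {β : CForm S.Quot (k + 1)} (hβ : β.IsSmooth) : β.d.IsSmooth := by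
  have h := S.isSmooth_iff_comp.mp hβ
  refine S.isSmooth_iff_comp.mpr fun I => ?_
  have h1 : S.comp β.d I = _ := funext fun p => comp_d hc hβ I p
  rw [h1]
  refine SmoothFn.sub (SmoothFn.sum fun i _ => (smoothFn_const _).mul (S.smoothFn_lder (h _) _))
    (SmoothFn.sum fun i _ => SmoothFn.sum fun j _ => (smoothFn_const _).mul
      (SmoothFn.sum fun l _ => (smoothFn_const _).mul (h _)))

theorem comp_two_swap (β : CForm S.Quot 2) (i j : Fin 4) (p : S.Quot) :
    S.comp β ![j, i] p = -S.comp β ![i, j] p := by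
  refine Eq.trans (congrArg (β p) ?_) ((alternating_two (β p) (S.fr p i) (S.fr p j)).trans
    (congrArg Neg.neg (congrArg (β p) ?_)))
  all_goals funext m; fin_cases m <;> rfl

theorem comp_three_swap (κ : CForm S.Quot 3) (i j k : Fin 4) (p : S.Quot) :
    S.comp κ ![j, i, k] p = -S.comp κ ![i, j, k] p ∧
      S.comp κ ![i, k, j] p = -S.comp κ ![i, j, k] p := by
  have h := alternating_three (κ p) (S.fr p i) (S.fr p j) (S.fr p k)
  constructor
  · refine Eq.trans (congrArg (κ p) ?_) (h.1.trans (congrArg Neg.neg (congrArg (κ p) ?_)))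
    all_goals funext m; fin_cases m <;> rfl
  · refine Eq.trans (congrArg (κ p) ?_) (h.2.trans (congrArg Neg.neg (congrArg (κ p) ?_)))
    all_goals funext m; fin_cases m <;> rfl

/-- The exterior derivative of a `1`-form in the left-invariant frame. -/
theorem comp_d_one {c : Fin 4 → Fin 4 → Fin 4 → ℝ} (hc : S.HasStructureConstants c)
    {α : CForm S.Quot 1} (hα : α.IsSmooth) (i j : Fin 4) (p : S.Quot) :
    S.comp α.d ![i, j] p = S.lder i (S.comp α ![j]) p - S.lder j (S.comp α ![i]) p
      - ∑ l, (c i j l : ℂ) * S.comp α ![l] p := by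
  obtain ⟨K, h1⟩ : ∃ K : Fin 4 → S.Quot → ℂ, ∀ I, S.comp α I = K (I 0) :=
    ⟨fun i => S.comp α ![i], fun I => congrArg _ (funext fun m => by fin_cases m; rfl)⟩
  rw [comp_d hc hα]
  have h2 : (Finset.Ici (0 : Fin 1)) = {0} := by decide
  simp [Fin.sum_univ_two, h1, Fin.removeNth]
  ring

/-- The exterior derivative of a `2`-form in the left-invariant frame. -/
theorem comp_d_two {c : Fin 4 → Fin 4 → Fin 4 → ℝ} (hc : S.HasStructureConstants c)
    {γ : CForm S.Quot 2} (hγ : γ.IsSmooth) (i j k : Fin 4) (p : S.Quot) :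
    S.comp γ.d ![i, j, k] p = S.lder i (S.comp γ ![j, k]) p - S.lder j (S.comp γ ![i, k]) p
      + S.lder k (S.comp γ ![i, j]) p
      - ∑ l, (c i j l : ℂ) * S.comp γ ![l, k] p + ∑ l, (c i k l : ℂ) * S.comp γ ![l, j] p
      - ∑ l, (c j k l : ℂ) * S.comp γ ![l, i] p := by
  obtain ⟨K, h1⟩ : ∃ K : Fin 4 → Fin 4 → S.Quot → ℂ, ∀ I, S.comp γ I = K (I 0) (I 1) :=
    ⟨fun i j => S.comp γ ![i, j], fun I => congrArg _ (funext fun m => by fin_cases m <;> rfl)⟩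
  rw [comp_d hc hγ]
  have h2 : (Finset.Ici (0 : Fin 2)) = {0, 1} := by decide
  have h3 : (Finset.Ici (1 : Fin 2)) = {1} := by decide
  simp [Fin.sum_univ_three, Fin.sum_univ_two, h1, h2, h3, Fin.removeNth, Fin.succAbove]
  ring

/-- The structure constants are those of a unimodular Lie algebra. -/
structure IsUnimodular (c : Fin 4 → Fin 4 → Fin 4 → ℝ) : Prop where
  skew : ∀ i j k, c i j k = -c j i k
  trace : ∀ i, ∑ j, c i j j = 0

/-- The exterior derivative of a `3`-form in the left-invariant frame. -/
theorem comp_d_three {c : Fin 4 → Fin 4 → Fin 4 → ℝ} (hc : S.HasStructureConstants c)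
    (hu : IsUnimodular c) {κ : CForm S.Quot 3} (hκ : κ.IsSmooth) (p : S.Quot) :
    S.comp κ.d ![0, 1, 2, 3] p = S.lder 0 (S.comp κ ![1, 2, 3]) p - S.lder 1 (S.comp κ ![0, 2, 3]) p
      + S.lder 2 (S.comp κ ![0, 1, 3]) p - S.lder 3 (S.comp κ ![0, 1, 2]) p := by
  obtain ⟨K, h1, hK⟩ : ∃ K : Fin 4 → Fin 4 → Fin 4 → S.Quot → ℂ,
      (∀ I, S.comp κ I = K (I 0) (I 1) (I 2)) ∧ ∀ i j k, K j i k p = -K i j k p ∧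
        K i k j p = -K i j k p :=
    ⟨fun i j k => S.comp κ ![i, j, k],
      fun I => congrArg _ (funext fun m => by fin_cases m <;> rfl),
      fun i j k => comp_three_swap κ i j k p⟩
  have z : ∀ i j, K i i j p = 0 ∧ K i j i p = 0 := by
    intro i j
    have h2 := (hK i i j).1
    have h3 := (hK i i j).2
    have h4 : K i i j p = 0 := by linear_combination h2 / 2
    exact ⟨h4, by rw [h3, h4, neg_zero]⟩
  rw [comp_d hc hκ]
  have e0 : (Finset.Ici (0 : Fin 3)) = {0, 1, 2} := by decide
  have e1 : (Finset.Ici (1 : Fin 3)) = {1, 2} := by decide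
  have e2 : (Finset.Ici (2 : Fin 3)) = {2} := by decide
  have t0 := hu.trace 0
  have t1 := hu.trace 1
  have t2 := hu.trace 2
  have t3 := hu.trace 3
  have s0 : ∀ i k, c i i k = 0 := fun i k => by linarith [hu.skew i i k]
  simp only [Fin.sum_univ_four, s0, hu.skew 1 0, hu.skew 2 0, hu.skew 3 0, hu.skew 2 1,
    hu.skew 3 1, hu.skew 3 2] at t0 t1 t2 t3
  replace t0 := congrArg (fun x : ℝ => (x : ℂ)) t0
  replace t1 := congrArg (fun x : ℝ => (x : ℂ)) t1
  replace t2 := congrArg (fun x : ℝ => (x : ℂ)) t2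
  replace t3 := congrArg (fun x : ℝ => (x : ℂ)) t3
  push_cast at t0 t1 t2 t3
  simp [Fin.sum_univ_four, Fin.sum_univ_three, h1, e0, e1, e2, Fin.removeNth, Fin.succAbove, z,
    (hK 0 1 2).1, (hK 0 1 3).1, (hK 0 2 3).1, (hK 1 2 3).1, (hK 0 2 1).1, (hK 0 3 1).1, (hK 0 3 2).1, (hK 1 3 2).1,
    (hK 0 1 2).2, (hK 0 1 3).2, (hK 0 2 3).2, (hK 1 2 3).2]
  -- The bracket terms assemble into the traces of the operators `ad E_i`, which vanish by
  -- unimodularity; only derivatives of components remain.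
  linear_combination -t0 * K 1 2 3 p + t1 * K 0 2 3 p - t2 * K 0 1 3 p + t3 * K 0 1 2 p

end FramedQuotient

/-! ### Invariant integration and Stokes' theorem -/

open MeasureTheory

namespace FramedQuotient

variable {S : FramedQuotient}

/-- A finite measure on `G` which represents an invariant integral over `Γ \ G` of full support. -/
structure IsInvariantIntegral (S : FramedQuotient) (μ : Measure R4) : Prop where
  integrable : ∀ f : S.Quot → ℂ, Continuous (fun x => f (S.proj x)) →
    Integrable (fun x => f (S.proj x)) μ
  integral_lder : ∀ (j : Fin 4) (f : S.Quot → ℂ), S.SmoothFn f →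
    ∫ x, S.lder j f (S.proj x) ∂μ = 0
  eq_zero : ∀ f : S.Quot → ℝ, Continuous (fun x => f (S.proj x)) → (∀ p, 0 ≤ f p) →
    ∫ x, f (S.proj x) ∂μ = 0 → ∀ p, f p = 0

theorem IsInvariantIntegral.integrable_smooth {μ : Measure R4} (hμ : S.IsInvariantIntegral μ)
    {f : S.Quot → ℂ} (hf : S.SmoothFn f) : Integrable (fun x => f (S.proj x)) μ :=
  hμ.integrable f hf.continuous

/-- A smooth function with non-negative values and integral zero vanishes. -/
theorem IsInvariantIntegral.eq_zero_of_ofReal {μ : Measure R4} (hμ : S.IsInvariantIntegral μ)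
    {f : S.Quot → ℂ} (hf : S.SmoothFn f) {F : S.Quot → ℝ} (hF : ∀ p, 0 ≤ F p)
    (h : ∀ p, f p = (F p : ℂ)) (h0 : ∫ x, f (S.proj x) ∂μ = 0) (p : S.Quot) : f p = 0 := by
  have h1 : (fun x => F (S.proj x)) = fun x => (f (S.proj x)).re := by
    funext x
    rw [h, Complex.ofReal_re]
  have h2 : Continuous (fun x => F (S.proj x)) := by
    rw [h1]
    exact Complex.continuous_re.comp hf.continuous
  have h3 : ∫ x, F (S.proj x) ∂μ = 0 := by
    simp only [h] at h0
    rw [integral_complex_ofReal] at h0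
    exact_mod_cast h0
  rw [h, hμ.eq_zero F h2 hF h3 p, Complex.ofReal_zero]

/-- A form at a point, as a form on the model space. -/
def lin {k : ℕ} (β : CForm S.Quot k) (p : S.Quot) : R4 [⋀^Fin k]→L[ℝ] ℂ := β p

/-- The left-invariant frame at a point, as a frame of the model space. -/
noncomputable def linFr (p : S.Quot) (j : Fin 4) : R4 := S.fr p j

theorem comp_one_eq (α : CForm S.Quot 1) (i : Fin 4) (p : S.Quot) :
    S.comp α ![i] p = lin α p ![linFr p i] :=
  congrArg (lin α p) (by funext m; fin_cases m; rfl)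

theorem comp_two_eq (α : CForm S.Quot 2) (i j : Fin 4) (p : S.Quot) :
    S.comp α ![i, j] p = lin α p ![linFr p i, linFr p j] :=
  congrArg (lin α p) (by funext m; fin_cases m <;> rfl)

theorem comp_three_eq (α : CForm S.Quot 3) (i j k : Fin 4) (p : S.Quot) :
    S.comp α ![i, j, k] p = lin α p ![linFr p i, linFr p j, linFr p k] :=
  congrArg (lin α p) (by funext m; fin_cases m <;> rfl)

theorem comp_four_eq (α : CForm S.Quot 4) (p : S.Quot) :
    S.comp α ![0, 1, 2, 3] p = lin α p (linFr p) :=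
  congrArg (lin α p) (by funext m; fin_cases m <;> rfl)

theorem wedge13_fr (α : CForm S.Quot 1) (κ : CForm S.Quot 3) (p : S.Quot) :
    wedge13 (lin α p) (lin κ p) (linFr p) = S.comp α ![0] p * S.comp κ ![1, 2, 3] p
      - S.comp α ![1] p * S.comp κ ![0, 2, 3] p + S.comp α ![2] p * S.comp κ ![0, 1, 3] p
      - S.comp α ![3] p * S.comp κ ![0, 1, 2] p := by
  simp only [comp_one_eq, comp_three_eq]
  rfl

theorem wedge22_fr (β γ : CForm S.Quot 2) (p : S.Quot) :
    wedge22 (lin β p) (lin γ p) (linFr p) = S.comp β ![0, 1] p * S.comp γ ![2, 3] p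
      - S.comp β ![0, 2] p * S.comp γ ![1, 3] p + S.comp β ![0, 3] p * S.comp γ ![1, 2] p
      + S.comp β ![1, 2] p * S.comp γ ![0, 3] p - S.comp β ![1, 3] p * S.comp γ ![0, 2] p
      + S.comp β ![2, 3] p * S.comp γ ![0, 1] p := by
  simp only [comp_two_eq]
  rfl

/-- The divergence theorem. -/
theorem IsInvariantIntegral.integral_div {μ : Measure R4} (hμ : S.IsInvariantIntegral μ)
    {w₀ w₁ w₂ w₃ : S.Quot → ℂ} (h₀ : S.SmoothFn w₀) (h₁ : S.SmoothFn w₁) (h₂ : S.SmoothFn w₂)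
    (h₃ : S.SmoothFn w₃) :
    ∫ x, (S.lder 0 w₀ (S.proj x) - S.lder 1 w₁ (S.proj x) + S.lder 2 w₂ (S.proj x)
      - S.lder 3 w₃ (S.proj x)) ∂μ = 0 := by
  have i₀ := hμ.integrable_smooth (S.smoothFn_lder h₀ 0)
  have i₁ := hμ.integrable_smooth (S.smoothFn_lder h₁ 1)
  have i₂ := hμ.integrable_smooth (S.smoothFn_lder h₂ 2)
  have i₃ := hμ.integrable_smooth (S.smoothFn_lder h₃ 3)
  refine (integral_sub ((i₀.sub i₁).add i₂) i₃).trans ?_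
  have e₁ := (integral_add (i₀.sub i₁) i₂).trans (congrArg₂ (· + ·) (integral_sub i₀ i₁) rfl)
  rw [hμ.integral_lder _ _ h₃, sub_zero]
  refine e₁.trans ?_
  simp only [hμ.integral_lder _ _ h₀, hμ.integral_lder _ _ h₁, hμ.integral_lder _ _ h₂]
  simp

/-- Stokes' theorem for the product of a function and a `3`-form. -/
theorem stokes_zero_three {c : Fin 4 → Fin 4 → Fin 4 → ℝ} (hc : S.HasStructureConstants c)
    (hu : IsUnimodular c) {μ : Measure R4} (hμ : S.IsInvariantIntegral μ)
    {f : CForm S.Quot 0} (hf : f.IsSmooth) {κ : CForm S.Quot 3} (hκ : κ.IsSmooth) :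
    ∫ x, (wedge13 (lin f.d (S.proj x)) (lin κ (S.proj x)) (linFr (S.proj x))
      + S.comp f ![] (S.proj x) * S.comp κ.d ![0, 1, 2, 3] (S.proj x)) ∂μ = 0 := by
  have sf := S.isSmooth_iff_comp.mp hf ![]
  have sκ := S.isSmooth_iff_comp.mp hκ
  -- By the Leibniz rule the integrand is `d(fκ)`, which by `comp_d_three` is a divergence.
  have key : ∀ p, wedge13 (lin f.d p) (lin κ p) (linFr p) + S.comp f ![] p * S.comp κ.d ![0, 1, 2, 3] p =
      S.lder 0 (fun p => S.comp f ![] p * S.comp κ ![1, 2, 3] p) p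
      - S.lder 1 (fun p => S.comp f ![] p * S.comp κ ![0, 2, 3] p) p
      + S.lder 2 (fun p => S.comp f ![] p * S.comp κ ![0, 1, 3] p) p
      - S.lder 3 (fun p => S.comp f ![] p * S.comp κ ![0, 1, 2] p) p := by
    intro p
    simp only [lder_mul sf (sκ _)]
    rw [wedge13_fr, comp_d_three hc hu hκ]
    simp only [comp_d_zero hf]
    ring
  simp only [key]
  exact hμ.integral_div (sf.mul (sκ _)) (sf.mul (sκ _)) (sf.mul (sκ _)) (sf.mul (sκ _))

/-- Stokes' theorem for the product of a `1`-form and a `2`-form. -/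
theorem stokes_one_two {c : Fin 4 → Fin 4 → Fin 4 → ℝ} (hc : S.HasStructureConstants c)
    (hu : IsUnimodular c) {μ : Measure R4} (hμ : S.IsInvariantIntegral μ)
    {α : CForm S.Quot 1} (hα : α.IsSmooth) {γ : CForm S.Quot 2} (hγ : γ.IsSmooth) :
    ∫ x, (wedge22 (lin α.d (S.proj x)) (lin γ (S.proj x)) (linFr (S.proj x))
      - wedge13 (lin α (S.proj x)) (lin γ.d (S.proj x)) (linFr (S.proj x))) ∂μ = 0 := by
  have sα : ∀ i, S.SmoothFn (S.comp α ![i]) := fun i => S.isSmooth_iff_comp.mp hα _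
  have sγ : ∀ i j, S.SmoothFn (S.comp γ ![i, j]) := fun i j => S.isSmooth_iff_comp.mp hγ _
  -- The components of `α ∧ γ`. The integrand is `d(α ∧ γ) = dα ∧ γ - α ∧ dγ`, and its zeroth-order
  -- terms are traces of `ad E_i` times these components.
  let W : Fin 4 → Fin 4 → Fin 4 → S.Quot → ℂ := fun i j k p =>
    S.comp α ![i] p * S.comp γ ![j, k] p - S.comp α ![j] p * S.comp γ ![i, k] p
      + S.comp α ![k] p * S.comp γ ![i, j] p
  have sW : ∀ i j k, S.SmoothFn (W i j k) := fun i j k =>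
    (((sα i).mul (sγ j k)).sub ((sα j).mul (sγ i k))).add ((sα k).mul (sγ i j))
  have dW : ∀ m i j k p, S.lder m (W i j k) p =
      S.comp α ![i] p * S.lder m (S.comp γ ![j, k]) p + S.lder m (S.comp α ![i]) p * S.comp γ ![j, k] p
      - (S.comp α ![j] p * S.lder m (S.comp γ ![i, k]) p + S.lder m (S.comp α ![j]) p * S.comp γ ![i, k] p)
      + (S.comp α ![k] p * S.lder m (S.comp γ ![i, j]) p
        + S.lder m (S.comp α ![k]) p * S.comp γ ![i, j] p) := by
    intro m i j k p
    rw [← lder_mul (sα i) (sγ j k), ← lder_mul (sα j) (sγ i k), ← lder_mul (sα k) (sγ i j),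
      ← lder_sub ((sα i).mul (sγ j k)) ((sα j).mul (sγ i k)),
      ← lder_add (((sα i).mul (sγ j k)).sub ((sα j).mul (sγ i k))) ((sα k).mul (sγ i j))]
  have t0 := hu.trace 0
  have t1 := hu.trace 1
  have t2 := hu.trace 2
  have t3 := hu.trace 3
  have s0 : ∀ i k, c i i k = 0 := fun i k => by linarith [hu.skew i i k]
  simp only [Fin.sum_univ_four, s0, hu.skew 1 0, hu.skew 2 0, hu.skew 3 0, hu.skew 2 1,
    hu.skew 3 1, hu.skew 3 2] at t0 t1 t2 t3
  replace t0 := congrArg (fun x : ℝ => (x : ℂ)) t0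
  replace t1 := congrArg (fun x : ℝ => (x : ℂ)) t1
  replace t2 := congrArg (fun x : ℝ => (x : ℂ)) t2
  replace t3 := congrArg (fun x : ℝ => (x : ℂ)) t3
  push_cast at t0 t1 t2 t3
  have key : ∀ p, wedge22 (lin α.d p) (lin γ p) (linFr p) - wedge13 (lin α p) (lin γ.d p) (linFr p) =
      S.lder 0 (W 1 2 3) p - S.lder 1 (W 0 2 3) p + S.lder 2 (W 0 1 3) p - S.lder 3 (W 0 1 2) p := by
    intro p
    have z : ∀ i, S.comp γ ![i, i] p = 0 := fun i => by
      linear_combination comp_two_swap γ i i p / 2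
    rw [wedge22_fr, wedge13_fr]
    simp only [comp_d_one hc hα, comp_d_two hc hγ, dW, Fin.sum_univ_four, z,
      comp_two_swap γ 0 1, comp_two_swap γ 0 2, comp_two_swap γ 0 3, comp_two_swap γ 1 2,
      comp_two_swap γ 1 3, comp_two_swap γ 2 3]
    linear_combination -t0 * W 1 2 3 p + t1 * W 0 2 3 p - t2 * W 0 1 3 p + t3 * W 0 1 2 p
  simp only [key]
  exact hμ.integral_div (sW _ _ _) (sW _ _ _) (sW _ _ _) (sW _ _ _)

end FramedQuotient

/-! ### The Hodge operator on the quotient; harmonic forms are closed and coclosed -/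

open MeasureTheory

theorem coframe_apply_frame {B : R4 →L[ℝ] R4 →L[ℝ] ℝ} {e : Fin 4 → R4}
    (he : ∀ i j, B (e i) (e j) = if i = j then 1 else 0) (i j : Fin 4) :
    Complex.ofRealCLM.comp (B (e i)) (e j) = if i = j then 1 else 0 := by
  simp only [ContinuousLinearMap.comp_apply, he, Complex.ofRealCLM_apply]
  split <;> simp

namespace FramedQuotient

variable {S : FramedQuotient} {J : AlmostComplexStructure S.Quot} (g : HermitianMetric J)

/-- The coefficients of the metric in the left-invariant frame. -/
noncomputable def gram (i j : Fin 4) (p : S.Quot) : ℝ := g.val p (S.fr p i) (S.fr p j)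

/-- The metric has smooth coefficients in the left-invariant frame. -/
def SmoothGram : Prop := ∀ i j, S.SmoothFn (fun p => (gram g i j p : ℂ))

/-- The volume density of the metric in the left-invariant frame. -/
noncomputable def dens (p : S.Quot) : ℝ :=
  gram g 0 0 p * gram g 2 2 p - gram g 0 2 p ^ 2 - gram g 1 2 p ^ 2

/-- The almost complex structure is `J E₀ = E₁`, `J E₂ = E₃`. -/
def IsStandard (J : AlmostComplexStructure S.Quot) : Prop :=
  ∀ p, J.toFun p (S.fr p 0) = S.fr p 1 ∧ J.toFun p (S.fr p 2) = S.fr p 3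

/-- The orthonormal frame of the metric at a point, as a frame of the model space. -/
noncomputable def linFrame (p : S.Quot) : Fin 4 → R4 := g.frame p

/-- The metric at a point, as a bilinear form on the model space. -/
noncomputable def linMetric (p : S.Quot) : R4 →L[ℝ] R4 →L[ℝ] ℝ := g.inner p

/-- The almost complex structure at a point, as an operator on the model space. -/
noncomputable def linJ (J : AlmostComplexStructure S.Quot) (p : S.Quot) : R4 →L[ℝ] R4 := J.toFun p

theorem linFrame_spec (p : S.Quot) :
    (∀ i j, linMetric g p (linFrame g p i) (linFrame g p j) = if i = j then 1 else 0) ∧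
      linFrame g p 1 = linJ J p (linFrame g p 0) ∧ linFrame g p 3 = linJ J p (linFrame g p 2) :=
  Classical.choose_spec (g.exists_frame p)

/-- The orthonormal frame of the metric, as a basis. -/
noncomputable def onb (p : S.Quot) : Module.Basis (Fin 4) ℝ R4 :=
  orthoBasis (linFrame_spec g p).1

theorem coe_onb (p : S.Quot) : ⇑(onb g p) = linFrame g p := coe_orthoBasis _

theorem lin_hodgeStar {k l : ℕ} (h : k + l = 4) (β : CForm S.Quot k) (p : S.Quot) :
    lin (g.hodgeStar h β) p = starAt (linFrame g p)
      (fun i => Complex.ofRealCLM.comp (linMetric g p (linFrame g p i))) h (lin β p) := rfl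

theorem gram_eq_lin (i j : Fin 4) (p : S.Quot) :
    gram g i j p = linMetric g p (linFr p i) (linFr p j) := rfl

/-- Both frames have the form `(X, JX, Y, JY)`, so the determinant is nonnegative by `adapted_det`,
and it is nonzero because the left-invariant frame is a basis. -/
theorem onb_det (hJ : IsStandard J) (p : S.Quot) :
    (onb g p).det (linFr p) = dens g p ∧ 0 < dens g p := by
  have h := adapted_det (B := linMetric g p) (J := linJ J p) (J.sq p) (g.isometry p)
    (linFrame_spec g p).1 (linFrame_spec g p).2.1 (linFrame_spec g p).2.2 (E := linFr p)
    (hJ p).1.symm (hJ p).2.symm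
  have h1 : (onb g p).det (linFr p) = dens g p := h.1
  refine ⟨h1, lt_of_le_of_ne (h1 ▸ h.2) ?_⟩
  rw [← h1]
  have h2 := (onb g p).isUnit_det (S.frameBasis (S.rep p))
  have h3 : ⇑(S.frameBasis (S.rep p)) = linFr p := funext fun j => S.frameBasis_apply _ j
  rw [h3] at h2
  exact h2.ne_zero.symm

theorem smoothFn_dens (hg : SmoothGram g) : S.SmoothFn (fun p => (dens g p : ℂ)) := by
  simp only [dens, Complex.ofReal_sub, Complex.ofReal_mul, sq]
  exact (((hg 0 0).mul (hg 2 2)).sub ((hg 0 2).mul (hg 0 2))).sub ((hg 1 2).mul (hg 1 2))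

theorem dens_ne_zero (hJ : IsStandard J) (p : S.Quot) : (dens g p : ℂ) ≠ 0 :=
  Complex.ofReal_ne_zero.mpr (onb_det g hJ p).2.ne'

/-- The Hodge operator preserves smoothness. -/
theorem isSmooth_hodgeStar (hJ : IsStandard J) (hg : SmoothGram g) {k l : ℕ} (h : k + l = 4)
    {β : CForm S.Quot k} (hβ : β.IsSmooth) : (g.hodgeStar h β).IsSmooth := by
  have sβ := S.isSmooth_iff_comp.mp hβ
  refine S.isSmooth_iff_comp.mpr fun I => ?_
  -- The orthonormal frame is chosen separately at each point and need not vary continuously. In the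
  -- left-invariant frame `*` is an expression in the smooth functions `gram`, divided by the
  -- density.
  have h1 : S.comp (g.hodgeStar h β) I = fun p => (dens g p : ℂ)⁻¹ *
      (((k.factorial * l.factorial : ℕ) : ℂ)⁻¹ * ∑ σ : Equiv.Perm (Fin 4),
      ((Equiv.Perm.sign σ : ℤ) : ℂ) *
        (S.comp β (fun a => σ (Fin.cast h (Fin.castAdd l a))) p *
        Matrix.det (Matrix.of fun b c =>
          (gram g (σ (Fin.cast h (Fin.natAdd k b))) (I c) p : ℂ)))) := by
    funext p
    have h2 := starAt_change_frame h (linMetric g p) (onb g p) (linFr p) (lin β p)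
      (fun i => linFr p (I i))
    rw [(onb_det g hJ p).1, coe_onb] at h2
    rw [eq_inv_mul_iff_mul_eq₀ (dens_ne_zero g hJ p)]
    refine h2.trans ?_
    rw [starAt_apply]
    rfl
  rw [h1]
  exact ((smoothFn_dens g hg).inv (dens_ne_zero g hJ)).mul ((smoothFn_const _).mul
    (SmoothFn.sum fun σ _ => (smoothFn_const _).mul ((sβ _).mul
      (SmoothFn.det fun i j => hg _ _))))

/-- `ω ∧ *α = ⟨ω, ᾱ⟩ vol` for `1`-forms, with both sides evaluated on the left-invariant frame. -/
theorem wedge13_star (hJ : IsStandard J) (τ : R4 [⋀^Fin 1]→L[ℝ] ℂ) (α : CForm S.Quot 1)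
    (p : S.Quot) :
    wedge13 τ (lin (g.hodgeStar (show 1 + 3 = 4 from rfl) α) p) (linFr p) =
      dens g p * ∑ i, τ ![linFrame g p i] * lin α p ![linFrame g p i] := by
  have h := wedge13_transfer (onb g p) τ (lin (g.hodgeStar (show 1 + 3 = 4 from rfl) α) p) (linFr p)
  rw [(onb_det g hJ p).1, coe_onb] at h
  refine h.trans ?_
  obtain ⟨h0, h1, h2, h3⟩ := starAt_one (coframe_apply_frame (linFrame_spec g p).1) (lin α p)
  rw [wedge13, lin_hodgeStar, h0, h1, h2, h3, Fin.sum_univ_four]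
  ring

theorem lin_conjForm_apply {k : ℕ} (β : CForm S.Quot k) (p : S.Quot) (v : Fin k → R4) :
    lin (conjForm β) p v = (starRingEnd ℂ) (lin β p v) := rfl

/-- The Hermitian pairing `⟨τ, α⟩ vol`, conjugate linear in `α`. -/
theorem wedge13_conj_star (hJ : IsStandard J) (τ : R4 [⋀^Fin 1]→L[ℝ] ℂ) (α : CForm S.Quot 1)
    (p : S.Quot) :
    wedge13 τ (lin (conjForm (g.hodgeStar (show 1 + 3 = 4 from rfl) α)) p) (linFr p) =
      dens g p * ∑ i, τ ![linFrame g p i] * (starRingEnd ℂ) (lin α p ![linFrame g p i]) := by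
  have h := wedge13_transfer (onb g p) τ (lin (conjForm (g.hodgeStar (show 1 + 3 = 4 from rfl) α)) p)
    (linFr p)
  rw [(onb_det g hJ p).1, coe_onb] at h
  refine h.trans ?_
  obtain ⟨h0, h1, h2, h3⟩ := starAt_one (coframe_apply_frame (linFrame_spec g p).1) (lin α p)
  simp only [wedge13, lin_conjForm_apply]
  rw [lin_hodgeStar, h0, h1, h2, h3, Fin.sum_univ_four]
  simp only [map_neg]
  ring

/-- `β̄ ∧ *β = |β|² vol`: the source of positivity in the energy identity. -/
theorem wedge22_conj_star (hJ : IsStandard J) (β : CForm S.Quot 2) (p : S.Quot) :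
    wedge22 (lin (conjForm β) p) (lin (g.hodgeStar (show 2 + 2 = 4 from rfl) β) p) (linFr p) =
      ((dens g p * (Complex.normSq (lin β p ![linFrame g p 0, linFrame g p 1])
        + Complex.normSq (lin β p ![linFrame g p 0, linFrame g p 2])
        + Complex.normSq (lin β p ![linFrame g p 0, linFrame g p 3])
        + Complex.normSq (lin β p ![linFrame g p 1, linFrame g p 2])
        + Complex.normSq (lin β p ![linFrame g p 1, linFrame g p 3])
        + Complex.normSq (lin β p ![linFrame g p 2, linFrame g p 3])) : ℝ) : ℂ) := by
  have h := wedge22_transfer (onb g p) (lin (conjForm β) p)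
    (lin (g.hodgeStar (show 2 + 2 = 4 from rfl) β) p) (linFr p)
  rw [(onb_det g hJ p).1, coe_onb] at h
  refine h.trans ?_
  obtain ⟨h0, h1, h2, h3, h4, h5⟩ := starAt_two (coframe_apply_frame (linFrame_spec g p).1) (lin β p)
  simp only [wedge22, lin_conjForm_apply]
  rw [lin_hodgeStar, h0, h1, h2, h3, h4, h5]
  push_cast
  simp only [Complex.normSq_eq_conj_mul_self]
  ring

theorem star_four_fr (hJ : IsStandard J) (η : CForm S.Quot 4) (p : S.Quot) (v : Fin 0 → R4) :
    dens g p * lin (g.hodgeStar (show 4 + 0 = 4 from rfl) η) p v = S.comp η ![0, 1, 2, 3] p := by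
  rw [lin_hodgeStar, starAt_four, comp_four_eq]
  have h := alternating_top_transfer (onb g p) (lin η p).toAlternatingMap (linFr p)
  rw [(onb_det g hJ p).1, coe_onb] at h
  exact h.symm

/-- The minus sign is that of `** = -1` on 3-forms in dimension 4, inserted in `τ ∧ *(*ξ) = ⟨τ, *ξ⟩
vol`. -/
theorem star_three_pairing (hJ : IsStandard J) (τ : R4 [⋀^Fin 1]→L[ℝ] ℂ) (ξ : CForm S.Quot 3)
    (p : S.Quot) :
    dens g p * ∑ i, lin (g.hodgeStar (show 3 + 1 = 4 from rfl) ξ) p ![linFrame g p i] * τ ![linFrame g p i] =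
      -wedge13 τ (lin ξ p) (linFr p) := by
  have h := wedge13_transfer (onb g p) τ (lin ξ p) (linFr p)
  rw [(onb_det g hJ p).1, coe_onb] at h
  rw [h]
  obtain ⟨h0, h1, h2, h3⟩ := starAt_three (coframe_apply_frame (linFrame_spec g p).1) (lin ξ p)
  rw [Fin.sum_univ_four, lin_hodgeStar, h0, h1, h2, h3, wedge13]
  ring

theorem smoothFn_wedge13 {α : CForm S.Quot 1} (hα : α.IsSmooth) {κ : CForm S.Quot 3}
    (hκ : κ.IsSmooth) : S.SmoothFn (fun p => wedge13 (lin α p) (lin κ p) (linFr p)) := by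
  have sα := S.isSmooth_iff_comp.mp hα
  have sκ := S.isSmooth_iff_comp.mp hκ
  simp only [wedge13_fr]
  exact ((((sα _).mul (sκ _)).sub ((sα _).mul (sκ _))).add ((sα _).mul (sκ _))).sub
    ((sα _).mul (sκ _))

theorem smoothFn_wedge22 {β γ : CForm S.Quot 2} (hβ : β.IsSmooth) (hγ : γ.IsSmooth) :
    S.SmoothFn (fun p => wedge22 (lin β p) (lin γ p) (linFr p)) := by
  have sβ := S.isSmooth_iff_comp.mp hβ
  have sγ := S.isSmooth_iff_comp.mp hγ
  simp only [wedge22_fr]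
  exact ((((((sβ _).mul (sγ _)).sub ((sβ _).mul (sγ _))).add ((sβ _).mul (sγ _))).add
    ((sβ _).mul (sγ _))).sub ((sβ _).mul (sγ _))).add ((sβ _).mul (sγ _))

theorem isSmooth_neg {k : ℕ} {β : CForm S.Quot k} (hβ : β.IsSmooth) : (-β).IsSmooth :=
  S.isSmooth_iff_comp.mpr fun I => (S.isSmooth_iff_comp.mp hβ I).neg

theorem isSmooth_d_zero {u : CForm S.Quot 0} (hu : u.IsSmooth) : u.d.IsSmooth := by
  refine S.isSmooth_iff_comp.mpr fun I => ?_
  have h1 : I = ![I 0] := funext fun m => by fin_cases m; rfl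
  rw [h1, show S.comp u.d ![I 0] = _ from funext fun p => comp_d_zero hu (I 0) p]
  exact S.smoothFn_lder (S.isSmooth_iff_comp.mp hu _) _

theorem dens_mul_codiff (hJ : IsStandard J) (α : CForm S.Quot 1) (p : S.Quot) :
    dens g p * S.comp (g.codiff (k := 0) (l := 3) rfl α) ![] p =
      -S.comp (g.hodgeStar (show 1 + 3 = 4 from rfl) α).d ![0, 1, 2, 3] p := by
  rw [← star_four_fr g hJ _ p (fun i => linFr p (![] i)), ← mul_neg]
  rfl

theorem isSmooth_codiff_one {c : Fin 4 → Fin 4 → Fin 4 → ℝ} (hc : S.HasStructureConstants c)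
    (hJ : IsStandard J) (hg : SmoothGram g) {α : CForm S.Quot 1} (hα : α.IsSmooth) :
    (g.codiff (k := 0) (l := 3) rfl α).IsSmooth :=
  isSmooth_neg (isSmooth_hodgeStar g hJ hg _ (isSmooth_d hc (isSmooth_hodgeStar g hJ hg _ hα)))

/-- A `1`-form whose components in an orthonormal frame pair to zero vanishes. -/
theorem form_two_eq_zero (β : CForm S.Quot 2) (p : S.Quot)
    (h : ∀ i j, i < j → lin β p ![linFrame g p i, linFrame g p j] = 0) : β p = 0 := by
  have key : (lin β p).toMultilinearMap = 0 := by
    refine Module.Basis.ext_multilinear (fun _ => onb g p) fun I => ?_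
    have h1 : ∀ i j, lin β p ![linFrame g p i, linFrame g p j] = 0 := by
      intro i j
      rcases lt_trichotomy i j with hij | rfl | hij
      · exact h i j hij
      · have := alternating_two (lin β p) (linFrame g p i) (linFrame g p i)
        linear_combination this / 2
      · rw [alternating_two, h j i hij, neg_zero]
    refine Eq.trans ?_ (h1 (I 0) (I 1))
    rw [coe_onb]
    exact congrArg (lin β p) (funext fun m => by fin_cases m <;> rfl)
  ext v
  exact DFunLike.congr_fun key v

/-- On `Γ \ G`, harmonic `1`-forms are closed and coclosed. -/
theorem closed_of_harmonic {c : Fin 4 → Fin 4 → Fin 4 → ℝ} (hc : S.HasStructureConstants c)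
    (hu : IsUnimodular c) {μ : Measure R4} (hμ : S.IsInvariantIntegral μ)
    (hJ : IsStandard J) (hg : SmoothGram g) {α : CForm S.Quot 1} (hα : α.IsSmooth)
    (h : g.laplacian α = 0) :
    α.d = 0 ∧ ∀ p, S.comp (g.codiff (k := 0) (l := 3) rfl α) ![] p = 0 := by
  set u := g.codiff (k := 0) (l := 3) rfl α with hu_def
  set κ := g.hodgeStar (show 1 + 3 = 4 from rfl) α with hκ_def
  set γ := g.hodgeStar (show 2 + 2 = 4 from rfl) α.d with hγ_def
  have su : u.IsSmooth := isSmooth_codiff_one g hc hJ hg hα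
  have sκ : κ.IsSmooth := isSmooth_hodgeStar g hJ hg _ hα
  have sβ : α.d.IsSmooth := isSmooth_d hc hα
  have sγ : γ.IsSmooth := isSmooth_hodgeStar g hJ hg _ sβ
  -- Here `Δ_d α = du - *dγ`, so harmonicity says `du = *dγ`.
  have hlap : ∀ p i, lin u.d p ![linFrame g p i] =
      lin (g.hodgeStar (show 3 + 1 = 4 from rfl) γ.d) p ![linFrame g p i] := by
    intro p i
    have h1 : lin (g.laplacian α) p ![linFrame g p i] = 0 := by rw [h]; rfl
    have h2 : lin (g.laplacian α) p ![linFrame g p i] = lin u.d p ![linFrame g p i] +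
      -lin (g.hodgeStar (show 3 + 1 = 4 from rfl) γ.d) p ![linFrame g p i] := rfl
    linear_combination h1 - h2
  -- The mixed terms of the two integrations by parts are `⟨du, α⟩` and `-⟨*dγ, α⟩` times the
  -- density; they cancel by `hlap`.
  have hcross : ∀ p, wedge13 (lin u.d p) (lin (conjForm κ) p) (linFr p) +
      wedge13 (lin (conjForm α) p) (lin γ.d p) (linFr p) = 0 := by
    intro p
    rw [wedge13_conj_star g hJ, ← neg_eq_iff_eq_neg.mpr
      (star_three_pairing g hJ (lin (conjForm α) p) γ.d p).symm.symm]
    simp only [hlap, lin_conjForm_apply]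
    ring
  have hdκ : ∀ p, S.comp (conjForm κ).d ![0, 1, 2, 3] p =
      -(dens g p * (starRingEnd ℂ) (S.comp u ![] p)) := by
    intro p
    rw [d_conjForm hc sκ, comp_conjForm]
    have h1 := dens_mul_codiff g hJ α p
    rw [← hu_def, ← hκ_def] at h1
    dsimp only
    rw [← neg_eq_iff_eq_neg.mpr h1, map_neg, map_mul, Complex.conj_ofReal]
  -- The energy density `|d^*α|² + |dα|²`, relative to the left-invariant volume form.
  let F : S.Quot → ℝ := fun p => dens g p * Complex.normSq (S.comp u ![] p) +
    dens g p * (Complex.normSq (lin α.d p ![linFrame g p 0, linFrame g p 1])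
        + Complex.normSq (lin α.d p ![linFrame g p 0, linFrame g p 2])
        + Complex.normSq (lin α.d p ![linFrame g p 0, linFrame g p 3])
        + Complex.normSq (lin α.d p ![linFrame g p 1, linFrame g p 2])
        + Complex.normSq (lin α.d p ![linFrame g p 1, linFrame g p 3])
        + Complex.normSq (lin α.d p ![linFrame g p 2, linFrame g p 3]))
  have hF0 : ∀ p, 0 ≤ F p := by
    intro p
    have := (onb_det g hJ p).2.le
    have n := fun z => Complex.normSq_nonneg z
    exact add_nonneg (mul_nonneg this (n _)) (mul_nonneg this (add_nonneg (add_nonneg (add_nonneg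
      (add_nonneg (add_nonneg (n _) (n _)) (n _)) (n _)) (n _)) (n _)))
  let f₁ : S.Quot → ℂ := fun p => wedge22 (lin (conjForm α).d p) (lin γ p) (linFr p)
      - wedge13 (lin (conjForm α) p) (lin γ.d p) (linFr p)
  let f₂ : S.Quot → ℂ := fun p => wedge13 (lin u.d p) (lin (conjForm κ) p) (linFr p)
      + S.comp u ![] p * S.comp (conjForm κ).d ![0, 1, 2, 3] p
  have sf₁ : S.SmoothFn f₁ := (smoothFn_wedge22 (isSmooth_d hc (isSmooth_conjForm hα)) sγ).sub
    (smoothFn_wedge13 (isSmooth_conjForm hα) (isSmooth_d hc sγ))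
  have sf₂ : S.SmoothFn f₂ := (smoothFn_wedge13 (isSmooth_d_zero su) (isSmooth_conjForm sκ)).add
    ((S.isSmooth_iff_comp.mp su _).mul
      (S.isSmooth_iff_comp.mp (isSmooth_d hc (isSmooth_conjForm sκ)) _))
  -- In the difference of the two Stokes integrands the mixed terms are exactly those of `hcross`,
  -- so only the energy density survives.
  have hfF : ∀ p, f₁ p - f₂ p = (F p : ℂ) := by
    intro p
    have e1 := hcross p
    have e2 := wedge22_conj_star g hJ α.d p
    simp only [f₁, f₂, F]
    rw [d_conjForm hc hα, e2, hdκ, Complex.ofReal_add, Complex.ofReal_mul (dens g p) (Complex.normSq _),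
      Complex.normSq_eq_conj_mul_self]
    linear_combination -e1
  have hint : ∫ x, (f₁ (S.proj x) - f₂ (S.proj x)) ∂μ = 0 := by
    rw [integral_sub (hμ.integrable_smooth sf₁) (hμ.integrable_smooth sf₂)]
    rw [stokes_one_two hc hu hμ (isSmooth_conjForm hα) sγ,
      stokes_zero_three hc hu hμ su (isSmooth_conjForm sκ), sub_zero]
  have hz := hμ.eq_zero_of_ofReal (sf₁.sub sf₂) hF0 hfF hint
  have hFz : ∀ p, F p = 0 := fun p => by
    have := (hfF p).symm.trans (hz p)
    exact_mod_cast this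
  have hparts : ∀ p, S.comp u ![] p = 0 ∧
      ∀ i j, i < j → lin α.d p ![linFrame g p i, linFrame g p j] = 0 := by
    intro p
    have hd := (onb_det g hJ p).2
    have n := fun z => Complex.normSq_nonneg z
    have e := hFz p
    simp only [F, ← mul_add, mul_eq_zero, hd.ne', false_or] at e
    have n0 := n (S.comp u ![] p)
    have n1 := n (lin α.d p ![linFrame g p 0, linFrame g p 1])
    have n2 := n (lin α.d p ![linFrame g p 0, linFrame g p 2])
    have n3 := n (lin α.d p ![linFrame g p 0, linFrame g p 3])
    have n4 := n (lin α.d p ![linFrame g p 1, linFrame g p 2])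
    have n5 := n (lin α.d p ![linFrame g p 1, linFrame g p 3])
    have n6 := n (lin α.d p ![linFrame g p 2, linFrame g p 3])
    refine ⟨Complex.normSq_eq_zero.mp (by linarith), ?_⟩
    intro i j hij
    apply Complex.normSq_eq_zero.mp
    fin_cases i <;> fin_cases j <;> first
      | exact absurd hij (by decide)
      | (simp only [Fin.mk_zero, Fin.mk_one, Fin.reduceFinMk, Fin.isValue] at *; linarith)
  exact ⟨funext fun p => form_two_eq_zero g _ p (hparts p).2, fun p => (hparts p).1⟩

end FramedQuotient

/-! ### Left-invariant 1-forms and forms of type (1,0) -/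

namespace FramedQuotient

variable {S : FramedQuotient}

/-- The left-invariant `1`-form with given components in the left-invariant frame. -/
noncomputable def constForm (S : FramedQuotient) (z : Fin 4 → ℂ) : CForm S.Quot 1 := fun p =>
  (ContinuousAlternatingMap.ofSubsingleton ℝ R4 ℂ 0
    (∑ j, (S.coframeG j (S.rep p)).smulRight (z j)) : R4 [⋀^Fin 1]→L[ℝ] ℂ)

theorem lin_constForm (z : Fin 4 → ℂ) (p : S.Quot) (v : R4) :
    lin (S.constForm z) p ![v] = ∑ j, (S.coframeG j (S.rep p) v : ℂ) * z j := by
  change (∑ j, (S.coframeG j (S.rep p)).smulRight (z j)) v = _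
  simp

theorem comp_constForm (z : Fin 4 → ℂ) (j : Fin 4) (p : S.Quot) :
    S.comp (S.constForm z) ![j] p = z j := by
  rw [comp_one_eq, lin_constForm]
  simp only [linFr, fr, S.coframeG_frame]
  rw [Finset.sum_eq_single j (fun i _ hi => by simp [hi]) (by simp)]
  simp

theorem isSmooth_of_comp_one {α : CForm S.Quot 1} (h : ∀ j, S.SmoothFn (S.comp α ![j])) :
    α.IsSmooth := by
  refine S.isSmooth_iff_comp.mpr fun I => ?_
  have h1 : I = ![I 0] := funext fun m => by fin_cases m; rfl
  rw [h1]
  exact h _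

theorem form_ext_one {α β : CForm S.Quot 1} (h : ∀ j p, S.comp α ![j] p = S.comp β ![j] p) :
    α = β := by
  refine S.form_ext fun I => ?_
  have h1 : I = ![I 0] := funext fun m => by fin_cases m; rfl
  rw [h1]
  exact funext (h _)

theorem form_ext_two {α β : CForm S.Quot 2}
    (h : ∀ i j p, S.comp α ![i, j] p = S.comp β ![i, j] p) : α = β := by
  refine S.form_ext fun I => ?_
  have h1 : I = ![I 0, I 1] := funext fun m => by fin_cases m <;> rfl
  rw [h1]
  exact funext (h _ _)

theorem isSmooth_constForm (z : Fin 4 → ℂ) : (S.constForm z).IsSmooth :=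
  isSmooth_of_comp_one fun j => by
    rw [show S.comp (S.constForm z) ![j] = fun _ => z j from funext fun p => comp_constForm z j p]
    exact smoothFn_const _

theorem comp_smul {k : ℕ} (z : ℂ) (α : CForm S.Quot k) (I : Fin k → Fin 4) (p : S.Quot) :
    S.comp (z • α) I p = z * S.comp α I p := rfl

theorem isSmooth_smul {α : CForm S.Quot 1} (z : ℂ) (hα : α.IsSmooth) : (z • α).IsSmooth :=
  S.isSmooth_iff_comp.mpr fun I => (smoothFn_const z).mul (S.isSmooth_iff_comp.mp hα I)

variable (S) in
/-- The `(1,0)`-form `E⁰ + i E¹`. -/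
noncomputable def phi₁ : CForm S.Quot 1 := S.constForm ![1, Complex.I, 0, 0]

variable (S) in
/-- The `(1,0)`-form `E² + i E³`. -/
noncomputable def phi₂ : CForm S.Quot 1 := S.constForm ![0, 0, 1, Complex.I]

theorem eval_frame (α : CForm S.Quot 1) (p : S.Quot) (j : Fin 4) :
    α.eval p (S.fr p j) = S.comp α ![j] p :=
  congrArg (α p) (funext fun m => by fin_cases m; rfl)

theorem isCoframe_phi : S.IsCoframe S.phi₁ S.phi₂ := by
  intro a j
  rw [S.dproj_frame, eval_frame, eval_frame]
  exact ⟨comp_constForm _ j _, comp_constForm _ j _⟩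

variable {J : AlmostComplexStructure S.Quot}

theorem IsStandard.frame_one (hJ : IsStandard J) (p : S.Quot) :
    J.toFun p (S.fr p 1) = -S.fr p 0 := by
  rw [← (hJ p).1]
  exact J.sq p _

theorem IsStandard.frame_three (hJ : IsStandard J) (p : S.Quot) :
    J.toFun p (S.fr p 3) = -S.fr p 2 := by
  rw [← (hJ p).2]
  exact J.sq p _

/-- A `1`-form at a point as a linear map. -/
theorem exists_linearMap (α : CForm S.Quot 1) (p : S.Quot) :
    ∃ L : TangentSpace 𝓘(ℝ, R4) p →ₗ[ℝ] ℂ, ∀ v, α.eval p v = L v :=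
  ⟨((ContinuousAlternatingMap.ofSubsingleton ℝ R4 ℂ (0 : Fin 1)).symm (lin α p)).toLinearMap,
    fun _ => rfl⟩

/-- The condition on `E₁ = JE₀` and `E₃ = JE₂` follows from that on `E₀` and `E₂` because `J² = -1`;
so the type amounts to two scalar equations. -/
theorem isType10_iff (hJ : IsStandard J) (α : CForm S.Quot 1) :
    J.IsType10 α ↔ ∀ p, S.comp α ![1] p = Complex.I * S.comp α ![0] p ∧
      S.comp α ![3] p = Complex.I * S.comp α ![2] p := by
  constructor
  · intro h p
    rw [← eval_frame, ← eval_frame, ← eval_frame, ← eval_frame, ← (hJ p).1, ← (hJ p).2]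
    exact ⟨h p _, h p _⟩
  · intro h p
    obtain ⟨L, hL⟩ := exists_linearMap α p
    obtain ⟨h1, h2⟩ := h p
    simp only [← eval_frame, hL] at h1 h2
    have key : L.comp (J.toFun p).toLinearMap = Complex.I • L := by
      refine (S.frBasis p).ext fun j => ?_
      rw [S.frBasis_apply]
      change L (J.toFun p (S.fr p j)) = Complex.I * L (S.fr p j)
      fin_cases j
      · exact (congrArg L (hJ p).1).trans h1
      · refine (congrArg L (hJ.frame_one p)).trans ?_
        rw [map_neg]
        change _ = Complex.I * L (S.fr p 1)
        linear_combination -Complex.I * h1 - L (S.fr p 0) * Complex.I_sq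
      · exact (congrArg L (hJ p).2).trans h2
      · refine (congrArg L (hJ.frame_three p)).trans ?_
        rw [map_neg]
        change _ = Complex.I * L (S.fr p 3)
        linear_combination -Complex.I * h2 - L (S.fr p 2) * Complex.I_sq
    intro v
    rw [hL, hL]
    exact LinearMap.congr_fun key v

theorem isType10_phi₁ (hJ : IsStandard J) : J.IsType10 S.phi₁ :=
  (isType10_iff hJ _).mpr fun p => by simp [phi₁, comp_constForm]

theorem isType10_phi₂ (hJ : IsStandard J) : J.IsType10 S.phi₂ :=
  (isType10_iff hJ _).mpr fun p => by simp [phi₂, comp_constForm]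

theorem isType10_smul {α : CForm S.Quot 1} (z : ℂ) (h : J.IsType10 α) : J.IsType10 (z • α) := by
  intro p v
  change z * α.eval p _ = Complex.I * (z * α.eval p v)
  rw [h p v]
  ring

/-- If no bracket of the frame has a component along `E₀`, `E₁`, then `E⁰ + i E¹` is closed. -/
theorem d_smul_phi₁ {c : Fin 4 → Fin 4 → Fin 4 → ℝ} (hc : S.HasStructureConstants c)
    (h0 : ∀ i j, c i j 0 = 0) (h1 : ∀ i j, c i j 1 = 0) (z : ℂ) : (z • S.phi₁).d = 0 := by
  refine form_ext_two fun i j p => ?_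
  have hk : ∀ k, S.comp (z • S.phi₁) ![k] = fun _ => z * ![1, Complex.I, 0, 0] k :=
    fun k => funext fun p => (comp_smul z _ _ p).trans (congrArg _ (comp_constForm _ k p))
  rw [comp_d_one hc (α := z • S.phi₁) (isSmooth_smul z (isSmooth_constForm _))]
  simp only [hk, lder_const, Fin.sum_univ_four, h0, h1]
  simp [comp]

end FramedQuotient

/-! ### The codifferential of `φ¹` and the value of `h^{1,0}_d` -/

namespace FramedQuotient

variable {S : FramedQuotient} {J : AlmostComplexStructure S.Quot} (g : HermitianMetric J)

/-- The Hodge star of a `1`-form given by its metric dual vector. -/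
theorem wedge13_star_of_dual (hJ : IsStandard J) {α : CForm S.Quot 1} {p : S.Quot}
    {X : Fin 4 → ℂ} (hX : ∀ v, lin α p ![v] = ∑ m, X m * (linMetric g p (linFr p m) v : ℂ))
    (τ : R4 [⋀^Fin 1]→L[ℝ] ℂ) :
    wedge13 τ (lin (g.hodgeStar (show 1 + 3 = 4 from rfl) α) p) (linFr p) =
      dens g p * ∑ m, X m * τ ![linFr p m] := by
  rw [wedge13_star g hJ]
  congr 1
  obtain ⟨L, hL⟩ : ∃ L : R4 →ₗ[ℝ] ℂ, ∀ v, τ ![v] = L v :=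
    ⟨((ContinuousAlternatingMap.ofSubsingleton ℝ R4 ℂ (0 : Fin 1)).symm τ).toLinearMap,
      fun v => congrArg τ (funext fun m => by fin_cases m; rfl)⟩
  have h1 : ∀ m, τ ![linFr p m] =
      ∑ i, (linMetric g p (linFr p m) (linFrame g p i) : ℂ) * τ ![linFrame g p i] := by
    intro m
    simp only [hL]
    conv_lhs => rw [ortho_expand (linFrame_spec g p).1 (linFr p m), map_sum]
    refine Finset.sum_congr rfl fun i _ => ?_
    rw [map_smul, Complex.real_smul, show linMetric g p (linFrame g p i) (linFr p m) =
      linMetric g p (linFr p m) (linFrame g p i) from g.symm p _ _]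
  simp only [h1, hX, Finset.mul_sum]
  rw [Finset.sum_comm]
  exact Finset.sum_congr rfl fun m _ => Finset.sum_congr rfl fun i _ => by ring

/-- The components of the Hodge star of a `1`-form given by its metric dual vector. -/
theorem comp_star_of_dual (hJ : IsStandard J) {α : CForm S.Quot 1} {p : S.Quot}
    {X : Fin 4 → ℂ} (hX : ∀ v, lin α p ![v] = ∑ m, X m * (linMetric g p (linFr p m) v : ℂ)) :
    S.comp (g.hodgeStar (show 1 + 3 = 4 from rfl) α) ![1, 2, 3] p = dens g p * X 0 ∧
    S.comp (g.hodgeStar (show 1 + 3 = 4 from rfl) α) ![0, 2, 3] p = -(dens g p * X 1) ∧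
    S.comp (g.hodgeStar (show 1 + 3 = 4 from rfl) α) ![0, 1, 3] p = dens g p * X 2 ∧
    S.comp (g.hodgeStar (show 1 + 3 = 4 from rfl) α) ![0, 1, 2] p = -(dens g p * X 3) := by
  -- Wedging with the forms of the left-invariant coframe isolates the components one at a time.
  have h := fun z => wedge13_star_of_dual g hJ hX (lin (S.constForm z) p)
  simp only [wedge13_fr, comp_constForm, ← comp_one_eq, Fin.sum_univ_four] at h
  have h0 := h ![1, 0, 0, 0]
  have h1 := h ![0, 1, 0, 0]
  have h2 := h ![0, 0, 1, 0]
  have h3 := h ![0, 0, 0, 1]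
  simp at h0 h1 h2 h3
  exact ⟨h0, by linear_combination -h1, h2, by linear_combination -h3⟩

theorem gram_symm (i j : Fin 4) (p : S.Quot) : gram g i j p = gram g j i p := g.symm p _ _

/-- Leaves four independent real coefficients: `g₀₀`, `g₂₂`, `g₀₂` and `g₁₂`. -/
theorem gram_isometry (hJ : IsStandard J) (p : S.Quot) :
    gram g 1 1 p = gram g 0 0 p ∧ gram g 3 3 p = gram g 2 2 p ∧ gram g 0 1 p = 0 ∧
      gram g 2 3 p = 0 ∧ gram g 1 3 p = gram g 0 2 p ∧ gram g 0 3 p = -gram g 1 2 p := by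
  have e1 : linJ J p (linFr p 0) = linFr p 1 := (hJ p).1
  have e2 : linJ J p (linFr p 2) = linFr p 3 := (hJ p).2
  have e3 : linJ J p (linFr p 1) = -linFr p 0 := hJ.frame_one p
  have e4 : linJ J p (linFr p 3) = -linFr p 2 := hJ.frame_three p
  have iso : ∀ v w, linMetric g p (linJ J p v) (linJ J p w) = linMetric g p v w := g.isometry p
  have sym : ∀ v w, linMetric g p v w = linMetric g p w v := g.symm p
  have a1 := iso (linFr p 0) (linFr p 0)
  have a2 := iso (linFr p 2) (linFr p 2)
  have a3 := iso (linFr p 0) (linFr p 1)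
  have a4 := iso (linFr p 2) (linFr p 3)
  have a5 := iso (linFr p 0) (linFr p 2)
  have a6 := iso (linFr p 1) (linFr p 2)
  rw [e1] at a1 a3 a5
  rw [e2] at a2 a4 a5 a6
  rw [e3] at a3 a6
  rw [e4] at a4
  simp only [map_neg, neg_apply] at a3 a4 a6
  have s1 := sym (linFr p 0) (linFr p 1)
  have s2 := sym (linFr p 2) (linFr p 3)
  simp only [gram_eq_lin]
  exact ⟨a1, a2, by linarith, by linarith, a5, by linarith⟩

/-- The metric dual of `z (E⁰ + i E¹)`, multiplied by the volume density. -/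
noncomputable def dualPhi₁ (z : ℂ) (p : S.Quot) : Fin 4 → ℂ :=
  ![z * gram g 2 2 p, Complex.I * z * gram g 2 2 p,
    -(z * (gram g 0 2 p + Complex.I * gram g 1 2 p)),
    -(Complex.I * z * (gram g 0 2 p + Complex.I * gram g 1 2 p))]

/-- Applying the Gram matrix to `(C, iC, -w, -iw)`, with `C = g₂₂` and `w = g₀₂ + i g₁₂`, gives `-wC
+ Cw = 0` on `E₂` and `AC - |w|²`, which is the density, on `E₀`. Thus after multiplication by the
density the dual vector is linear in the metric. -/
theorem lin_smul_phi₁ (hJ : IsStandard J) (z : ℂ) (p : S.Quot) (v : R4) :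
    lin (z • S.phi₁) p ![v] =
      ∑ m, (dens g p : ℂ)⁻¹ * dualPhi₁ g z p m * (linMetric g p (linFr p m) v : ℂ) := by
  let L : R4 →ₗ[ℝ] ℂ :=
    ((ContinuousAlternatingMap.ofSubsingleton ℝ R4 ℂ (0 : Fin 1)).symm (lin (z • S.phi₁) p)).toLinearMap
  have hL : ∀ v, lin (z • S.phi₁) p ![v] = L v :=
    fun v => congrArg (lin (z • S.phi₁) p) (funext fun m => by fin_cases m; rfl)
  let R : R4 →ₗ[ℝ] ℂ := ∑ m, ((dens g p : ℂ)⁻¹ * dualPhi₁ g z p m) •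
    (Complex.ofRealCLM.toLinearMap ∘ₗ (linMetric g p (linFr p m)).toLinearMap)
  have hR : ∀ v, ∑ m, (dens g p : ℂ)⁻¹ * dualPhi₁ g z p m * (linMetric g p (linFr p m) v : ℂ)
      = R v := fun v => by simp [R]
  rw [hL, hR]
  refine LinearMap.congr_fun (S.frameBasis (S.rep p) |>.ext fun j => ?_) v
  rw [S.frameBasis_apply, ← hL, ← hR]
  have e1 : lin (z • S.phi₁) p ![S.E j (S.rep p)] = z * ![1, Complex.I, 0, 0] j := by
    rw [← comp_constForm (S := S) ![1, Complex.I, 0, 0] j p, ← comp_smul]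
    exact (comp_one_eq _ j p).symm
  have e2 : ∀ m, linMetric g p (linFr p m) (S.E j (S.rep p)) = gram g m j p := fun m => rfl
  obtain ⟨g1, g2, g3, g4, g5, g6⟩ := gram_isometry g hJ p
  have hd := dens_ne_zero g hJ p
  have hd' : (dens g p : ℂ) = gram g 0 0 p * gram g 2 2 p - gram g 0 2 p ^ 2 - gram g 1 2 p ^ 2 := by
    simp [dens]
  simp only [e1, e2, mul_assoc, ← Finset.mul_sum]
  rw [eq_inv_mul_iff_mul_eq₀ hd, hd', Fin.sum_univ_four]
  have I2 := Complex.I_sq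
  fin_cases j <;> simp only [Fin.mk_zero, Fin.mk_one, Fin.reduceFinMk, Fin.isValue, dualPhi₁,
    Matrix.cons_val, gram_symm g 1 0, gram_symm g 2 0, gram_symm g 3 0, gram_symm g 2 1,
    gram_symm g 3 1, gram_symm g 3 2, g1, g2, g3, g4, g5, g6] <;> push_cast
  · linear_combination -(z * gram g 1 2 p ^ 2) * I2
  · linear_combination (z * gram g 0 2 p * gram g 1 2 p) * I2
  · ring
  · linear_combination (z * gram g 2 2 p * gram g 1 2 p) * I2

/-- The codifferential of `z (E⁰ + i E¹)`. -/
theorem dens_mul_codiff_phi₁ {c : Fin 4 → Fin 4 → Fin 4 → ℝ} (hc : S.HasStructureConstants c)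
    (hu : IsUnimodular c) (hJ : IsStandard J) (hg : SmoothGram g) (z : ℂ) (p : S.Quot) :
    dens g p * S.comp (g.codiff (k := 0) (l := 3) rfl (z • S.phi₁)) ![] p =
      -(z * (S.lder 0 (fun p => (gram g 2 2 p : ℂ)) p
        + Complex.I * S.lder 1 (fun p => (gram g 2 2 p : ℂ)) p
        - S.lder 2 (fun p => gram g 0 2 p + Complex.I * gram g 1 2 p) p
        - Complex.I * S.lder 3 (fun p => gram g 0 2 p + Complex.I * gram g 1 2 p) p)) := by
  rw [dens_mul_codiff g hJ, comp_d_three hc hu (isSmooth_hodgeStar g hJ hg _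
    (β := z • S.phi₁) (isSmooth_smul z (isSmooth_constForm _)))]
  have hs := fun p => comp_star_of_dual g hJ (lin_smul_phi₁ g hJ z p)
  have hd := fun p => dens_ne_zero g hJ p
  have sC := hg 2 2
  have sw : S.SmoothFn (fun p => (gram g 0 2 p : ℂ) + Complex.I * gram g 1 2 p) :=
    (hg 0 2).add ((smoothFn_const _).mul (hg 1 2))
  -- The density in `*` cancels the inverse density of the dual vector, so what gets differentiated
  -- is linear in the coefficients of the metric.
  rw [show S.comp (g.hodgeStar (show 1 + 3 = 4 from rfl) (z • S.phi₁)) ![1, 2, 3] =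
      fun p => z * gram g 2 2 p from funext fun p => by
        rw [(hs p).1, mul_inv_cancel_left₀ (hd p)]; rfl,
    show S.comp (g.hodgeStar (show 1 + 3 = 4 from rfl) (z • S.phi₁)) ![0, 2, 3] =
      fun p => (-(Complex.I * z)) * gram g 2 2 p from funext fun p => by
        rw [(hs p).2.1, mul_inv_cancel_left₀ (hd p), neg_mul]; rfl,
    show S.comp (g.hodgeStar (show 1 + 3 = 4 from rfl) (z • S.phi₁)) ![0, 1, 3] =
      fun p => (-z) * (gram g 0 2 p + Complex.I * gram g 1 2 p) from funext fun p => by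
        rw [(hs p).2.2.1, mul_inv_cancel_left₀ (hd p), neg_mul]; rfl,
    show S.comp (g.hodgeStar (show 1 + 3 = 4 from rfl) (z • S.phi₁)) ![0, 1, 2] =
      fun p => (Complex.I * z) * (gram g 0 2 p + Complex.I * gram g 1 2 p) from funext fun p => by
        rw [(hs p).2.2.2, mul_inv_cancel_left₀ (hd p), ← neg_neg (Complex.I * z * _)]; rfl]
  rw [lder_const_mul sC, lder_const_mul sC, lder_const_mul sw, lder_const_mul sw]
  ring

/-- The divergence of the metric dual of `E⁰ + i E¹`. -/
noncomputable def divPhi₁ (p : S.Quot) : ℂ :=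
  S.lder 0 (fun p => (gram g 2 2 p : ℂ)) p
    + Complex.I * S.lder 1 (fun p => (gram g 2 2 p : ℂ)) p
    - S.lder 2 (fun p => gram g 0 2 p + Complex.I * gram g 1 2 p) p
    - Complex.I * S.lder 3 (fun p => gram g 0 2 p + Complex.I * gram g 1 2 p) p

theorem hodgeStar_zero {k l : ℕ} (h : k + l = 4) : g.hodgeStar h (0 : CForm S.Quot k) = 0 := by
  funext p
  have h1 : lin (g.hodgeStar h (0 : CForm S.Quot k)) p = 0 := by
    ext v
    have h2 : ∀ v, lin (0 : CForm S.Quot k) p v = 0 := fun _ => rfl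
    rw [lin_hodgeStar, starAt_apply]
    simp [starTerm, h2]
  exact h1

theorem d_zero {k : ℕ} : (0 : CForm S.Quot k).d = 0 := by
  funext p
  have h1 : (0 : CForm S.Quot k).inChart p = fun _ => 0 := by
    funext y
    rfl
  unfold CForm.d
  rw [h1]
  have h2 : extDeriv (fun _ : R4 => (0 : R4 [⋀^Fin k]→L[ℝ] ℂ)) = fun _ => 0 := by
    funext x
    ext v
    simp [extDeriv, ContinuousAlternatingMap.alternatizeUncurryFin_apply]
  rw [h2]
  rfl

theorem laplacian_eq_zero {α : CForm S.Quot 1} (h : α.d = 0)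
    (h' : ∀ p, S.comp (g.codiff (k := 0) (l := 3) rfl α) ![] p = 0) : g.laplacian α = 0 := by
  have e1 : g.codiff (k := 0) (l := 3) rfl α = 0 := by
    refine S.form_ext fun I => funext fun p => ?_
    rw [Subsingleton.elim I ![]]
    exact h' p
  unfold HermitianMetric.laplacian
  rw [e1, h, d_zero, zero_add]
  unfold HermitianMetric.codiff
  rw [hodgeStar_zero, d_zero, hodgeStar_zero, neg_zero]

/-- The closed `(1,0)`-forms are the constant multiples of `E⁰ + i E¹`. -/
def ClosedFormsConstant (S : FramedQuotient) : Prop :=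
  ∀ σ : CForm S.Quot 1, σ.IsSmooth → (∀ p, S.comp σ ![1] p = Complex.I * S.comp σ ![0] p) →
    (∀ p, S.comp σ ![3] p = Complex.I * S.comp σ ![2] p) →
    (σ.d = 0 ↔ ∃ z : ℂ, σ = z • S.phi₁)

theorem phi₁_ne_zero : S.phi₁ ≠ 0 := by
  intro h
  have h1 := comp_constForm (S := S) ![1, Complex.I, 0, 0] 0 (S.proj 0)
  rw [show S.constForm ![1, Complex.I, 0, 0] = 0 from h] at h1
  exact zero_ne_one h1

/-- Harmonic means closed and coclosed. Closedness leaves only the multiples `zφ¹` with `z`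
constant, and since the density does not vanish, coclosedness becomes a scalar equation for `z`. -/
theorem harmonic_iff {c : Fin 4 → Fin 4 → Fin 4 → ℝ} (hc : S.HasStructureConstants c)
    (hu : IsUnimodular c) {μ : MeasureTheory.Measure R4} (hμ : S.IsInvariantIntegral μ)
    (hS : S.ClosedFormsConstant) (hJ : IsStandard J) (hg : SmoothGram g) (σ : CForm S.Quot 1) :
    (σ.IsSmooth ∧ J.IsType10 σ ∧ g.laplacian σ = 0) ↔
      ∃ z : ℂ, σ = z • S.phi₁ ∧ ∀ p, z * divPhi₁ g p = 0 := by
  have hcod : ∀ (z : ℂ) p, S.comp (g.codiff (k := 0) (l := 3) rfl (z • S.phi₁)) ![] p = 0 ↔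
      z * divPhi₁ g p = 0 := by
    intro z p
    rw [← mul_eq_zero_iff_left (dens_ne_zero g hJ p), dens_mul_codiff_phi₁ g hc hu hJ hg,
      neg_eq_zero]
    rfl
  constructor
  · rintro ⟨sσ, tσ, hσ⟩
    obtain ⟨h1, h2⟩ := closed_of_harmonic g hc hu hμ hJ hg sσ hσ
    have t := (isType10_iff hJ σ).mp tσ
    obtain ⟨z, rfl⟩ := (hS σ sσ (fun p => (t p).1) (fun p => (t p).2)).mp h1
    exact ⟨z, rfl, fun p => (hcod z p).mp (h2 p)⟩
  · rintro ⟨z, rfl, hz⟩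
    have sσ := isSmooth_smul z (isSmooth_constForm (S := S) ![1, Complex.I, 0, 0])
    have tσ := isType10_smul z (isType10_phi₁ (S := S) hJ)
    have t := (isType10_iff hJ _).mp tσ
    refine ⟨sσ, tσ, laplacian_eq_zero g ?_ fun p => (hcod z p).mpr (hz p)⟩
    exact (hS _ sσ (fun p => (t p).1) (fun p => (t p).2)).mpr ⟨z, rfl⟩

theorem h10d_eq_one {c : Fin 4 → Fin 4 → Fin 4 → ℝ} (hc : S.HasStructureConstants c)
    (hu : IsUnimodular c) {μ : MeasureTheory.Measure R4} (hμ : S.IsInvariantIntegral μ)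
    (hS : S.ClosedFormsConstant) (hJ : IsStandard J) (hg : SmoothGram g)
    (h : ∀ p, divPhi₁ g p = 0) : g.h10d = 1 := by
  have h1 : g.harmonic10 = Submodule.span ℂ {S.phi₁} := by
    refine le_antisymm (Submodule.span_le.mpr fun σ hσ => ?_) (Submodule.span_mono ?_)
    · obtain ⟨z, rfl, -⟩ := (harmonic_iff g hc hu hμ hS hJ hg σ).mp hσ
      exact Submodule.smul_mem _ _ (Submodule.mem_span_singleton_self _)
    · rintro _ rfl
      exact (harmonic_iff g hc hu hμ hS hJ hg _).mpr ⟨1, (one_smul _ _).symm, fun p => by simp [h]⟩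
  rw [HermitianMetric.h10d, h1, ← Module.finrank_eq_rank, finrank_span_singleton phi₁_ne_zero,
    Nat.cast_one]

/-- The coefficient `z` is a constant, so one point with nonzero divergence already forces `z = 0`.
-/
theorem h10d_eq_zero {c : Fin 4 → Fin 4 → Fin 4 → ℝ} (hc : S.HasStructureConstants c)
    (hu : IsUnimodular c) {μ : MeasureTheory.Measure R4} (hμ : S.IsInvariantIntegral μ)
    (hS : S.ClosedFormsConstant) (hJ : IsStandard J) (hg : SmoothGram g)
    (h : ∃ p, divPhi₁ g p ≠ 0) : g.h10d = 0 := by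
  obtain ⟨p, hp⟩ := h
  have h1 : g.harmonic10 = ⊥ := by
    refine Submodule.span_eq_bot.mpr fun σ hσ => ?_
    obtain ⟨z, rfl, hz⟩ := (harmonic_iff g hc hu hμ hS hJ hg σ).mp hσ
    rw [(mul_eq_zero.mp (hz p)).resolve_right hp]
    exact zero_smul ℂ S.phi₁
  rw [HermitianMetric.h10d, h1, rank_bot]

end FramedQuotient

/-! ### Classification of the closed (1,0)-forms -/

namespace FramedQuotient

variable {S : FramedQuotient}

/-- The commutator of two vector fields of the frame, acting on functions. -/
theorem lder_comm {c : Fin 4 → Fin 4 → Fin 4 → ℝ} (hc : S.HasStructureConstants c)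
    {f : S.Quot → ℂ} (hf : S.SmoothFn f) (i j : Fin 4) (p : S.Quot) :
    S.lder i (S.lder j f) p - S.lder j (S.lder i f) p = ∑ l, (c i j l : ℂ) * S.lder l f p := by
  let φ : R4 → ℂ := fun x => f (S.proj x)
  have hφ : ContDiff ℝ ∞ φ := hf
  have hdφ : ContDiff ℝ ∞ (fderiv ℝ φ) := hφ.fderiv_right (by simp)
  have h1 : ∀ i j, S.lder i (S.lder j f) p =
      fderiv ℝ (fderiv ℝ φ) (S.rep p) (S.E i (S.rep p)) (S.E j (S.rep p)) +
      fderiv ℝ φ (S.rep p) (fderiv ℝ (S.E j) (S.rep p) (S.E i (S.rep p))) := by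
    intro i j
    have h2 : (fun x => S.lder j f (S.proj x)) = fun x => fderiv ℝ φ x (S.E j x) :=
      funext fun x => S.lder_proj hf j x
    change fderiv ℝ (fun x => S.lder j f (S.proj x)) (S.rep p) (S.E i (S.rep p)) = _
    rw [h2, fderiv_clm_apply (hdφ.differentiable (by simp) _)
      ((S.contDiff_frame j).differentiable (by simp) _)]
    simp [add_comm]
  -- By symmetry of the second derivative the second-order terms of the commutator cancel, and the
  -- first-order terms form the Lie bracket.
  have h3 : IsSymmSndFDerivAt ℝ φ (S.rep p) :=
    hφ.contDiffAt.isSymmSndFDerivAt (by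
      rw [minSmoothness_of_isRCLikeNormedField]
      exact WithTop.coe_le_coe.mpr (le_top (a := (2 : ℕ∞))))
  have h4 := congrArg (fderiv ℝ φ (S.rep p)) (hc i j (S.rep p))
  rw [VectorField.lieBracket, map_sub, map_sum] at h4
  rw [h1, h1, h3.eq (S.E i (S.rep p)) (S.E j (S.rep p)), add_sub_add_left_eq_sub, h4]
  refine Finset.sum_congr rfl fun l _ => ?_
  rw [map_smul, Complex.real_smul]
  rfl

/-- A function whose derivatives along the frame vanish is constant. -/
theorem eq_const_of_lder {f : S.Quot → ℂ} (hf : S.SmoothFn f) (h : ∀ j p, S.lder j f p = 0)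
    (p q : S.Quot) : f p = f q := by
  have h1 : ∀ x, fderiv ℝ (fun x => f (S.proj x)) x = 0 := by
    intro x
    have : (fderiv ℝ (fun x => f (S.proj x)) x).toLinearMap = 0 := by
      refine (S.frameBasis x).ext fun j => ?_
      rw [S.frameBasis_apply]
      exact (S.lder_proj hf j x).symm.trans (h j _)
    ext v
    exact LinearMap.congr_fun this v
  have := is_const_of_fderiv_eq_zero (𝕜 := ℝ) (ContDiff.differentiable hf (by simp)) h1
    (S.rep p) (S.rep q)
  simpa only [S.proj_rep] using this

theorem IsInvariantIntegral.integral_lder_add {μ : MeasureTheory.Measure R4}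
    (hμ : S.IsInvariantIntegral μ) {w w' : S.Quot → ℂ} (hw : S.SmoothFn w) (hw' : S.SmoothFn w')
    (i j : Fin 4) : ∫ x, (S.lder i w (S.proj x) + S.lder j w' (S.proj x)) ∂μ = 0 := by
  refine (MeasureTheory.integral_add (hμ.integrable_smooth (S.smoothFn_lder hw i))
    (hμ.integrable_smooth (S.smoothFn_lder hw' j))).trans ?_
  rw [hμ.integral_lder _ _ hw, hμ.integral_lder _ _ hw', add_zero]

/-- If `(E_i + i E_j) h = 0` and `E_i`, `E_j` commute on `h`, then `E_i h = E_j h = 0`. -/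
theorem lder_eq_zero_of_dbar {μ : MeasureTheory.Measure R4} (hμ : S.IsInvariantIntegral μ)
    {h : S.Quot → ℂ} (hh : S.SmoothFn h) {i j : Fin 4}
    (hd : ∀ p, S.lder i h p + Complex.I * S.lder j h p = 0)
    (hcomm : ∀ p, S.lder i (S.lder j h) p = S.lder j (S.lder i h) p) :
    (∀ p, S.lder i h p = 0) ∧ ∀ p, S.lder j h p = 0 := by
  have sa := S.smoothFn_lder hh i
  have sb := S.smoothFn_lder hh j
  have hc := hh.conj
  have ha : S.lder i h = fun p => -Complex.I * S.lder j h p :=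
    funext fun p => by linear_combination hd p
  have hb : S.lder j h = fun p => Complex.I * S.lder i h p :=
    funext fun p => by linear_combination -Complex.I * hd p + S.lder j h p * Complex.I_sq
  -- With `hcomm`, the identities `e1` and `e2` give `E_i²h + E_j²h = 0`. Hence the divergence of
  -- `h̄ (E_i h, E_j h)` is `|E_i h|² + |E_j h|²`, whose integral is therefore zero.
  have e1 : ∀ p, S.lder i (S.lder i h) p = -Complex.I * S.lder i (S.lder j h) p := fun p => by
    conv_lhs => rw [ha]
    rw [lder_const_mul sb]
  have e2 : ∀ p, S.lder j (S.lder j h) p = Complex.I * S.lder j (S.lder i h) p := fun p => by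
    conv_lhs => rw [hb]
    rw [lder_const_mul sa]
  let F : S.Quot → ℝ := fun p => Complex.normSq (S.lder i h p) + Complex.normSq (S.lder j h p)
  let w : S.Quot → ℂ := fun p => S.lder i (fun p => (starRingEnd ℂ) (h p) * S.lder i h p) p +
    S.lder j (fun p => (starRingEnd ℂ) (h p) * S.lder j h p) p
  have hF : ∀ p, 0 ≤ F p := fun p => add_nonneg (Complex.normSq_nonneg _) (Complex.normSq_nonneg _)
  have hwF : ∀ p, w p = (F p : ℂ) := by
    intro p
    simp only [w, F]
    rw [lder_mul hc sa, lder_mul hc sb, lder_conj hh, lder_conj hh, e1, e2, hcomm,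
      Complex.ofReal_add, Complex.normSq_eq_conj_mul_self, Complex.normSq_eq_conj_mul_self]
    ring
  have sw : S.SmoothFn w := (S.smoothFn_lder (hc.mul sa) i).add (S.smoothFn_lder (hc.mul sb) j)
  have hz := hμ.eq_zero_of_ofReal sw hF hwF (hμ.integral_lder_add (hc.mul sa) (hc.mul sb) i j)
  have key : ∀ p, S.lder i h p = 0 ∧ S.lder j h p = 0 := by
    intro p
    have h1 : F p = 0 := by exact_mod_cast (hwF p).symm.trans (hz p)
    have n1 := Complex.normSq_nonneg (S.lder i h p)
    have n2 := Complex.normSq_nonneg (S.lder j h p)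
    simp only [F] at h1
    exact ⟨Complex.normSq_eq_zero.mp (by linarith), Complex.normSq_eq_zero.mp (by linarith)⟩
  exact ⟨fun p => (key p).1, fun p => (key p).2⟩

/-- A constant which is a sum of derivatives vanishes. -/
theorem const_eq_zero_of_lder_add {μ : MeasureTheory.Measure R4} (hμ : S.IsInvariantIntegral μ)
    {f f' : S.Quot → ℂ} (hf : S.SmoothFn f) (hf' : S.SmoothFn f') {i j : Fin 4} {z : ℂ}
    (h : ∀ p, S.lder i f p + S.lder j f' p = z) : z = 0 := by
  -- Multiplication by the conjugate of `z` turns the constant into `|z|² ≥ 0`, to which the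
  -- positivity of the integral applies.
  have s1 := (smoothFn_const (S := S) ((starRingEnd ℂ) z)).mul hf
  have s2 := (smoothFn_const (S := S) ((starRingEnd ℂ) z)).mul hf'
  have h1 := hμ.integral_lder_add s1 s2 i j
  have h2 : ∀ p, S.lder i (fun p => (starRingEnd ℂ) z * f p) p +
      S.lder j (fun p => (starRingEnd ℂ) z * f' p) p = ((Complex.normSq z : ℝ) : ℂ) := by
    intro p
    rw [lder_const_mul hf, lder_const_mul hf', Complex.normSq_eq_conj_mul_self, ← h p]
    ring
  have h3 := hμ.eq_zero_of_ofReal ((S.smoothFn_lder s1 i).add (S.smoothFn_lder s2 j))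
    (F := fun _ => Complex.normSq z) (fun _ => Complex.normSq_nonneg z) h2 h1 (S.proj 0)
  rw [h2] at h3
  exact Complex.normSq_eq_zero.mp (by exact_mod_cast h3)

/-- The structure constants of `[E_i, E_j] = E_k`. -/
def singleBracket (i j k : Fin 4) : Fin 4 → Fin 4 → Fin 4 → ℝ := fun a b l =>
  if l = k then (if a = i ∧ b = j then 1 else if a = j ∧ b = i then -1 else 0) else 0

/-- The structure constants of the Lie algebra of `ℝ × H₃(ℝ)`. -/
def kodairaBracket : Fin 4 → Fin 4 → Fin 4 → ℝ := singleBracket 0 1 2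

/-- The structure constants of the Lie algebra of `Nil⁴`. -/
def nil4Bracket : Fin 4 → Fin 4 → Fin 4 → ℝ := singleBracket 0 1 2 + singleBracket 0 2 3

/-- The structure constants of the Lie algebra of `ℝ × Sol³`. -/
def solBracket : Fin 4 → Fin 4 → Fin 4 → ℝ := singleBracket 0 2 2 - singleBracket 0 3 3

theorem isUnimodular_kodairaBracket : IsUnimodular kodairaBracket where
  skew i j k := by
    fin_cases i <;> fin_cases j <;> simp [kodairaBracket, singleBracket] <;> split_ifs <;> simp
  trace i := by
    fin_cases i <;> simp [kodairaBracket, singleBracket]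

theorem isUnimodular_nil4Bracket : IsUnimodular nil4Bracket where
  skew i j k := by
    fin_cases i <;> fin_cases j <;> simp [nil4Bracket, singleBracket] <;> split_ifs <;> simp
  trace i := by
    fin_cases i <;> simp [nil4Bracket, singleBracket, Fin.sum_univ_four]

theorem isUnimodular_solBracket : IsUnimodular solBracket where
  skew i j k := by
    fin_cases i <;> fin_cases j <;> simp [solBracket, singleBracket] <;> split_ifs <;> simp
  trace i := by
    fin_cases i <;> simp [solBracket, singleBracket]

/-- Reduction of the classification of closed `(1,0)`-forms to a system of equations for their
coefficients. -/
theorem closedFormsConstant_of {c : Fin 4 → Fin 4 → Fin 4 → ℝ} (hc : S.HasStructureConstants c)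
    (h0 : ∀ i j, c i j 0 = 0) (h1 : ∀ i j, c i j 1 = 0)
    (H : ∀ f h : S.Quot → ℂ, S.SmoothFn f → S.SmoothFn h →
      (∀ p, Complex.I * S.lder 0 f p - S.lder 1 f p = (c 0 1 2 + Complex.I * c 0 1 3) * h p) →
      (∀ p, S.lder 0 h p - S.lder 2 f p = (c 0 2 2 + Complex.I * c 0 2 3) * h p) →
      (∀ p, Complex.I * S.lder 0 h p - S.lder 3 f p = (c 0 3 2 + Complex.I * c 0 3 3) * h p) →
      (∀ p, S.lder 1 h p - Complex.I * S.lder 2 f p = (c 1 2 2 + Complex.I * c 1 2 3) * h p) →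
      (∀ p, Complex.I * S.lder 1 h p - Complex.I * S.lder 3 f p =
        (c 1 3 2 + Complex.I * c 1 3 3) * h p) →
      (∀ p, Complex.I * S.lder 2 h p - S.lder 3 h p = (c 2 3 2 + Complex.I * c 2 3 3) * h p) →
      (∀ j p, S.lder j f p = 0) ∧ ∀ p, h p = 0) : S.ClosedFormsConstant := by
  intro σ sσ t1 t3
  refine ⟨fun hσ => ?_, ?_⟩
  · have s := fun j => S.isSmooth_iff_comp.mp sσ ![j]
    have e1 : S.comp σ ![1] = fun p => Complex.I * S.comp σ ![0] p := funext t1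
    have e3 : S.comp σ ![3] = fun p => Complex.I * S.comp σ ![2] p := funext t3
    -- For `σ = fφ¹ + hφ²` the coefficients are the components on `E₀` and `E₂`. Brackets lie in the
    -- span of `E₂` and `E₃`, so only `h` appears on the right-hand side.
    have hd : ∀ i j p, S.lder i (S.comp σ ![j]) p - S.lder j (S.comp σ ![i]) p =
        (c i j 2 + Complex.I * c i j 3) * S.comp σ ![2] p := by
      intro i j p
      have h2 := comp_d_one hc sσ i j p
      rw [hσ, show S.comp (0 : CForm S.Quot 2) ![i, j] p = 0 from rfl, Fin.sum_univ_four, h0, h1,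
        t3 p] at h2
      push_cast at h2
      linear_combination -h2
    have hI : ∀ m j p, S.lder m (fun p => Complex.I * S.comp σ ![j] p) p =
        Complex.I * S.lder m (S.comp σ ![j]) p := fun m j p => lder_const_mul (s j) _ m p
    have d01 := hd 0 1
    have d02 := hd 0 2
    have d03 := hd 0 3
    have d12 := hd 1 2
    have d13 := hd 1 3
    have d23 := hd 2 3
    simp only [e1, e3, hI] at d01 d02 d03 d12 d13 d23
    obtain ⟨hf, hh⟩ := H _ _ (s 0) (s 2) d01 d02 d03 d12 d13 d23
    refine ⟨S.comp σ ![0] (S.proj 0), form_ext_one fun j p => ?_⟩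
    rw [comp_smul, phi₁, comp_constForm]
    have h4 := eq_const_of_lder (s 0) hf p (S.proj 0)
    fin_cases j
    · simpa using h4
    · refine (t1 p).trans ?_
      simp [h4, mul_comm]
    · simpa using hh p
    · refine (t3 p).trans ?_
      simp [hh p]
  · rintro ⟨z, rfl⟩
    exact d_smul_phi₁ hc h0 h1 z

/-- `ε = 0` is `ℝ × H₃(ℝ)` and `ε = 1` is `Nil⁴`. The derivatives along `E₂`, `E₃` are killed before
those along `E₀`, `E₁`, since the commutator `[E₀, E₁] = E₂` must act by zero for
`lder_eq_zero_of_dbar` to apply. -/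
theorem closedFormsConstant_nilpotent {c : Fin 4 → Fin 4 → Fin 4 → ℝ}
    (hc : S.HasStructureConstants c) {μ : MeasureTheory.Measure R4} (hμ : S.IsInvariantIntegral μ)
    {ε : ℝ} (hε : c = singleBracket 0 1 2 + ε • singleBracket 0 2 3) : S.ClosedFormsConstant := by
  have comm : ∀ {f : S.Quot → ℂ}, S.SmoothFn f → ∀ i j p, S.lder i (S.lder j f) p =
      S.lder j (S.lder i f) p + (c i j 2 * S.lder 2 f p + c i j 3 * S.lder 3 f p) := by
    intro f hf i j p
    have := lder_comm hc hf i j p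
    rw [Fin.sum_univ_four, show c i j 0 = 0 by simp [hε, singleBracket],
      show c i j 1 = 0 by simp [hε, singleBracket]] at this
    push_cast at this
    linear_combination this
  refine closedFormsConstant_of hc (fun i j => by simp [hε, singleBracket])
    (fun i j => by simp [hε, singleBracket]) ?_
  intro f h sf sh d01 d02 d03 d12 d13 d23
  simp [hε, singleBracket] at d01 d02 d03 d12 d13 d23
  obtain ⟨h2, h3⟩ := lder_eq_zero_of_dbar hμ sh (i := 2) (j := 3)
    (fun p => by linear_combination -Complex.I * d23 p + S.lder 2 h p * Complex.I_sq)
    (fun p => by rw [comm sh]; simp [hε, singleBracket])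
  -- Eliminating `E₃f` from the components `03` and `13` leaves `(E₀ + iE₁)h = 0`.
  obtain ⟨h0, h1⟩ := lder_eq_zero_of_dbar hμ sh (i := 0) (j := 1)
    (fun p => by linear_combination d13 p - Complex.I * d03 p + S.lder 0 h p * Complex.I_sq)
    (fun p => by rw [comm sh, h2, h3]; simp)
  have hconst := eq_const_of_lder sh (fun j => by fin_cases j <;> assumption)
  -- The component `01` reads `iE₀f - E₁f = h` with `h` constant, and a constant that is a
  -- divergence vanishes.
  have hh : ∀ p, h p = 0 := by
    intro p
    refine const_eq_zero_of_lder_add hμ ((smoothFn_const Complex.I).mul sf)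
      ((smoothFn_const (-1)).mul sf) (i := 0) (j := 1) fun q => ?_
    rw [lder_const_mul sf, lder_const_mul sf, ← hconst q p, ← d01 q]
    ring
  have f2 : ∀ p, S.lder 2 f p = 0 := fun p => by
    have := d02 p
    rw [h0, hh, mul_zero] at this
    linear_combination -this
  have f3 : ∀ p, S.lder 3 f p = 0 := fun p => by
    have := d03 p
    rw [h0] at this
    linear_combination -this
  obtain ⟨f0, f1⟩ := lder_eq_zero_of_dbar hμ sf (i := 0) (j := 1)
    (fun p => by
      have := d01 p
      rw [hh p] at this
      linear_combination -Complex.I * this + S.lder 0 f p * Complex.I_sq)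
    (fun p => by rw [comm sf, f2, f3]; simp)
  exact ⟨fun j => by fin_cases j <;> assumption, hh⟩

/-- Since `[E₀, E₁] = 0` and `[E₂, E₃] = 0`, all derivatives of `f` vanish without knowledge of `h`.
As `ad E₀` has the opposite eigenvalues 1 and -1 on `E₂` and `E₃`, the components `02` and `03` then
read `E₀h = h` and `E₀h = -h`. -/
theorem closedFormsConstant_sol (hc : S.HasStructureConstants solBracket)
    {μ : MeasureTheory.Measure R4} (hμ : S.IsInvariantIntegral μ) : S.ClosedFormsConstant := by
  have comm : ∀ {f : S.Quot → ℂ}, S.SmoothFn f → ∀ i j p, S.lder i (S.lder j f) p =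
      S.lder j (S.lder i f) p + (solBracket i j 2 * S.lder 2 f p + solBracket i j 3 * S.lder 3 f p) := by
    intro f hf i j p
    have := lder_comm hc hf i j p
    rw [Fin.sum_univ_four, show solBracket i j 0 = 0 by simp [solBracket, singleBracket],
      show solBracket i j 1 = 0 by simp [solBracket, singleBracket]] at this
    push_cast at this
    linear_combination this
  refine closedFormsConstant_of hc (fun i j => by simp [solBracket, singleBracket])
    (fun i j => by simp [solBracket, singleBracket]) ?_
  intro f h sf sh d01 d02 d03 d12 d13 d23
  simp [solBracket, singleBracket] at d01 d02 d03 d12 d13 d23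
  obtain ⟨h2, h3⟩ := lder_eq_zero_of_dbar hμ sh (i := 2) (j := 3)
    (fun p => by linear_combination -Complex.I * d23 p + S.lder 2 h p * Complex.I_sq)
    (fun p => by rw [comm sh]; simp [solBracket, singleBracket])
  obtain ⟨f0, f1⟩ := lder_eq_zero_of_dbar hμ sf (i := 0) (j := 1)
    (fun p => by linear_combination -Complex.I * d01 p + S.lder 0 f p * Complex.I_sq)
    (fun p => by rw [comm sf]; simp [solBracket, singleBracket])
  obtain ⟨f2, f3⟩ := lder_eq_zero_of_dbar hμ sf (i := 2) (j := 3)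
    (fun p => by linear_combination Complex.I * d12 p - d13 p + S.lder 2 f p * Complex.I_sq)
    (fun p => by rw [comm sf]; simp [solBracket, singleBracket])
  refine ⟨fun j => by fin_cases j <;> assumption, fun p => ?_⟩
  have e1 := d02 p
  have e2 := d03 p
  rw [f2] at e1
  rw [f3] at e2
  have : 2 * h p = 0 := by
    linear_combination -e1 - Complex.I * e2 + (S.lder 0 h p + h p) * Complex.I_sq
  simpa using this

end FramedQuotient

/-! ### The standard almost complex structure and Hermitian metrics as smooth tensors -/

namespace FramedQuotient

variable (S : FramedQuotient)

/-- The inverse of the tangent trivialization at `p₀` is the differential of the inverse chart, that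
is, of the projection. So in the trivialization the frame of the quotient becomes the smooth frame
`E_j` at the chart point. -/
theorem symm_trivializationAt_frame {p₀ p : S.Quot} (hp : p ∈ (chartAt R4 p₀).source) (j : Fin 4) :
    (trivializationAt R4 (TangentSpace 𝓘(ℝ, R4)) p₀).symm p (S.E j (extChartAt 𝓘(ℝ, R4) p₀ p)) =
      S.fr p j := by
  have h1 := DFunLike.congr_fun (TangentBundle.symmL_trivializationAt (I := 𝓘(ℝ, R4)) hp)
    (S.E j (extChartAt 𝓘(ℝ, R4) p₀ p))
  refine (Bundle.Trivialization.symmL_apply (R := ℝ) _ (by simpa using hp) _).symm.trans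
    (h1.trans ?_)
  have h2 : S.proj (extChartAt 𝓘(ℝ, R4) p₀ p) = p := by
    rw [← S.coe_extChartAt_symm p₀]
    exact (extChartAt 𝓘(ℝ, R4) p₀).left_inv (by rwa [extChartAt_source])
  have h3 := S.dproj_frame (extChartAt 𝓘(ℝ, R4) p₀ p) j
  rw [modelWithCornersSelf_coe, Set.range_id, mfderivWithin_univ, S.coe_extChartAt_symm]
  have h4 : ∀ q, q = p → (S.fr q j : R4) = (S.fr p j : R4) := by
    rintro q rfl
    rfl
  exact Eq.trans (b := (S.fr (S.proj (extChartAt 𝓘(ℝ, R4) p₀ p)) j : R4)) h3 (h4 _ h2)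

theorem continuousLinearMapAt_frame {p₀ p : S.Quot} (hp : p ∈ (chartAt R4 p₀).source)
    (j : Fin 4) :
    (trivializationAt R4 (TangentSpace 𝓘(ℝ, R4)) p₀).continuousLinearMapAt ℝ p (S.fr p j) =
      S.E j (extChartAt 𝓘(ℝ, R4) p₀ p) := by
  have hp' : p ∈ (trivializationAt R4 (TangentSpace 𝓘(ℝ, R4)) p₀).baseSet := by simpa using hp
  rw [← S.symm_trivializationAt_frame hp j, ← Bundle.Trivialization.symmL_apply (R := ℝ) _ hp']
  exact (trivializationAt R4 (TangentSpace 𝓘(ℝ, R4)) p₀).continuousLinearMapAt_symmL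
    (R := ℝ) hp' _

/-- A tensor field which on `G` is given by a smooth family of operators that are compatible with
the left-invariant frame is smooth. -/
theorem contMDiff_endomorphism {T : (p : S.Quot) → TangentSpace 𝓘(ℝ, R4) p →L[ℝ] TangentSpace 𝓘(ℝ, R4) p}
    {m : Fin 4 → Fin 4 → ℝ} (hT : ∀ p j, T p (S.fr p j) = ∑ k, m j k • S.fr p k) :
    ContMDiff 𝓘(ℝ, R4) (𝓘(ℝ, R4).prod 𝓘(ℝ, R4 →L[ℝ] R4)) ∞
    (fun p => Bundle.TotalSpace.mk' (R4 →L[ℝ] R4)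
      (E := fun p : S.Quot => TangentSpace 𝓘(ℝ, R4) p →L[ℝ] TangentSpace 𝓘(ℝ, R4) p) p (T p)) := by
  intro p₀
  rw [contMDiffAt_hom_bundle]
  refine ⟨contMDiffAt_id, ?_⟩
  let L : R4 → R4 →L[ℝ] R4 := fun a =>
    ∑ j, (S.coframeG j a).smulRight (∑ k, m j k • S.E k a)
  have hL : ContDiff ℝ ∞ L := ContDiff.sum fun j _ => (S.contDiff_coframeG j).smulRight
    (ContDiff.sum fun k _ => (S.contDiff_frame k).const_smul (m j k))
  have h1 : ContMDiffAt 𝓘(ℝ, R4) 𝓘(ℝ, R4 →L[ℝ] R4) ∞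
      (fun p => L (extChartAt 𝓘(ℝ, R4) p₀ p)) p₀ :=
    hL.contMDiff.contMDiffAt.comp p₀ contMDiffAt_extChartAt
  refine h1.congr_of_eventuallyEq ?_
  filter_upwards [(chartAt R4 p₀).open_source.mem_nhds (mem_chart_source R4 p₀)] with p hp
  have h2 : (ContinuousLinearMap.inCoordinates R4 (TangentSpace 𝓘(ℝ, R4)) R4
      (TangentSpace 𝓘(ℝ, R4)) p₀ p p₀ p (T p)).toLinearMap =
      (L (extChartAt 𝓘(ℝ, R4) p₀ p)).toLinearMap := by
    refine (S.frameBasis (extChartAt 𝓘(ℝ, R4) p₀ p)).ext fun j => ?_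
    rw [S.frameBasis_apply]
    change (trivializationAt R4 (TangentSpace 𝓘(ℝ, R4)) p₀).continuousLinearMapAt ℝ p (T p
      ((trivializationAt R4 (TangentSpace 𝓘(ℝ, R4)) p₀).symmL ℝ p
        (S.E j (extChartAt 𝓘(ℝ, R4) p₀ p)))) = _
    rw [Bundle.Trivialization.symmL_apply (R := ℝ) _ (by simpa using hp), S.symm_trivializationAt_frame hp, hT, map_sum]
    simp only [map_smul, S.continuousLinearMapAt_frame hp]
    simp [L, S.coframeG_frame]
  exact ContinuousLinearMap.coe_injective h2

/-- A bilinear form on `Γ \ G` whose coefficients in the left-invariant frame are smooth is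
smooth. -/
theorem contMDiff_bilinear
    {B : (p : S.Quot) → TangentSpace 𝓘(ℝ, R4) p →L[ℝ] TangentSpace 𝓘(ℝ, R4) p →L[ℝ] ℝ}
    (hB : ∀ i j, ContDiff ℝ ∞ fun a => B (S.proj a) (S.fr (S.proj a) i) (S.fr (S.proj a) j)) :
    ContMDiff 𝓘(ℝ, R4) (𝓘(ℝ, R4).prod 𝓘(ℝ, R4 →L[ℝ] R4 →L[ℝ] ℝ)) ∞
    (fun p => Bundle.TotalSpace.mk' (R4 →L[ℝ] R4 →L[ℝ] ℝ)
      (E := fun p : S.Quot => TangentSpace 𝓘(ℝ, R4) p →L[ℝ] TangentSpace 𝓘(ℝ, R4) p →L[ℝ] ℝ)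
      p (B p)) := by
  intro p₀
  rw [contMDiffAt_hom_bundle]
  refine ⟨contMDiffAt_id, ?_⟩
  let L : R4 → R4 →L[ℝ] R4 →L[ℝ] ℝ := fun a =>
    ∑ i, (S.coframeG i a).smulRight (∑ j, (B (S.proj a) (S.fr (S.proj a) i) (S.fr (S.proj a) j)) •
      S.coframeG j a)
  have hL : ContDiff ℝ ∞ L := ContDiff.sum fun i _ => (S.contDiff_coframeG i).smulRight
    (ContDiff.sum fun j _ => (hB i j).smul (S.contDiff_coframeG j))
  have h1 : ContMDiffAt 𝓘(ℝ, R4) 𝓘(ℝ, R4 →L[ℝ] R4 →L[ℝ] ℝ) ∞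
      (fun p => L (extChartAt 𝓘(ℝ, R4) p₀ p)) p₀ :=
    hL.contMDiff.contMDiffAt.comp p₀ contMDiffAt_extChartAt
  refine h1.congr_of_eventuallyEq ?_
  filter_upwards [(chartAt R4 p₀).open_source.mem_nhds (mem_chart_source R4 p₀)] with p hp
  have h3 : S.proj (extChartAt 𝓘(ℝ, R4) p₀ p) = p := by
    rw [← S.coe_extChartAt_symm p₀]
    exact (extChartAt 𝓘(ℝ, R4) p₀).left_inv (by rwa [extChartAt_source])
  set b := S.frameBasis (extChartAt 𝓘(ℝ, R4) p₀ p)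
  refine ContinuousLinearMap.coe_injective (b.ext fun i =>
    ContinuousLinearMap.coe_injective (b.ext fun j => ?_))
  simp only [b, S.frameBasis_apply]
  refine (inCoordinates_apply_eq₂ (by simpa using hp) (by simpa using hp)
    (by simp)).trans ?_
  rw [S.symm_trivializationAt_frame hp, S.symm_trivializationAt_frame hp]
  refine Eq.trans (b := B p (S.fr p i) (S.fr p j)) (by simp)
    ((congrArg (fun q => B q (S.fr q i) (S.fr q j)) h3.symm).trans ?_)
  simp [L, S.coframeG_frame]
  rfl

/-- The operator `E₀ ↦ E₁ ↦ -E₀`, `E₂ ↦ E₃ ↦ -E₂` on the tangent space at a point. -/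
noncomputable def stdOperator (p : S.Quot) : R4 →L[ℝ] R4 :=
  ∑ j, (S.coframeG j (S.rep p)).smulRight
    (![S.E 1 (S.rep p), -S.E 0 (S.rep p), S.E 3 (S.rep p), -S.E 2 (S.rep p)] j)

theorem stdOperator_frame (p : S.Quot) (j : Fin 4) : S.stdOperator p (S.E j (S.rep p)) =
    ![S.E 1 (S.rep p), -S.E 0 (S.rep p), S.E 3 (S.rep p), -S.E 2 (S.rep p)] j := by
  simp [stdOperator, S.coframeG_frame]

/-- The left-invariant almost complex structure with `J E₀ = E₁`, `J E₂ = E₃`. -/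
noncomputable def stdJ : AlmostComplexStructure S.Quot where
  toFun p := S.stdOperator p
  sq p := by
    have h : (S.stdOperator p).toLinearMap ∘ₗ (S.stdOperator p).toLinearMap = -LinearMap.id := by
      refine (S.frameBasis (S.rep p)).ext fun j => ?_
      rw [S.frameBasis_apply]
      change S.stdOperator p (S.stdOperator p (S.E j (S.rep p))) = -S.E j (S.rep p)
      fin_cases j <;> simp [S.stdOperator_frame]
    exact fun v => LinearMap.congr_fun h v
  contMDiff := by
    refine S.contMDiff_endomorphism
      (m := ![![0, 1, 0, 0], ![-1, 0, 0, 0], ![0, 0, 0, 1], ![0, 0, -1, 0]]) fun p j => ?_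
    have h := S.stdOperator_frame p j
    have h2 : ∑ k, (![![0, 1, 0, 0], ![-1, 0, 0, 0], ![0, 0, 0, 1], ![0, 0, -1, 0]] :
        Fin 4 → Fin 4 → ℝ) j k • S.E k (S.rep p) =
        ![S.E 1 (S.rep p), -S.E 0 (S.rep p), S.E 3 (S.rep p), -S.E 2 (S.rep p)] j := by
      fin_cases j <;> simp [Fin.sum_univ_four]
    exact h.trans h2.symm

theorem isStandard_stdJ : IsStandard S.stdJ :=
  fun p => ⟨S.stdOperator_frame p 0, S.stdOperator_frame p 2⟩

/-- On the compact unit sphere `B` has a minimum `m > 0`; so `B(v,v) < 1` gives `‖v‖² < 1/m`, and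
`‖v‖ ≤ 1 + ‖v‖²`. It supplies the boundedness condition in the structure of a Riemannian metric. -/
theorem isVonNBounded_of_pos {B : R4 →L[ℝ] R4 →L[ℝ] ℝ} (hB : ∀ v, v ≠ 0 → 0 < B v v) :
    Bornology.IsVonNBounded ℝ {v : R4 | B v v < 1} := by
  have hc : Continuous fun v : R4 => B v v := by fun_prop
  obtain ⟨v₀, hv₀, hmin⟩ := (isCompact_sphere (0 : R4) 1).exists_isMinOn
    (NormedSpace.sphere_nonempty.mpr zero_le_one) hc.continuousOn
  have hpos : 0 < B v₀ v₀ := hB v₀ (by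
    rintro rfl
    simp at hv₀)
  rw [NormedSpace.isVonNBounded_iff', ]
  refine ⟨1 + (B v₀ v₀)⁻¹, fun v hv => ?_⟩
  rcases eq_or_ne v 0 with rfl | hv0
  · rw [norm_zero]
    positivity
  have hn : 0 < ‖v‖ := norm_pos_iff.mpr hv0
  have h1 : B v₀ v₀ ≤ B (‖v‖⁻¹ • v) (‖v‖⁻¹ • v) := hmin (by
    simp [norm_smul, hn.ne'])
  simp only [map_smul, smul_apply, smul_eq_mul] at h1
  have hv1 : B v v < 1 := hv
  have h2 : B v₀ v₀ * ‖v‖ ^ 2 < 1 := by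
    refine lt_of_le_of_lt ?_ hv1
    calc B v₀ v₀ * ‖v‖ ^ 2 ≤ ‖v‖⁻¹ * (‖v‖⁻¹ * B v v) * ‖v‖ ^ 2 := by gcongr
      _ = B v v := by field_simp
  have h3 : ‖v‖ ^ 2 < (B v₀ v₀)⁻¹ := by
    rw [lt_inv_comm₀ (by positivity) hpos, ← one_div, lt_div_iff₀ (by positivity)]
    exact h2
  nlinarith [sq_nonneg (‖v‖ - 1)]

/-- The bilinear form with matrix `G` in the left-invariant frame. -/
noncomputable def bilinearOf (G : Fin 4 → Fin 4 → ℝ) (p : S.Quot) : R4 →L[ℝ] R4 →L[ℝ] ℝ :=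
  ∑ i, (S.coframeG i (S.rep p)).smulRight (∑ j, G i j • S.coframeG j (S.rep p))

theorem bilinearOf_apply (G : Fin 4 → Fin 4 → ℝ) (p : S.Quot) (v w : R4) :
    S.bilinearOf G p v w =
      ∑ i, ∑ j, G i j * (S.coframeG i (S.rep p) v * S.coframeG j (S.rep p) w) := by
  simp only [bilinearOf, sum_apply, ContinuousLinearMap.smulRight_apply, smul_apply, smul_eq_mul,
    Finset.mul_sum]
  exact Finset.sum_congr rfl fun i _ => Finset.sum_congr rfl fun j _ => by ring

theorem bilinearOf_frame (G : Fin 4 → Fin 4 → ℝ) (p : S.Quot) (i j : Fin 4) :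
    S.bilinearOf G p (S.E i (S.rep p)) (S.E j (S.rep p)) = G i j := by
  simp [bilinearOf, S.coframeG_frame]

/-- The matrix of a Hermitian metric in the frame `E₀, JE₀, E₂, JE₂`. -/
def hermitianMatrix (A C b₁ b₂ : ℝ) : Fin 4 → Fin 4 → ℝ :=
  ![![A, 0, b₁, -b₂], ![0, A, b₂, b₁], ![b₁, b₂, C, 0], ![-b₂, b₁, 0, C]]

theorem bilinearOf_hermitianMatrix_pos {A C b₁ b₂ : ℝ} (hA : 0 < A) (h : b₁ ^ 2 + b₂ ^ 2 < A * C)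
    (p : S.Quot) {v : R4} (hv : v ≠ 0) :
    0 < S.bilinearOf (hermitianMatrix A C b₁ b₂) p v v := by
  obtain ⟨x, hx⟩ : ∃ x : Fin 4 → ℝ, ∀ j, S.coframeG j (S.rep p) v = x j := ⟨_, fun _ => rfl⟩
  have hx0 : ¬ (x 0 = 0 ∧ x 1 = 0 ∧ x 2 = 0 ∧ x 3 = 0) := by
    rintro ⟨h0, h1, h2, h3⟩
    apply hv
    rw [S.sum_coframeG (S.rep p) v, Fin.sum_univ_four, hx, hx, hx, hx, h0, h1, h2, h3]
    simp
  -- Completing squares in the first two coordinates; the remaining factor `AC - (b₁² + b₂²)` is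
  -- positive by hypothesis.
  have key : A * S.bilinearOf (hermitianMatrix A C b₁ b₂) p v v =
      (A * x 0 + b₁ * x 2 - b₂ * x 3) ^ 2 + (A * x 1 + b₂ * x 2 + b₁ * x 3) ^ 2 +
      (A * C - (b₁ ^ 2 + b₂ ^ 2)) * (x 2 ^ 2 + x 3 ^ 2) := by
    simp only [bilinearOf_apply, hx, Fin.sum_univ_four, hermitianMatrix, Matrix.cons_val]
    ring
  refine pos_of_mul_pos_right (a := A) ?_ hA.le
  rw [key]
  have hd : 0 < A * C - (b₁ ^ 2 + b₂ ^ 2) := sub_pos.mpr h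
  rcases eq_or_ne (x 2) 0 with h2 | h2
  · rcases eq_or_ne (x 3) 0 with h3 | h3
    · have : 0 < x 0 ^ 2 + x 1 ^ 2 := by
        rcases eq_or_ne (x 0) 0 with h0 | h0
        · have h1 : x 1 ≠ 0 := fun h1 => hx0 ⟨h0, h1, h2, h3⟩
          positivity
        · positivity
      have : 0 < A ^ 2 * (x 0 ^ 2 + x 1 ^ 2) := by positivity
      rw [h2, h3]
      nlinarith
    · positivity
  · positivity

/-- The Hermitian metric with smooth coefficients `A`, `C`, `b₁`, `b₂`. -/
noncomputable def hermitianMetric {A C b₁ b₂ : S.Quot → ℝ}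
    (sA : ContDiff ℝ ∞ fun a => A (S.proj a)) (sC : ContDiff ℝ ∞ fun a => C (S.proj a))
    (s₁ : ContDiff ℝ ∞ fun a => b₁ (S.proj a)) (s₂ : ContDiff ℝ ∞ fun a => b₂ (S.proj a))
    (hA : ∀ p, 0 < A p) (h : ∀ p, b₁ p ^ 2 + b₂ p ^ 2 < A p * C p) : HermitianMetric S.stdJ where
  inner p := S.bilinearOf (hermitianMatrix (A p) (C p) (b₁ p) (b₂ p)) p
  symm p v w := by
    refine (S.bilinearOf_apply _ p v w).trans (Eq.trans ?_ (S.bilinearOf_apply _ p w v).symm)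
    simp only [Fin.sum_univ_four, hermitianMatrix, Matrix.cons_val]
    ring
  pos p v hv := S.bilinearOf_hermitianMatrix_pos (hA p) (h p) p hv
  isVonNBounded p := isVonNBounded_of_pos fun v hv =>
    S.bilinearOf_hermitianMatrix_pos (hA p) (h p) p hv
  contMDiff := by
    refine S.contMDiff_bilinear fun i j => ?_
    have h1 : (fun a => S.bilinearOf (hermitianMatrix (A (S.proj a)) (C (S.proj a))
        (b₁ (S.proj a)) (b₂ (S.proj a))) (S.proj a) (S.E i (S.rep (S.proj a)))
        (S.E j (S.rep (S.proj a)))) = fun a => hermitianMatrix (A (S.proj a)) (C (S.proj a))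
        (b₁ (S.proj a)) (b₂ (S.proj a)) i j := funext fun a => S.bilinearOf_frame _ _ i j
    have z : ContDiff ℝ ∞ fun _ : R4 => (0 : ℝ) := contDiff_const
    have h2 : ContDiff ℝ ∞ fun a => hermitianMatrix (A (S.proj a)) (C (S.proj a))
        (b₁ (S.proj a)) (b₂ (S.proj a)) i j := by
      fin_cases i <;> fin_cases j <;> first | assumption | exact s₂.neg
    rw [← h1] at h2
    exact h2
  isometry p := by
    set B := S.bilinearOf (hermitianMatrix (A p) (C p) (b₁ p) (b₂ p)) p with hB
    have h1 : (B.toLinearMap₁₂.compl₁₂ (S.stdOperator p).toLinearMap (S.stdOperator p).toLinearMap) =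
        B.toLinearMap₁₂ := by
      refine (S.frameBasis (S.rep p)).ext fun i => (S.frameBasis (S.rep p)).ext fun j => ?_
      rw [S.frameBasis_apply, S.frameBasis_apply]
      change B (S.stdOperator p (S.E i (S.rep p))) (S.stdOperator p (S.E j (S.rep p))) =
        B (S.E i (S.rep p)) (S.E j (S.rep p))
      rw [S.stdOperator_frame, S.stdOperator_frame]
      fin_cases i <;> fin_cases j <;>
        simp [hB, S.bilinearOf_frame, hermitianMatrix]
    exact fun v w => LinearMap.congr_fun₂ h1 v w

end FramedQuotient

/-! ### Coefficients of the metrics and the conclusions about them -/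

namespace FramedQuotient

variable {S : FramedQuotient}

theorem contDiff_comp_proj {f : S.Quot → ℝ} (hf : ContMDiff 𝓘(ℝ, R4) 𝓘(ℝ, ℝ) ∞ f) :
    ContDiff ℝ ∞ fun a => f (S.proj a) :=
  contMDiff_iff_contDiff.mp (hf.comp S.contMDiff_proj)

theorem smoothFn_ofReal {f : S.Quot → ℝ} (hf : ContDiff ℝ ∞ fun a => f (S.proj a)) :
    S.SmoothFn fun p => (f p : ℂ) := Complex.ofRealCLM.contDiff.comp hf

section Metric

variable {A C b₁ b₂ : S.Quot → ℝ}
    (sA : ContDiff ℝ ∞ fun a => A (S.proj a)) (sC : ContDiff ℝ ∞ fun a => C (S.proj a))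
    (s₁ : ContDiff ℝ ∞ fun a => b₁ (S.proj a)) (s₂ : ContDiff ℝ ∞ fun a => b₂ (S.proj a))
    (hA : ∀ p, 0 < A p) (h : ∀ p, b₁ p ^ 2 + b₂ p ^ 2 < A p * C p)

theorem gram_hermitianMetric (i j : Fin 4) (p : S.Quot) :
    gram (S.hermitianMetric sA sC s₁ s₂ hA h) i j p =
      hermitianMatrix (A p) (C p) (b₁ p) (b₂ p) i j :=
  S.bilinearOf_frame _ p i j

theorem smoothGram_hermitianMetric : SmoothGram (S.hermitianMetric sA sC s₁ s₂ hA h) := by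
  intro i j
  simp only [gram_hermitianMetric]
  have z : ContDiff ℝ ∞ fun _ : R4 => (0 : ℝ) := contDiff_const
  have h2 : ContDiff ℝ ∞ fun a => hermitianMatrix (A (S.proj a)) (C (S.proj a))
      (b₁ (S.proj a)) (b₂ (S.proj a)) i j := by
    fin_cases i <;> fin_cases j <;> first | assumption | exact s₂.neg
  exact Complex.ofRealCLM.contDiff.comp h2

theorem divPhi₁_hermitianMetric (p : S.Quot) : divPhi₁ (S.hermitianMetric sA sC s₁ s₂ hA h) p =
    S.lder 0 (fun p => (C p : ℂ)) p + Complex.I * S.lder 1 (fun p => (C p : ℂ)) p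
    - S.lder 2 (fun p => b₁ p + Complex.I * b₂ p) p
    - Complex.I * S.lder 3 (fun p => b₁ p + Complex.I * b₂ p) p := by
  unfold divPhi₁
  simp only [gram_hermitianMetric]
  rfl

theorem coframeG_stdOperator (p : S.Quot) (v : R4) (j : Fin 4) :
    S.coframeG j (S.rep p) (S.stdOperator p v) =
      ![-S.coframeG 1 (S.rep p) v, S.coframeG 0 (S.rep p) v, -S.coframeG 3 (S.rep p) v,
        S.coframeG 2 (S.rep p) v] j := by
  fin_cases j <;> simp [stdOperator, Fin.sum_univ_four, S.coframeG_frame]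

theorem eval_constForm (z : Fin 4 → ℂ) (p : S.Quot) (v : R4) :
    (S.constForm z).eval p v = ∑ j, (S.coframeG j (S.rep p) v : ℂ) * z j := by
  rw [← lin_constForm]
  exact congrArg (lin (S.constForm z) p) (funext fun m => by fin_cases m; rfl)

/-- Evaluating `2ω` on `(E₀, E₂)` and `(E₁, E₂)` gives `2g(E₁, E₂) = u + ū` and `-2g(E₀, E₂) = i(u -
ū)`; hence `b₂ = Re u` and `b₁ = Im u`. -/
theorem hasCoefficients_hermitianMetric {r s : S.Quot → ℝ} {u : ℂ}
    (hAr : ∀ p, A p = r p ^ 2) (hCs : ∀ p, C p = s p ^ 2) (hb₁ : ∀ p, b₁ p = u.im)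
    (hb₂ : ∀ p, b₂ p = u.re) :
    (S.hermitianMetric sA sC s₁ s₂ hA h).HasCoefficients S.phi₁ S.phi₂ r s (fun _ => u) := by
  intro p
  suffices key : ∀ v w : R4,
      2 * ((S.bilinearOf (hermitianMatrix (A p) (C p) (b₁ p) (b₂ p)) p (S.stdOperator p v) w : ℝ) : ℂ) =
      Complex.I * (r p : ℂ) ^ 2 * S.phi₁.wedgeConj S.phi₁ p v w
        + Complex.I * (s p : ℂ) ^ 2 * S.phi₂.wedgeConj S.phi₂ p v w
        + u * S.phi₁.wedgeConj S.phi₂ p v w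
        - (starRingEnd ℂ) u * S.phi₂.wedgeConj S.phi₁ p v w from key
  intro v w
  rw [S.bilinearOf_apply]
  unfold CForm.wedgeConj phi₁ phi₂
  rw [eval_constForm _ p v, eval_constForm _ p w, eval_constForm _ p v, eval_constForm _ p w]
  simp only [coframeG_stdOperator]
  obtain ⟨x, hx⟩ : ∃ x : Fin 4 → ℝ, ∀ j, S.coframeG j (S.rep p) v = x j := ⟨_, fun _ => rfl⟩
  obtain ⟨y, hy⟩ : ∃ x : Fin 4 → ℝ, ∀ j, S.coframeG j (S.rep p) w = x j := ⟨_, fun _ => rfl⟩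
  simp only [hx, hy, Fin.sum_univ_four, Matrix.cons_val, hermitianMatrix, hAr, hCs, hb₁, hb₂]
  have hu : u = u.re + u.im * Complex.I := (Complex.re_add_im u).symm
  have hu' : (starRingEnd ℂ) u = u.re - u.im * Complex.I := by
    apply Complex.ext <;> simp
  rw [hu']
  generalize u.re = a at hu ⊢
  generalize u.im = b at hu ⊢
  rw [hu]
  simp only [map_add, map_mul, Complex.conj_ofReal, Complex.conj_I, map_one, map_zero]
  push_cast
  have I2 := Complex.I_sq
  ring_nf
  simp only [I2]
  ring

end Metric

/-- A metric is left-invariant if and only if its coefficients in the left-invariant frame are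
constant. -/
theorem isLeftInvariant_iff {J : AlmostComplexStructure S.Quot} (g : HermitianMetric J) :
    S.IsLeftInvariant g ↔ ∀ i j p q, gram g i j p = gram g i j q := by
  have key : ∀ b a i j, g.val (S.proj (S.leftMul b a))
      (S.dproj (S.leftMul b a) (fderiv ℝ (S.leftMul b) a (S.E i a)))
      (S.dproj (S.leftMul b a) (fderiv ℝ (S.leftMul b) a (S.E j a))) =
      gram g i j (S.proj (S.leftMul b a)) := by
    intro b a i j
    rw [S.fderiv_leftMul_frame, S.fderiv_leftMul_frame, S.dproj_frame, S.dproj_frame]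
    rfl
  have key' : ∀ a i j, g.val (S.proj a) (S.dproj a (S.E i a)) (S.dproj a (S.E j a)) =
      gram g i j (S.proj a) := by
    intro a i j
    rw [S.dproj_frame, S.dproj_frame]
    rfl
  constructor
  · intro h i j p q
    let := S.group
    have h1 := h (S.rep q * (S.rep p)⁻¹) (S.rep p) (S.E i (S.rep p)) (S.E j (S.rep p))
    rw [key, key', show S.leftMul (S.rep q * (S.rep p)⁻¹) (S.rep p) = S.rep q from
      inv_mul_cancel_right _ _, S.proj_rep, S.proj_rep] at h1
    exact h1.symm
  · intro h b a
    let D₁ : R4 →ₗ[ℝ] R4 := (mfderiv 𝓘(ℝ, R4) 𝓘(ℝ, R4) S.proj (S.leftMul b a)).toLinearMap ∘ₗ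
      (fderiv ℝ (S.leftMul b) a).toLinearMap
    let D₂ : R4 →ₗ[ℝ] R4 := (mfderiv 𝓘(ℝ, R4) 𝓘(ℝ, R4) S.proj a).toLinearMap
    have h1 : (linMetric g (S.proj (S.leftMul b a))).toLinearMap₁₂.compl₁₂ D₁ D₁ =
        (linMetric g (S.proj a)).toLinearMap₁₂.compl₁₂ D₂ D₂ := by
      refine (S.frameBasis a).ext fun i => (S.frameBasis a).ext fun j => ?_
      rw [S.frameBasis_apply, S.frameBasis_apply]
      exact (key b a i j).trans ((h i j _ _).trans (key' a i j).symm)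
    exact fun v w => LinearMap.congr_fun₂ h1 v w

theorem smoothGram_of_const {J : AlmostComplexStructure S.Quot} {g : HermitianMetric J}
    (h : ∀ i j p q, gram g i j p = gram g i j q) : SmoothGram g := by
  intro i j
  rw [show (fun p => (gram g i j p : ℂ)) = fun _ => (gram g i j (S.proj 0) : ℂ) from
    funext fun p => by rw [h i j p (S.proj 0)]]
  exact smoothFn_const _

theorem divPhi₁_of_const {J : AlmostComplexStructure S.Quot} {g : HermitianMetric J}
    (h : ∀ i j p q, gram g i j p = gram g i j q) (p : S.Quot) : divPhi₁ g p = 0 := by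
  have e : ∀ i j, gram g i j = fun _ => gram g i j (S.proj 0) := fun i j =>
    funext fun q => h i j q _
  unfold divPhi₁
  rw [e 2 2, e 0 2, e 1 2]
  simp only [lder_const]
  ring

theorem lder_exp_sq {F : S.Quot → ℝ} (hF : ContDiff ℝ ∞ fun a => F (S.proj a)) (j : Fin 4) (a : R4) :
    S.lder j (fun p => ((Real.exp (F p) ^ 2 : ℝ) : ℂ)) (S.proj a) =
      2 * (Real.exp (F (S.proj a)) ^ 2 : ℝ) *
        (fderiv ℝ (fun x => F (S.proj x)) a (S.E j a) : ℂ) := by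
  rw [S.lder_proj (smoothFn_ofReal (hF.exp.pow 2))]
  have h1 := (((hF.differentiable (by simp) a).hasFDerivAt.exp).pow 2)
  have h2 := (Complex.ofRealCLM.hasFDerivAt.comp a h1).fderiv
  refine (DFunLike.congr_fun h2 _).trans ?_
  simp
  ring

/-- The conclusions about metrics on `Γ \ G`, from the structure constants, an invariant integral
and the classification of closed `(1,0)`-forms. -/
theorem exists_almostComplexStructure {c : Fin 4 → Fin 4 → Fin 4 → ℝ}
    (hc : S.HasStructureConstants c) (hu : IsUnimodular c) {μ : MeasureTheory.Measure R4}
    (hμ : S.IsInvariantIntegral μ) (hS : S.ClosedFormsConstant)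
    (hF : ∃ F : S.Quot → ℝ, ContMDiff 𝓘(ℝ, R4) 𝓘(ℝ, ℝ) ∞ F ∧ ∃ a : R4, S.V1bar F a ≠ 0) :
    ∃ (J : AlmostComplexStructure S.Quot) (φ₁ φ₂ : CForm S.Quot 1),
      S.IsCoframe φ₁ φ₂ ∧ φ₁.IsSmooth ∧ φ₂.IsSmooth ∧ J.IsType10 φ₁ ∧ J.IsType10 φ₂ ∧
      (∀ σ : CForm S.Quot 1, σ.IsSmooth → J.IsType10 σ → (σ.d = 0 ↔ ∃ c : ℂ, σ = c • φ₁)) ∧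
      (∃ g : HermitianMetric J, S.IsLeftInvariant g) ∧
      (∀ g : HermitianMetric J, S.IsLeftInvariant g → g.h10d = 1) ∧
      (∀ (F r : S.Quot → ℝ) (u : ℂ),
        ContMDiff 𝓘(ℝ, R4) 𝓘(ℝ, ℝ) ∞ F → ContMDiff 𝓘(ℝ, R4) 𝓘(ℝ, ℝ) ∞ r →
        (∀ p, 0 < r p) → (∀ p, ‖u‖ < r p * Real.exp (F p)) →
        ∃ g : HermitianMetric J,
          g.HasCoefficients φ₁ φ₂ r (fun p => Real.exp (F p)) (fun _ => u) ∧
          (g.h10d = 0 ↔ ∃ a : R4, S.V1bar F a ≠ 0)) ∧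
      (∃ g : HermitianMetric J, ¬ S.IsLeftInvariant g ∧ g.h10d = 0) := by
  have hJ := S.isStandard_stdJ
  have hinv : ∀ g : HermitianMetric S.stdJ, S.IsLeftInvariant g → g.h10d = 1 := by
    intro g hg
    have h1 := (isLeftInvariant_iff g).mp hg
    exact h10d_eq_one g hc hu hμ hS hJ (smoothGram_of_const h1) (divPhi₁_of_const h1)
  have hmetric : ∀ (F r : S.Quot → ℝ) (u : ℂ),
        ContMDiff 𝓘(ℝ, R4) 𝓘(ℝ, ℝ) ∞ F → ContMDiff 𝓘(ℝ, R4) 𝓘(ℝ, ℝ) ∞ r →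
        (∀ p, 0 < r p) → (∀ p, ‖u‖ < r p * Real.exp (F p)) →
        ∃ g : HermitianMetric S.stdJ,
          g.HasCoefficients S.phi₁ S.phi₂ r (fun p => Real.exp (F p)) (fun _ => u) ∧
          (g.h10d = 0 ↔ ∃ a : R4, S.V1bar F a ≠ 0) := by
    intro F r u sF sr hr hru
    have sF' := contDiff_comp_proj sF
    have sA : ContDiff ℝ ∞ fun a => r (S.proj a) ^ 2 := (contDiff_comp_proj sr).pow 2
    have sC : ContDiff ℝ ∞ fun a => Real.exp (F (S.proj a)) ^ 2 := sF'.exp.pow 2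
    have hA : ∀ p, 0 < r p ^ 2 := fun p => pow_pos (hr p) 2
    have hAC : ∀ p, u.im ^ 2 + u.re ^ 2 < r p ^ 2 * Real.exp (F p) ^ 2 := by
      intro p
      have h1 := Complex.sq_norm u
      rw [Complex.normSq_apply] at h1
      have h2 : ‖u‖ ^ 2 < (r p * Real.exp (F p)) ^ 2 :=
        pow_lt_pow_left₀ (hru p) (norm_nonneg u) two_ne_zero
      rw [mul_pow] at h2
      nlinarith
    let g := S.hermitianMetric (A := fun p => r p ^ 2) (C := fun p => Real.exp (F p) ^ 2)
      (b₁ := fun _ => u.im) (b₂ := fun _ => u.re) sA sC contDiff_const contDiff_const hA hAC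
    have hg : SmoothGram g := smoothGram_hermitianMetric sA sC contDiff_const contDiff_const hA hAC
    refine ⟨g, hasCoefficients_hermitianMetric _ _ _ _ _ _ (fun _ => rfl) (fun _ => rfl)
      (fun _ => rfl) (fun _ => rfl), ?_⟩
    -- With `g₂₂ = e^{2F}` and constant `g₀₂`, `g₁₂`, the divergence is `2e^{2F}(E₀F + iE₁F)`; the
    -- coefficient `r` does not enter.
    have hdiv : ∀ a, divPhi₁ g (S.proj a) =
        4 * (Real.exp (F (S.proj a)) ^ 2 : ℝ) * S.V1bar F a := by
      intro a
      refine (divPhi₁_hermitianMetric sA sC contDiff_const contDiff_const hA hAC _).trans ?_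
      rw [lder_exp_sq sF', lder_exp_sq sF', lder_const, lder_const, V1bar]
      ring
    have hne : ∀ a, (4 * (Real.exp (F (S.proj a)) ^ 2 : ℝ) : ℂ) ≠ 0 := fun a =>
      mul_ne_zero (by norm_num) (Complex.ofReal_ne_zero.mpr (by positivity))
    constructor
    · intro h0
      by_contra! hV
      have h1 := h10d_eq_one g hc hu hμ hS hJ hg fun p => by
        rw [← S.proj_rep p, hdiv, hV, mul_zero]
      exact zero_ne_one (h0.symm.trans h1)
    · rintro ⟨a, ha⟩
      exact h10d_eq_zero g hc hu hμ hS hJ hg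
        ⟨S.proj a, by rw [hdiv]; exact mul_ne_zero (hne a) ha⟩
  refine ⟨S.stdJ, S.phi₁, S.phi₂, isCoframe_phi, isSmooth_constForm _, isSmooth_constForm _,
    isType10_phi₁ hJ, isType10_phi₂ hJ, ?_, ?_, hinv, hmetric, ?_⟩
  · intro σ sσ tσ
    have t := (isType10_iff hJ σ).mp tσ
    exact hS σ sσ (fun p => (t p).1) fun p => (t p).2
  · refine ⟨S.hermitianMetric (A := fun _ => 1) (C := fun _ => 1) (b₁ := fun _ => 0)
      (b₂ := fun _ => 0) contDiff_const contDiff_const contDiff_const contDiff_const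
      (fun _ => one_pos) (fun _ => by norm_num), ?_⟩
    rw [isLeftInvariant_iff]
    intro i j p q
    rw [gram_hermitianMetric, gram_hermitianMetric]
  · obtain ⟨F, sF, hV⟩ := hF
    obtain ⟨g, -, hg⟩ := hmetric F (fun _ => 1) 0 sF contMDiff_const (fun _ => one_pos) (fun p => by
      rw [norm_zero, one_mul]
      exact Real.exp_pos _)
    have h0 := hg.mpr hV
    -- Left-invariant metrics have value 1, so the value 0 itself excludes left-invariance.
    exact ⟨g, fun hinv' => zero_ne_one (h0.symm.trans (hinv g hinv')), h0⟩

end FramedQuotient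

/-! ### Volume-preserving flows, fundamental domains and the topology of the quotient -/

open MeasureTheory

theorem measurePreserving_of_det {f : R4 → R4} {f' : R4 → R4 →L[ℝ] R4}
    (hf : ∀ x, HasFDerivAt f (f' x) x) (hbij : Function.Bijective f) (hdet : ∀ x, (f' x).det = 1) :
    MeasurePreserving f volume volume := by
  have hc : Continuous f := continuous_iff_continuousAt.mpr fun x => (hf x).continuousAt
  refine ⟨hc.measurable, ?_⟩
  have h := map_withDensity_abs_det_fderiv_eq_addHaar (μ := (volume : Measure R4))
    MeasurableSet.univ.nullMeasurableSet (fun x _ => (hf x).hasFDerivWithinAt) hbij.1.injOn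
  simpa [hdet, Set.range_eq_univ.mpr hbij.2] using h

/-- The derivative is the identity plus a rank-one map whose image has no `k`-component because `V`
has none; it is a transvection of determinant 1. Coordinate `k` is fixed, so the shear with `-t` is
the inverse. -/
theorem measurePreserving_shear {V : ℝ → R4} (hV : Differentiable ℝ V) {k : Fin 4}
    (hk : ∀ s, V s k = 0) (t : ℝ) :
    MeasurePreserving (fun a : R4 => a + t • V (a k)) volume volume := by
  have hpr : ∀ a : R4, HasFDerivAt (fun a : R4 => a k)
      (EuclideanSpace.proj (𝕜 := ℝ) k : R4 →L[ℝ] ℝ) a := fun a =>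
    (EuclideanSpace.proj (𝕜 := ℝ) k : R4 →L[ℝ] ℝ).hasFDerivAt
  have h1 : ∀ a : R4, HasFDerivAt (fun a : R4 => a + t • V (a k))
      (ContinuousLinearMap.id ℝ R4 +
        t • (EuclideanSpace.proj (𝕜 := ℝ) k : R4 →L[ℝ] ℝ).smulRight (deriv V (a k))) a := by
    intro a
    have h2 := ((hV (a k)).hasDerivAt.hasFDerivAt.comp a (hpr a)).const_smul t
    refine ((hasFDerivAt_id a).add h2).congr_fderiv ?_
    ext v
    simp
  have hk' : ∀ s, deriv V s k = 0 := by
    intro s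
    have h3 := ((EuclideanSpace.proj (𝕜 := ℝ) k : R4 →L[ℝ] ℝ).hasFDerivAt.comp_hasDerivAt s
      (hV s).hasDerivAt)
    have h4 : (⇑(EuclideanSpace.proj (𝕜 := ℝ) k : R4 →L[ℝ] ℝ) ∘ V) = fun _ => (0 : ℝ) :=
      funext hk
    rw [h4] at h3
    exact h3.unique (hasDerivAt_const s 0)
  refine measurePreserving_of_det h1 ?_ fun a => ?_
  · refine Function.bijective_iff_has_inverse.mpr ⟨fun a => a + (-t) • V (a k), ?_, ?_⟩
    · intro a
      simp [hk]
    · intro a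
      simp [hk]
  · have h5 : ((ContinuousLinearMap.id ℝ R4 +
        t • (EuclideanSpace.proj (𝕜 := ℝ) k : R4 →L[ℝ] ℝ).smulRight (deriv V (a k))) :
        R4 →L[ℝ] R4).toLinearMap = LinearMap.transvection
          (EuclideanSpace.proj (𝕜 := ℝ) k : R4 →L[ℝ] ℝ).toLinearMap (t • deriv V (a k)) := by
      ext v
      simp [LinearMap.transvection.apply]
      ring
    rw [ContinuousLinearMap.det, h5, LinearMap.transvection.det]
    simp [hk']

namespace FramedQuotient

variable {S : FramedQuotient}

/-- A bounded fundamental domain for `Γ`, for a volume-preserving left-invariant frame whose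
vector fields have straight integral curves. -/
structure HasBoundedDomain (S : FramedQuotient) (D : Set R4) : Prop where
  det_frame : ∃ δ : ℝ, ∀ a, (S.frameMap a).det = δ
  shear : ∀ j, ∃ (k : Fin 4) (V : ℝ → R4), Differentiable ℝ V ∧ (∀ s, V s k = 0) ∧
    ∀ a, S.E j a = V (a k)
  equivariant : ∀ b a j (t : ℝ),
    S.leftMul b (a + t • S.E j a) = S.leftMul b a + t • S.E j (S.leftMul b a)
  measurable : MeasurableSet D
  bounded : Bornology.IsBounded D
  exists_unique : ∀ a, ∃! γ, γ ∈ S.Γ ∧ S.leftMul γ a ∈ D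

theorem bijective_leftMul (b : R4) : Function.Bijective (S.leftMul b) := by
  let := S.group
  exact (Equiv.mulLeft b).bijective

/-- Left translation carries the frame to the frame, and the determinant of the frame is constant
and nonzero; so the Jacobian is 1. -/
theorem HasBoundedDomain.measurePreserving_leftMul {D : Set R4} (hD : S.HasBoundedDomain D)
    (b : R4) : MeasurePreserving (S.leftMul b) volume volume := by
  refine measurePreserving_of_det (fun x => (S.differentiable_leftMul b x).hasFDerivAt)
    (bijective_leftMul b) fun a => ?_
  obtain ⟨δ, hδ⟩ := hD.det_frame
  have h1 : fderiv ℝ (S.leftMul b) a ∘L S.frameMap a = S.frameMap (S.leftMul b a) := by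
    ext1 v
    rw [ContinuousLinearMap.comp_apply, frameMap_apply, frameMap_apply, map_sum]
    simp only [map_smul, S.fderiv_leftMul_frame]
  have h2 : (fderiv ℝ (S.leftMul b) a).det * (S.frameMap a).det =
      (S.frameMap (S.leftMul b a)).det := by
    rw [← h1]
    exact (LinearMap.det_comp _ _).symm
  have h3 : (S.frameMap a).det ≠ 0 := by
    rw [← S.coe_frameEquiv]
    exact ((S.frameEquiv a).toLinearEquiv.isUnit_det').ne_zero
  rw [hδ, hδ] at h2
  rw [hδ] at h3
  exact mul_right_cancel₀ h3 (h2.trans (one_mul δ).symm)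

theorem HasBoundedDomain.measurePreserving_flow {D : Set R4} (hD : S.HasBoundedDomain D)
    (j : Fin 4) (t : ℝ) : MeasurePreserving (fun a => a + t • S.E j a) volume volume := by
  obtain ⟨k, V, hV, hk, h⟩ := hD.shear j
  simp only [h]
  exact measurePreserving_shear hV hk t

theorem HasBoundedDomain.flow_flow {D : Set R4} (hD : S.HasBoundedDomain D)
    (j : Fin 4) (t : ℝ) (a : R4) : (a + t • S.E j a) + (-t) • S.E j (a + t • S.E j a) = a := by
  obtain ⟨k, V, hV, hk, h⟩ := hD.shear j
  simp [h, hk]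

theorem countable_Γ (S : FramedQuotient) : Countable S.Γ := by
  have : DiscreteTopology S.Γ := isDiscrete_iff_discreteTopology.mp S.discrete
  exact countable_of_Lindelof_of_discrete

theorem HasBoundedDomain.isFundamentalDomain {D : Set R4} (hD : S.HasBoundedDomain D) :
    letI := S.group
    IsFundamentalDomain S.Γ D (volume : Measure R4) := by
  let := S.group
  refine IsFundamentalDomain.mk' hD.measurable.nullMeasurableSet fun a => ?_
  obtain ⟨γ, ⟨h1, h2⟩, h3⟩ := hD.exists_unique a
  exact ⟨⟨γ, h1⟩, h2, fun γ' h' => Subtype.ext (h3 γ' ⟨γ'.2, h'⟩)⟩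

theorem smulInvariantMeasure {D : Set R4} (hD : S.HasBoundedDomain D) :
    letI := S.group
    SMulInvariantMeasure S.Γ R4 (volume : Measure R4) := by
  let := S.group
  exact ⟨fun γ s hs => (hD.measurePreserving_leftMul γ).measure_preimage hs.nullMeasurableSet⟩

theorem measurableConstSMul (S : FramedQuotient) :
    letI := S.group
    MeasurableConstSMul S.Γ R4 := by
  let := S.group
  exact ⟨fun γ => (S.contDiff_leftMul γ).continuous.measurable⟩

/-- The flow preserves volume and commutes with `Γ`, so it maps the fundamental domain to another
one, and a `Γ`-invariant function has the same integral over both. -/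
theorem HasBoundedDomain.integral_flow {D : Set R4} (hD : S.HasBoundedDomain D)
    (f : S.Quot → ℂ) (j : Fin 4) (t : ℝ) :
    ∫ a in D, f (S.proj (a + t • S.E j a)) = ∫ a in D, f (S.proj a) := by
  let := S.group
  have := S.countable_Γ
  have := smulInvariantMeasure hD
  have := S.measurableConstSMul
  have hfd := hD.isFundamentalDomain
  let Φ : ℝ → R4 → R4 := fun t a => a + t • S.E j a
  let e : R4 ≃ R4 := ⟨Φ t, Φ (-t), hD.flow_flow j t, fun a => by
    have := hD.flow_flow j (-t) a
    rwa [neg_neg] at this⟩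
  have h1 : IsFundamentalDomain S.Γ (e '' D) (volume : Measure R4) := by
    refine hfd.image_of_equiv e (hD.measurePreserving_flow j (-t)).quasiMeasurePreserving
      (Equiv.refl _) fun γ a => ?_
    exact (hD.equivariant γ a j t).symm
  have hemb : MeasurableEmbedding (Φ t) :=
    (MeasurableEquiv.mk e (hD.measurePreserving_flow j t).measurable
      (hD.measurePreserving_flow j (-t)).measurable).measurableEmbedding
  have h2 := (hD.measurePreserving_flow j t).setIntegral_image_emb hemb
    (fun a => f (S.proj a)) D
  refine h2.symm.trans (h1.setIntegral_eq hfd fun γ a => ?_)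
  exact congrArg f (S.proj_leftMul γ.2 a)

theorem HasBoundedDomain.integrable {D : Set R4} (hD : S.HasBoundedDomain D) {f : R4 → ℂ}
    (hf : Continuous f) : IntegrableOn f D :=
  (hf.continuousOn.integrableOn_compact hD.bounded.isCompact_closure).mono_set subset_closure

theorem HasBoundedDomain.isInvariantIntegral {D : Set R4} (hD : S.HasBoundedDomain D) :
    S.IsInvariantIntegral (volume.restrict D) where
  integrable f hf := hD.integrable hf
  integral_lder j f hf := by
    let φ : R4 → ℂ := fun x => f (S.proj x)
    have hφ : ContDiff ℝ ∞ φ := hf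
    let F : ℝ → R4 → ℂ := fun t a => φ (a + t • S.E j a)
    let F' : ℝ → R4 → ℂ := fun t a => fderiv ℝ φ (a + t • S.E j a) (S.E j a)
    have hE := (S.contDiff_frame j).continuous
    have hF' : Continuous fun q : ℝ × R4 => F' q.1 q.2 :=
      ((hφ.continuous_fderiv (by simp)).comp (by fun_prop)).clm_apply (hE.comp continuous_snd)
    -- The `t`-derivative is continuous on the compact set `[-1,1] × closure D`; its bound there
    -- dominates when differentiating under the integral.
    obtain ⟨B, hB⟩ := ((isCompact_Icc (a := (-1 : ℝ)) (b := 1)).prod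
      hD.bounded.isCompact_closure).exists_bound_of_continuousOn hF'.continuousOn
    have hFt : ∀ t, Continuous (F t) := fun t => hφ.continuous.comp (by fun_prop)
    have hder : ∀ t a, HasDerivAt (fun t => F t a) (F' t a) t := by
      intro t a
      have h1 : HasDerivAt (fun t : ℝ => a + t • S.E j a) (S.E j a) t := by
        simpa using ((hasDerivAt_id t).smul_const (S.E j a)).const_add a
      exact ((hφ.differentiable (by simp) _).hasFDerivAt).comp_hasDerivAt t h1
    have key := hasDerivAt_integral_of_dominated_loc_of_deriv_le (μ := volume.restrict D)
      (F := F) (F' := F') (x₀ := 0) (bound := fun _ => B) (s := Set.Ioo (-1) 1)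
      (Ioo_mem_nhds (by norm_num) (by norm_num))
      (Filter.Eventually.of_forall fun t => (hFt t).aestronglyMeasurable)
      (hD.integrable (hFt 0))
      (hF'.comp (continuous_const.prodMk continuous_id)).aestronglyMeasurable
      ((ae_restrict_mem hD.measurable).mono fun a ha t ht =>
        hB (t, a) ⟨Set.Ioo_subset_Icc_self ht, subset_closure ha⟩)
      (integrableOn_const (hD.bounded.measure_lt_top).ne)
      (Filter.Eventually.of_forall fun a t _ => hder t a)
    -- The integral is independent of `t`, so its derivative at `t = 0`, the integral of `E_j f`, is
    -- zero.
    have h2 : (fun t => ∫ a in D, F t a) = fun _ => ∫ a in D, φ a :=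
      funext fun t => hD.integral_flow f j t
    have h3 := key.2
    rw [h2] at h3
    have h4 := h3.unique (hasDerivAt_const 0 _)
    rw [← h4]
    refine integral_congr_ae (Filter.Eventually.of_forall fun a => ?_)
    simp [F', φ, S.lder_proj hf]
  eq_zero f hf h0 hint := by
    let := S.group
    have := S.countable_Γ
    have := smulInvariantMeasure hD
    have := S.measurableConstSMul
    have h1 : IntegrableOn (fun x => f (S.proj x)) D :=
      (hf.continuousOn.integrableOn_compact hD.bounded.isCompact_closure).mono_set subset_closure
    have h2 := (integral_eq_zero_iff_of_nonneg (fun a => h0 (S.proj a)) h1).mp hint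
    let N : Set R4 := {a | f (S.proj a) ≠ 0}
    have h3 : volume (N ∩ D) = 0 := by
      rw [← Measure.restrict_apply' hD.measurable]
      exact h2
    -- The set `N` is `Γ`-invariant and null inside the fundamental domain, hence null; a continuous
    -- function that vanishes almost everywhere vanishes.
    have h4 : volume N = 0 := by
      refine hD.isFundamentalDomain.measure_zero_of_invariant N (fun γ => ?_) h3
      ext a
      rw [Set.mem_smul_set_iff_inv_smul_mem]
      exact not_congr (Eq.congr_left (congrArg f (S.proj_leftMul (γ⁻¹).2 a)))
    have h5 : (fun a => f (S.proj a)) =ᵐ[volume] fun _ => 0 := h4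
    have h6 := (Continuous.ae_eq_iff_eq volume hf continuous_const).mp h5
    intro p
    rw [← S.proj_rep p]
    exact congrFun h6 _

theorem continuous_proj (S : FramedQuotient) : Continuous S.proj := S.contMDiff_proj.continuous

theorem HasBoundedDomain.compactSpace {D : Set R4} (hD : S.HasBoundedDomain D) :
    CompactSpace S.Quot := by
  refine ⟨?_⟩
  have h1 : S.proj '' closure D = Set.univ := by
    refine Set.eq_univ_of_forall fun p => ?_
    obtain ⟨γ, ⟨hγ, h⟩, -⟩ := hD.exists_unique (S.rep p)
    exact ⟨_, subset_closure h, by rw [S.proj_leftMul hγ, S.proj_rep]⟩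
  rw [← h1]
  exact hD.bounded.isCompact_closure.image S.continuous_proj

theorem connectedSpace (S : FramedQuotient) : ConnectedSpace S.Quot :=
  S.proj_surjective.connectedSpace S.continuous_proj

/-- A discrete subgroup acts properly discontinuously by translations, and such an orbit space is
Hausdorff. -/
theorem t2Space (S : FramedQuotient) : T2Space S.Quot := by
  let := S.group
  have := S.isTopologicalGroup
  have : DiscreteTopology S.Γ := isDiscrete_iff_discreteTopology.mp S.discrete
  have : ProperlyDiscontinuousSMul S.Γ R4 :=
    S.Γ.properlyDiscontinuousSMul_of_tendsto_cofinite (S.Γ.tendsto_coe_cofinite_of_discrete S.discrete)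
  exact inferInstanceAs (T2Space (Quotient (MulAction.orbitRel S.Γ R4)))

end FramedQuotient

/-! ### Periodic functions, brackets of frames, and the Kodaira surface -/

namespace FramedQuotient

variable {S : FramedQuotient}

theorem contMDiff_of_comp_proj {F : S.Quot → ℝ} (hF : ContDiff ℝ ∞ fun a => F (S.proj a)) :
    ContMDiff 𝓘(ℝ, R4) 𝓘(ℝ, ℝ) ∞ F := by
  intro p₀
  have h1 : ContMDiffAt 𝓘(ℝ, R4) 𝓘(ℝ, ℝ) ∞ (fun p => F (S.proj (extChartAt 𝓘(ℝ, R4) p₀ p))) p₀ :=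
    hF.contMDiff.contMDiffAt.comp p₀ contMDiffAt_extChartAt
  refine h1.congr_of_eventuallyEq ?_
  filter_upwards [(chartAt R4 p₀).open_source.mem_nhds (mem_chart_source R4 p₀)] with p hp
  rw [← S.coe_extChartAt_symm p₀, (extChartAt 𝓘(ℝ, R4) p₀).left_inv (by rwa [extChartAt_source])]

/-- If `Γ` acts on a coordinate by translations by multiples of `T`, then `Γ \ G` carries a
function with `V̄₁F ≠ 0`. -/
theorem exists_V1bar_ne_zero {k : Fin 4} {T : ℝ} (hT : 0 < T)
    (hΓ : ∀ γ ∈ S.Γ, ∀ a, ∃ n : ℤ, S.leftMul γ a k = a k + n * T)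
    (h0 : ∀ a, S.E 0 a k = 1) (h1 : ∀ a, S.E 1 a k = 0) :
    ∃ F : S.Quot → ℝ, ContMDiff 𝓘(ℝ, R4) 𝓘(ℝ, ℝ) ∞ F ∧ ∃ a : R4, S.V1bar F a ≠ 0 := by
  -- A sine of period `T` in coordinate `k` descends to the quotient. Since `E₀` and `E₁` have
  -- `k`-components 1 and 0, its derivative `V̄₁F` at the origin is `π/T`.
  let F : S.Quot → ℝ := fun p => Real.sin (2 * Real.pi / T * S.rep p k)
  have hF : (fun a => F (S.proj a)) = fun a : R4 => Real.sin (2 * Real.pi / T * a k) := by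
    funext a
    obtain ⟨γ, hγ, h⟩ := S.exists_leftMul_eq_rep a
    obtain ⟨n, hn⟩ := hΓ γ hγ a
    simp only [F]
    rw [← h, hn, show 2 * Real.pi / T * (a k + n * T) =
      2 * Real.pi / T * a k + n * (2 * Real.pi) by field_simp]
    exact Real.sin_add_int_mul_two_pi _ n
  refine ⟨F, contMDiff_of_comp_proj ?_, 0, ?_⟩
  · rw [hF]
    fun_prop
  · have h2 : HasFDerivAt (fun a : R4 => Real.sin (2 * Real.pi / T * a k))
        (Real.cos (2 * Real.pi / T * (0 : R4) k) •
          ((2 * Real.pi / T) • (EuclideanSpace.proj (𝕜 := ℝ) k : R4 →L[ℝ] ℝ))) 0 :=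
      (((EuclideanSpace.proj (𝕜 := ℝ) k : R4 →L[ℝ] ℝ).hasFDerivAt (x := (0 : R4))).const_mul
        (2 * Real.pi / T)).sin
    rw [V1bar, hF, h2.fderiv]
    simp [h0, h1, hT.ne', Real.pi_ne_zero]

theorem det_frameMap (a : R4) :
    (S.frameMap a).det = Matrix.det (Matrix.of fun i j => S.E j a i) := by
  rw [ContinuousLinearMap.det,
    ← LinearMap.det_toMatrix (EuclideanSpace.basisFun (Fin 4) ℝ).toBasis]
  congr 1
  ext i j
  rw [LinearMap.toMatrix_apply]
  change ((EuclideanSpace.basisFun (Fin 4) ℝ).toBasis.repr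
    (S.frameMap a ((EuclideanSpace.basisFun (Fin 4) ℝ).toBasis j))) i = _
  rw [frameMap_apply]
  simp

/-- The brackets of a frame whose vector fields are functions of a single coordinate. -/
theorem lieBracket_of_coordinate {k : Fin 4 → Fin 4} {V V' : Fin 4 → ℝ → R4}
    (hV : ∀ j s, HasDerivAt (V j) (V' j s) s) (hE : ∀ j a, S.E j a = V j (a (k j)))
    (i j : Fin 4) (a : R4) : VectorField.lieBracket ℝ (S.E i) (S.E j) a =
      S.E i a (k j) • V' j (a (k j)) - S.E j a (k i) • V' i (a (k i)) := by
  have h : ∀ j v, fderiv ℝ (S.E j) a v = v (k j) • V' j (a (k j)) := by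
    intro j v
    have h1 := (hV j (a (k j))).hasFDerivAt.comp a
      ((EuclideanSpace.proj (𝕜 := ℝ) (k j) : R4 →L[ℝ] ℝ).hasFDerivAt (x := a))
    rw [show S.E j = V j ∘ (EuclideanSpace.proj (𝕜 := ℝ) (k j) : R4 →L[ℝ] ℝ) from
      funext (hE j), h1.fderiv]
    simp
  rw [VectorField.lieBracket, h, h]

theorem hasDerivAt_euclidean {V : ℝ → R4} {v : R4} {s : ℝ}
    (h : ∀ i, HasDerivAt (fun s => V s i) (v i) s) : HasDerivAt V v s := by
  have h1 : HasFDerivAt V (ContinuousLinearMap.toSpanSingleton ℝ v) s := by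
    rw [← hasFDerivWithinAt_univ, hasFDerivWithinAt_euclidean]
    intro i
    rw [hasFDerivWithinAt_univ]
    refine (h i).hasFDerivAt.congr_fderiv ?_
    ext
    simp
  simpa using h1.hasDerivAt

theorem isBounded_of_coord {D : Set R4} {C : ℝ} (h : ∀ a ∈ D, ∀ i, |a i| ≤ C) :
    Bornology.IsBounded D := by
  rcases D.eq_empty_or_nonempty with rfl | ⟨a₀, ha₀⟩
  · exact Bornology.isBounded_empty
  have hC : 0 ≤ C := (abs_nonneg _).trans (h a₀ ha₀ 0)
  refine (Metric.isBounded_closedBall (x := (0 : R4)) (r := 2 * C)).subset fun a ha => ?_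
  rw [mem_closedBall_zero_iff, EuclideanSpace.norm_eq]
  apply Real.sqrt_le_iff.mpr ⟨by positivity, ?_⟩
  have h1 : ∀ i, ‖a i‖ ^ 2 ≤ C ^ 2 := fun i => by
    rw [Real.norm_eq_abs]
    exact pow_le_pow_left₀ (abs_nonneg _) (h a ha i) 2
  rw [Fin.sum_univ_four]
  nlinarith [h1 0, h1 1, h1 2, h1 3]

/-- The functions of one coordinate which give the frame of `ℝ × H₃(ℝ)`. -/
noncomputable def kodairaField : Fin 4 → ℝ → R4 :=
  ![fun _ => !₂[0, 1, 0, 0], fun s => !₂[0, 0, 1, s], fun _ => !₂[0, 0, 0, 1],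
    fun _ => !₂[1, 0, 0, 0]]

theorem hasDerivAt_kodairaField (j : Fin 4) (s : ℝ) : HasDerivAt (kodairaField j)
    ((![0, !₂[0, 0, 0, 1], 0, 0] : Fin 4 → R4) j) s := by
  refine hasDerivAt_euclidean fun i => ?_
  fin_cases j <;> fin_cases i <;>
    first | exact hasDerivAt_const s _ | exact hasDerivAt_id s

/-- The selected coordinate is one that the field itself does not move, as straight integral curves
require; for a constant field any coordinate with zero component serves. -/
theorem kodaira_E (j : Fin 4) (a : R4) : kodaira.E j a = kodairaField j (a (![0, 1, 0, 1] j)) := by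
  fin_cases j <;> rfl

theorem hasStructureConstants_kodaira : kodaira.HasStructureConstants kodairaBracket := by
  intro i j a
  rw [lieBracket_of_coordinate hasDerivAt_kodairaField kodaira_E]
  simp only [kodaira_E]
  fin_cases i <;> fin_cases j <;> ext m <;> fin_cases m <;>
    simp [kodairaField, kodairaBracket, singleBracket]

theorem int_add_mem_Ico {n : ℤ} {x : ℝ} : (n : ℝ) + x ∈ Set.Ico (0 : ℝ) 1 ↔ n = -⌊x⌋ := by
  rw [Set.mem_Ico, eq_neg_iff_add_eq_zero, ← Int.floor_intCast_add, Int.floor_eq_iff]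
  simp

theorem measurableSet_coord {f : Fin 4 → R4 → ℝ} (hf : ∀ i, Continuous (f i)) :
    MeasurableSet {a : R4 | ∀ i, f i a ∈ Set.Ico (0 : ℝ) 1} := by
  rw [Set.ofPred_forall]
  exact MeasurableSet.iInter fun i => (hf i).measurable measurableSet_Ico

/-- The group law is triangular: `γ₀, γ₁, γ₂` are fixed by integer parts of the coordinates of `a`,
and `γ₃` then by that of `a₃ + γ₁a₂`. -/
theorem hasBoundedDomain_kodaira :
    kodaira.HasBoundedDomain {a | ∀ i, a i ∈ Set.Ico (0 : ℝ) 1} where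
  det_frame := by
    -- The sign is that of a 4-cycle: `t` is the first coordinate but `∂_t` is the last field.
    refine ⟨-1, fun a => ?_⟩
    rw [det_frameMap]
    simp only [kodaira_E]
    simp [kodairaField, Matrix.det_succ_row_zero, Fin.sum_univ_succ, Fin.succAbove]
    norm_num
  shear j := by
    refine ⟨![0, 1, 0, 1] j, kodairaField j,
      fun s => (hasDerivAt_kodairaField j s).differentiableAt, fun s => ?_, kodaira_E j⟩
    fin_cases j <;> simp [kodairaField]
  equivariant b a j t := by
    change kodairaMul b (a + t • kodairaFrame j a) =
      kodairaMul b a + t • kodairaFrame j (kodairaMul b a)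
    fin_cases j <;> ext i <;> fin_cases i <;> simp [kodairaFrame, kodairaMul] <;> ring
  measurable := measurableSet_coord fun i => by fun_prop
  bounded := isBounded_of_coord (C := 1) fun a ha i => by
    rw [abs_of_nonneg (ha i).1]
    exact (ha i).2.le
  exists_unique a := by
    refine ⟨!₂[(-⌊a 0⌋ : ℤ), (-⌊a 1⌋ : ℤ), (-⌊a 2⌋ : ℤ),
      (-⌊a 3 + (-⌊a 1⌋ : ℤ) * a 2⌋ : ℤ)], ⟨?_, ?_⟩, ?_⟩
    · intro i
      fin_cases i <;> exact ⟨_, rfl⟩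
    · change ∀ i, kodairaMul _ a i ∈ Set.Ico (0 : ℝ) 1
      intro i
      fin_cases i
      · exact int_add_mem_Ico.mpr rfl
      · exact int_add_mem_Ico.mpr rfl
      · exact int_add_mem_Ico.mpr rfl
      · have := int_add_mem_Ico.mpr (Eq.refl (-⌊a 3 + (-⌊a 1⌋ : ℤ) * a 2⌋))
        rw [← add_assoc] at this
        exact this
    · rintro γ ⟨hγ, hD⟩
      change ∀ i, ∃ n : ℤ, γ i = n at hγ
      choose n hn using hγ
      change ∀ i, kodairaMul γ a i ∈ Set.Ico (0 : ℝ) 1 at hD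
      have h0 : γ 0 + a 0 ∈ Set.Ico (0 : ℝ) 1 := hD 0
      have h1 : γ 1 + a 1 ∈ Set.Ico (0 : ℝ) 1 := hD 1
      have h2 : γ 2 + a 2 ∈ Set.Ico (0 : ℝ) 1 := hD 2
      have h3 : γ 3 + a 3 + γ 1 * a 2 ∈ Set.Ico (0 : ℝ) 1 := hD 3
      rw [hn, int_add_mem_Ico] at h0 h1 h2
      rw [hn, hn, add_assoc, int_add_mem_Ico, h1] at h3
      ext i
      rw [hn]
      fin_cases i
      · exact congrArg _ h0
      · exact congrArg _ h1
      · exact congrArg _ h2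
      · exact congrArg _ h3

theorem exists_V1bar_ne_zero_kodaira :
    ∃ F : kodaira.Quot → ℝ, ContMDiff 𝓘(ℝ, R4) 𝓘(ℝ, ℝ) ∞ F ∧ ∃ a : R4, kodaira.V1bar F a ≠ 0 := by
  refine exists_V1bar_ne_zero (k := 1) one_pos (fun γ hγ a => ?_) (fun a => ?_) fun a => ?_
  · obtain ⟨n, hn⟩ := hγ 1
    refine ⟨n, ?_⟩
    change γ 1 + a 1 = _
    rw [hn]
    ring
  · simp [kodaira_E, kodairaField]
  · simp [kodaira_E, kodairaField]

end FramedQuotient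

/-! ### `Nil⁴`, and the frame of `ℝ × Sol³` -/

namespace FramedQuotient

/-- The functions of one coordinate which give the frame of `Nil⁴`. -/
noncomputable def nil4Field : Fin 4 → ℝ → R4 :=
  ![fun _ => !₂[1, 0, 0, 0], fun s => !₂[0, 1, s, 1 / 2 * s ^ 2], fun s => !₂[0, 0, 1, s],
    fun _ => !₂[0, 0, 0, 1]]

theorem hasDerivAt_nil4Field (j : Fin 4) (s : ℝ) : HasDerivAt (nil4Field j)
    ((![0, !₂[0, 0, 1, s], !₂[0, 0, 0, 1], 0] : Fin 4 → R4) j) s := by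
  have hsq : HasDerivAt (fun s : ℝ => 1 / 2 * s ^ 2) s s := by
    refine ((hasDerivAt_pow 2 s).const_mul (1 / 2)).congr_deriv ?_
    norm_num
    ring
  refine hasDerivAt_euclidean fun i => ?_
  fin_cases j <;> fin_cases i <;>
    first | exact hasDerivAt_const s _ | exact hasDerivAt_id s | exact hsq

theorem nil4_E (j : Fin 4) (a : R4) : nil4.E j a = nil4Field j (a (![1, 0, 0, 0] j)) := by
  fin_cases j <;> rfl

theorem hasStructureConstants_nil4 : nil4.HasStructureConstants nil4Bracket := by
  intro i j a
  rw [lieBracket_of_coordinate hasDerivAt_nil4Field nil4_E]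
  simp only [nil4_E]
  fin_cases i <;> fin_cases j <;> ext m <;> fin_cases m <;>
    simp [nil4Field, nil4Bracket, singleBracket]

theorem two_mul_int_add_mem_Ico {n : ℤ} {x : ℝ} :
    (2 * (n : ℝ) + x) / 2 ∈ Set.Ico (0 : ℝ) 1 ↔ n = -⌊x / 2⌋ := by
  rw [← int_add_mem_Ico, add_div, mul_div_cancel_left₀ _ two_ne_zero]

/-- Again triangular: once `γ₀` is known, the remaining coordinates of `γa` are those of `γ` plus
shifts depending on `a` and `γ₀` only. Halving adapts the unit cube to `2ℤ⁴`. -/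
theorem hasBoundedDomain_nil4 :
    nil4.HasBoundedDomain {a | ∀ i, a i / 2 ∈ Set.Ico (0 : ℝ) 1} where
  det_frame := by
    refine ⟨1, fun a => ?_⟩
    rw [det_frameMap]
    simp only [nil4_E]
    simp [nil4Field, Matrix.det_succ_row_zero, Fin.sum_univ_succ, Fin.succAbove]
  shear j := by
    refine ⟨![1, 0, 0, 0] j, nil4Field j,
      fun s => (hasDerivAt_nil4Field j s).differentiableAt, fun s => ?_, nil4_E j⟩
    fin_cases j <;> simp [nil4Field]
  equivariant b a j t := by
    change nil4Mul b (a + t • nil4Frame j a) = nil4Mul b a + t • nil4Frame j (nil4Mul b a)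
    fin_cases j <;> ext i <;> fin_cases i <;> simp [nil4Frame, nil4Mul] <;> ring
  measurable := measurableSet_coord fun i => by fun_prop
  bounded := isBounded_of_coord (C := 2) fun a ha i => by
    obtain ⟨h1, h2⟩ := ha i
    rw [abs_of_nonneg (by linarith)]
    linarith
  exists_unique a := by
    obtain ⟨n0, hn0⟩ : ∃ n0 : ℤ, n0 = -⌊a 0 / 2⌋ := ⟨_, rfl⟩
    obtain ⟨n1, hn1⟩ : ∃ n1 : ℤ, n1 = -⌊a 1 / 2⌋ := ⟨_, rfl⟩
    obtain ⟨n2, hn2⟩ : ∃ n2 : ℤ, n2 = -⌊(a 2 + 2 * (n0 : ℝ) * a 1) / 2⌋ := ⟨_, rfl⟩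
    obtain ⟨n3, hn3⟩ : ∃ n3 : ℤ, n3 = -⌊(a 3 + 1 / 2 * (2 * (n0 : ℝ)) ^ 2 * a 1
      + 2 * (n0 : ℝ) * a 2) / 2⌋ := ⟨_, rfl⟩
    refine ⟨!₂[2 * (n0 : ℝ), 2 * (n1 : ℝ), 2 * (n2 : ℝ), 2 * (n3 : ℝ)], ⟨?_, ?_⟩, ?_⟩
    · intro i
      fin_cases i <;> exact ⟨_, rfl⟩
    · change ∀ i, nil4Mul _ a i / 2 ∈ Set.Ico (0 : ℝ) 1
      have e0 := two_mul_int_add_mem_Ico.mpr hn0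
      have e1 := two_mul_int_add_mem_Ico.mpr hn1
      have e2 := two_mul_int_add_mem_Ico.mpr hn2
      have e3 := two_mul_int_add_mem_Ico.mpr hn3
      intro i
      fin_cases i
      · convert e0 using 1
        simp [nil4Mul]
        ring
      · convert e1 using 1
        simp [nil4Mul]
        ring
      · convert e2 using 1
        simp [nil4Mul]
        ring
      · convert e3 using 1
        simp [nil4Mul]
        ring
    · rintro γ ⟨hγ, hD⟩
      change ∀ i, ∃ n : ℤ, γ i = 2 * n at hγ
      choose n hn using hγ
      change ∀ i, nil4Mul γ a i / 2 ∈ Set.Ico (0 : ℝ) 1 at hD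
      have e0 : (2 * (n 0 : ℝ) + a 0) / 2 ∈ Set.Ico (0 : ℝ) 1 := by
        have := hD 0
        simp only [nil4Mul, hn] at this
        convert this using 1
        simp
        ring
      rw [two_mul_int_add_mem_Ico, ← hn0] at e0
      have e1 : (2 * (n 1 : ℝ) + a 1) / 2 ∈ Set.Ico (0 : ℝ) 1 := by
        have := hD 1
        simp only [nil4Mul, hn] at this
        convert this using 1
        simp
        ring
      rw [two_mul_int_add_mem_Ico, ← hn1] at e1
      have e2 : (2 * (n 2 : ℝ) + (a 2 + 2 * (n0 : ℝ) * a 1)) / 2 ∈ Set.Ico (0 : ℝ) 1 := by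
        have := hD 2
        simp only [nil4Mul, hn, e0] at this
        convert this using 1
        simp
        ring
      rw [two_mul_int_add_mem_Ico, ← hn2] at e2
      have e3 : (2 * (n 3 : ℝ) + (a 3 + 1 / 2 * (2 * (n0 : ℝ)) ^ 2 * a 1 + 2 * (n0 : ℝ) * a 2)) / 2
          ∈ Set.Ico (0 : ℝ) 1 := by
        have := hD 3
        simp only [nil4Mul, hn, e0] at this
        convert this using 1
        simp
        ring
      rw [two_mul_int_add_mem_Ico, ← hn3] at e3
      ext i
      rw [hn]
      fin_cases i <;> simp [e0, e1, e2, e3]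

theorem exists_V1bar_ne_zero_nil4 :
    ∃ F : nil4.Quot → ℝ, ContMDiff 𝓘(ℝ, R4) 𝓘(ℝ, ℝ) ∞ F ∧ ∃ a : R4, nil4.V1bar F a ≠ 0 := by
  refine exists_V1bar_ne_zero (k := 0) two_pos (fun γ hγ a => ?_) (fun a => ?_) fun a => ?_
  · obtain ⟨n, hn⟩ := hγ 0
    refine ⟨n, ?_⟩
    change a 0 + γ 0 = _
    rw [hn]
    ring
  · simp [nil4_E, nil4Field]
  · simp [nil4_E, nil4Field]

/-- The functions of one coordinate which give the frame of `ℝ × Sol³`. -/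
noncomputable def solField : Fin 4 → ℝ → R4 :=
  ![fun _ => !₂[1, 0, 0, 0], fun _ => !₂[0, 1, 0, 0], fun s => !₂[0, 0, Real.exp s, 0],
    fun s => !₂[0, 0, 0, Real.exp (-s)]]

theorem hasDerivAt_solField (j : Fin 4) (s : ℝ) : HasDerivAt (solField j)
    ((![0, 0, !₂[0, 0, Real.exp s, 0], !₂[0, 0, 0, -Real.exp (-s)]] : Fin 4 → R4) j) s := by
  have hneg : HasDerivAt (fun s : ℝ => Real.exp (-s)) (-Real.exp (-s)) s := by
    simpa using (hasDerivAt_neg s).exp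
  refine hasDerivAt_euclidean fun i => ?_
  fin_cases j <;> fin_cases i <;>
    first | exact hasDerivAt_const s _ | exact Real.hasDerivAt_exp s | exact hneg

variable {P : SolParameters}

theorem sol_E (j : Fin 4) (a : R4) : (solR P).E j a = solField j (a (![1, 0, 0, 0] j)) := by
  fin_cases j <;> rfl

theorem hasStructureConstants_sol : (solR P).HasStructureConstants solBracket := by
  intro i j a
  rw [lieBracket_of_coordinate hasDerivAt_solField sol_E]
  simp only [sol_E]
  fin_cases i <;> fin_cases j <;> ext m <;> fin_cases m <;>
    simp [solField, solBracket, singleBracket]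

theorem exists_V1bar_ne_zero_sol :
    ∃ F : (solR P).Quot → ℝ, ContMDiff 𝓘(ℝ, R4) 𝓘(ℝ, ℝ) ∞ F ∧
      ∃ a : R4, (solR P).V1bar F a ≠ 0 := by
  refine exists_V1bar_ne_zero (k := 0) P.κ_pos (fun γ hγ a => ?_) (fun a => ?_) fun a => ?_
  · obtain ⟨m, n, v, rfl⟩ := P.mem_lattice hγ
    refine ⟨m, ?_⟩
    change m * P.κ + a 0 = _
    ring
  · simp [sol_E, solField]
  · simp [sol_E, solField]

end FramedQuotient

/-! ### Hyperbolic matrices and the lattices in `ℝ × Sol³` -/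

/-- An element of `SL₂(ℤ)` of trace at least `3` is hyperbolic. -/
theorem exists_solParameters (A : Matrix.SpecialLinearGroup (Fin 2) ℤ) (hA : 3 ≤ A.1.trace) :
    ∃ D : SolParameters, D.A = A := by
  obtain ⟨a, ha⟩ : ∃ a, a = A.1 0 0 := ⟨_, rfl⟩
  obtain ⟨b, hb⟩ : ∃ b, b = A.1 0 1 := ⟨_, rfl⟩
  obtain ⟨c, hc⟩ : ∃ c, c = A.1 1 0 := ⟨_, rfl⟩
  obtain ⟨d, hd⟩ : ∃ d, d = A.1 1 1 := ⟨_, rfl⟩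
  have hdet : a * d - b * c = 1 := by
    rw [ha, hb, hc, hd, ← Matrix.det_fin_two]
    exact A.2
  have htr : 3 ≤ a + d := by
    rwa [Matrix.trace_fin_two, ← ha, ← hd] at hA
  -- If `c = 0`, then `ad = 1`, so the trace would be `±2`.
  have hc0 : c ≠ 0 := by
    rintro rfl
    rw [mul_zero, sub_zero] at hdet
    rcases Int.eq_one_or_neg_one_of_mul_eq_one hdet with h | h
    · rw [h, one_mul] at hdet
      omega
    · rw [h] at hdet
      omega
  have hdet' : (a : ℝ) * d - b * c = 1 := by exact_mod_cast hdet
  have htr' : (3 : ℝ) ≤ a + d := by exact_mod_cast htr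
  obtain ⟨w, hw⟩ : ∃ w, w = Real.sqrt (((a : ℝ) + d) ^ 2 - 4) := ⟨_, rfl⟩
  have hw2 : w * w = ((a : ℝ) + d) ^ 2 - 4 := by
    rw [hw]
    exact Real.mul_self_sqrt (by nlinarith)
  have hw0 : 0 ≤ w := hw ▸ Real.sqrt_nonneg _
  -- The larger root of `λ² - (tr A)λ + 1`; the other root is `x⁻¹`, and `κ` will be `log x`.
  obtain ⟨x, hx⟩ : ∃ x : ℝ, x = (a + d + w) / 2 := ⟨_, rfl⟩
  have hx1 : 1 < x := by linarith
  have hx0 : x ≠ 0 := by linarith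
  have hxT : x * x = (a + d) * x - 1 := by
    rw [hx]
    linear_combination hw2 / 4
  have hinv : x⁻¹ = a + d - x :=
    inv_eq_of_mul_eq_one_right (by linear_combination -hxT)
  have hx2 : x⁻¹ < x := (inv_lt_one_of_one_lt₀ hx1).trans hx1
  have hexp : Real.exp (Real.log x) = x := Real.exp_log (by linarith)
  have hexp' : Real.exp (-Real.log x) = x⁻¹ := by rw [Real.exp_neg, hexp]
  -- The rows are left eigenvectors of `A` for `x` and `x⁻¹`; they are independent because `c ≠ 0`
  -- and `x ≠ x⁻¹`.
  let P : Matrix (Fin 2) (Fin 2) ℝ := !![(c : ℝ), x - a; (c : ℝ), x⁻¹ - a]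
  have hP : P.det ≠ 0 := by
    rw [Matrix.det_fin_two_of, show (c : ℝ) * (x⁻¹ - a) - (x - a) * c = c * (x⁻¹ - x) by ring]
    exact mul_ne_zero (Int.cast_ne_zero.mpr hc0) (sub_ne_zero.mpr hx2.ne)
  have hPA : P * A.1.map (Int.cast : ℤ → ℝ) =
      !![Real.exp (Real.log x), 0; 0, Real.exp (-Real.log x)] * P := by
    rw [hexp, hexp']
    have hA' : A.1.map (Int.cast : ℤ → ℝ) = !![(a : ℝ), b; (c : ℝ), d] := by
      ext i j
      fin_cases i <;> fin_cases j <;> simp [ha, hb, hc, hd]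
    rw [hA', Matrix.mul_fin_two, Matrix.mul_fin_two, hinv]
    ext i j
    fin_cases i <;> fin_cases j <;> simp
    · ring
    · linear_combination -hxT - hdet'
    · ring
    · linear_combination -hxT - hdet'
  refine ⟨⟨A, hA, Real.log x, Real.log_pos hx1, P, hP, ?_⟩, rfl⟩
  rw [Matrix.mul_assoc, ← hPA, ← Matrix.mul_assoc,
    Matrix.nonsing_inv_mul _ (isUnit_iff_ne_zero.mpr hP), Matrix.one_mul]

/-- Applied to the one-parameter families through the generators of `Γ_A`, whose integral points are
then powers of a generator. -/
theorem mem_subgroup_of_add {G : Type*} [Group G] {H : Subgroup G} {f : ℤ → G}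
    (hf : ∀ m n, f (m + n) = f m * f n) (h1 : f 1 ∈ H) (n : ℤ) : f n ∈ H := by
  let φ : Multiplicative ℤ →* G := MonoidHom.mk' (fun n => f n.toAdd) fun m n => hf _ _
  have h2 : f n = f 1 ^ n := MonoidHom.apply_mint G φ (Multiplicative.ofAdd n)
  rw [h2]
  exact H.zpow_mem h1 n

theorem SolParameters.mem_lattice_of (D : SolParameters) (m n : ℤ) (v : Fin 2 → ℤ) :
    !₂[m * D.κ, (n : ℝ), D.P 0 0 * v 0 + D.P 0 1 * v 1, D.P 1 0 * v 0 + D.P 1 1 * v 1] ∈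
      D.lattice := by
  let := solGroup
  have hgen : ∀ x ∈ ({!₂[D.κ, 0, 0, 0], !₂[0, 1, 0, 0], !₂[0, 0, D.P 0 0, D.P 1 0],
      !₂[0, 0, D.P 0 1, D.P 1 1]} : Set R4), x ∈ D.lattice := fun x hx =>
    Subgroup.subset_closure hx
  have h1 : (!₂[m * D.κ, 0, 0, 0] : R4) ∈ D.lattice := by
    refine mem_subgroup_of_add (f := fun m : ℤ => (!₂[m * D.κ, 0, 0, 0] : R4)) (fun m n => ?_)
      (by simpa using hgen _ (by simp)) m
    change _ = solMul _ _
    ext i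
    fin_cases i <;> simp [solMul]
    ring
  have h2 : (!₂[0, (n : ℝ), 0, 0] : R4) ∈ D.lattice := by
    refine mem_subgroup_of_add (f := fun n : ℤ => (!₂[0, (n : ℝ), 0, 0] : R4)) (fun m n => ?_)
      (by simpa using hgen _ (by simp)) n
    change _ = solMul _ _
    ext i
    fin_cases i <;> simp [solMul]
  have h3 : ∀ j (k : ℤ), (!₂[0, 0, D.P 0 j * k, D.P 1 j * k] : R4) ∈ D.lattice := by
    intro j k
    refine mem_subgroup_of_add (f := fun k : ℤ => (!₂[0, 0, D.P 0 j * k, D.P 1 j * k] : R4))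
      (fun m n => ?_) (by fin_cases j <;> simpa using hgen _ (by simp)) k
    change _ = solMul _ _
    ext i
    fin_cases i <;> simp [solMul] <;> ring
  -- The translation in `t` stands last: all factors to its left have `t = 0`, so no exponential
  -- appears in the product.
  have h4 := mul_mem (mul_mem (h3 0 (v 0)) (h3 1 (v 1))) (mul_mem h2 h1)
  convert h4 using 1
  change _ = solMul (solMul _ _) (solMul _ _)
  ext i
  fin_cases i <;> simp [solMul]

namespace FramedQuotient

variable {P : SolParameters}

/-- Coordinates on `ℝ × Sol³` in which the lattice acts by integral translations on the fibres. -/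
noncomputable def solCoord (P : SolParameters) : Fin 4 → R4 → ℝ :=
  ![fun a => a 0 / P.κ, fun a => a 1, fun a => (P.P 1 1 * a 2 - P.P 0 1 * a 3) / P.P.det,
    fun a => (P.P 0 0 * a 3 - P.P 1 0 * a 2) / P.P.det]

/-- In the coordinates `P⁻¹(a₂, a₃)` the fibre part of a lattice element is an integral translation,
applied after the rescaling by `e^{±mκ}` which depends on `m` alone. -/
theorem solCoord_mul (m n : ℤ) (v : Fin 2 → ℤ) (a : R4) (i : Fin 4) :
    solCoord P i (solMul !₂[m * P.κ, (n : ℝ), P.P 0 0 * v 0 + P.P 0 1 * v 1,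
      P.P 1 0 * v 0 + P.P 1 1 * v 1] a) = (![m, n, v 0, v 1] i : ℤ) +
      solCoord P i !₂[a 0, a 1, Real.exp (m * P.κ) * a 2, Real.exp (-(m * P.κ)) * a 3] := by
  have hκ := P.κ_pos.ne'
  have hδ := P.det_ne_zero
  have hdet := Matrix.det_fin_two P.P
  fin_cases i <;> simp [solCoord, solMul]
  · field_simp
  · field_simp
    linear_combination -(v 0 : ℝ) * hdet
  · field_simp
    linear_combination -(v 1 : ℝ) * hdet

theorem hasBoundedDomain_sol :
    (solR P).HasBoundedDomain {a | ∀ i, solCoord P i a ∈ Set.Ico (0 : ℝ) 1} where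
  det_frame := by
    refine ⟨1, fun a => ?_⟩
    rw [det_frameMap]
    simp only [sol_E]
    simp [solField, Matrix.det_succ_row_zero, Fin.sum_univ_succ, Fin.succAbove, ← Real.exp_add]
  shear j := by
    refine ⟨![1, 0, 0, 0] j, solField j,
      fun s => (hasDerivAt_solField j s).differentiableAt, fun s => ?_, sol_E j⟩
    fin_cases j <;> simp [solField]
  equivariant b a j t := by
    change solMul b (a + t • solFrame j a) = solMul b a + t • solFrame j (solMul b a)
    fin_cases j <;> ext i <;> fin_cases i <;> simp [solFrame, solMul, Real.exp_add] <;> ring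
  measurable := measurableSet_coord fun i => by
    fin_cases i
    · exact (by fun_prop : Continuous fun a : R4 => a 0 / P.κ)
    · exact (by fun_prop : Continuous fun a : R4 => a 1)
    · exact (by fun_prop :
        Continuous fun a : R4 => (P.P 1 1 * a 2 - P.P 0 1 * a 3) / P.P.det)
    · exact (by fun_prop :
        Continuous fun a : R4 => (P.P 0 0 * a 3 - P.P 1 0 * a 2) / P.P.det)
  bounded := by
    refine isBounded_of_coord
      (C := P.κ + 1 + (|P.P 0 0| + |P.P 0 1|) + (|P.P 1 0| + |P.P 1 1|)) fun a ha i => ?_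
    have hκ := P.κ_pos
    have hδ := P.det_ne_zero
    have hdet := Matrix.det_fin_two P.P
    have hq : ∀ j, |solCoord P j a| ≤ 1 := fun j => by
      rw [abs_of_nonneg (ha j).1]
      exact (ha j).2.le
    have e0 : a 0 = P.κ * solCoord P 0 a := by
      simp [solCoord]
      field_simp
    have e1 : a 1 = solCoord P 1 a := rfl
    have e2 : a 2 = P.P 0 0 * solCoord P 2 a + P.P 0 1 * solCoord P 3 a := by
      simp [solCoord]
      field_simp
      linear_combination a 2 * hdet
    have e3 : a 3 = P.P 1 0 * solCoord P 2 a + P.P 1 1 * solCoord P 3 a := by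
      simp [solCoord]
      field_simp
      linear_combination a 3 * hdet
    have bound : ∀ x y s t : ℝ, |s| ≤ 1 → |t| ≤ 1 → |x * s + y * t| ≤ |x| + |y| := by
      intro x y s t hs ht
      refine (abs_add_le _ _).trans (add_le_add ?_ ?_)
      · rw [abs_mul]
        exact mul_le_of_le_one_right (abs_nonneg _) hs
      · rw [abs_mul]
        exact mul_le_of_le_one_right (abs_nonneg _) ht
    have b0 : |a 0| ≤ P.κ := by
      rw [e0, abs_mul, abs_of_pos hκ]
      exact mul_le_of_le_one_right hκ.le (hq 0)
    have b1 : |a 1| ≤ 1 := e1 ▸ hq 1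
    have b2 : |a 2| ≤ |P.P 0 0| + |P.P 0 1| := e2 ▸ bound _ _ _ _ (hq 2) (hq 3)
    have b3 : |a 3| ≤ |P.P 1 0| + |P.P 1 1| := e3 ▸ bound _ _ _ _ (hq 2) (hq 3)
    have p2 : 0 ≤ |P.P 0 0| + |P.P 0 1| := by positivity
    have p3 : 0 ≤ |P.P 1 0| + |P.P 1 1| := by positivity
    fin_cases i
    · exact b0.trans (by linarith)
    · exact b1.trans (by linarith)
    · exact b2.trans (by linarith)
    · exact b3.trans (by linarith)
  exists_unique a := by
    -- `m` is read off the first coordinate, which the rescaling leaves unchanged. Once `m` is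
    -- known, the other integers are minus the floors of the coordinates of the rescaled point `a'`.
    obtain ⟨m, hm⟩ : ∃ m : ℤ, m = -⌊solCoord P 0 a⌋ := ⟨_, rfl⟩
    obtain ⟨a', ha'⟩ : ∃ a' : R4, a' =
      !₂[a 0, a 1, Real.exp (m * P.κ) * a 2, Real.exp (-(m * P.κ)) * a 3] := ⟨_, rfl⟩
    have hm' : m = -⌊solCoord P 0 a'⌋ := by rw [hm, ha']; rfl
    refine ⟨!₂[m * P.κ, ((-⌊solCoord P 1 a'⌋ : ℤ) : ℝ),
      P.P 0 0 * (![-⌊solCoord P 2 a'⌋, -⌊solCoord P 3 a'⌋] 0 : ℤ) +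
        P.P 0 1 * (![-⌊solCoord P 2 a'⌋, -⌊solCoord P 3 a'⌋] 1 : ℤ),
      P.P 1 0 * (![-⌊solCoord P 2 a'⌋, -⌊solCoord P 3 a'⌋] 0 : ℤ) +
        P.P 1 1 * (![-⌊solCoord P 2 a'⌋, -⌊solCoord P 3 a'⌋] 1 : ℤ)],
      ⟨P.mem_lattice_of _ _ _, ?_⟩, ?_⟩
    · intro i
      change solCoord P i (solMul _ a) ∈ _
      rw [solCoord_mul, ← ha', int_add_mem_Ico]
      fin_cases i
      · exact hm'
      · rfl
      · rfl
      · rfl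
    · rintro γ ⟨hγ, hD⟩
      obtain ⟨m₁, n₁, v₁, rfl⟩ := P.mem_lattice hγ
      have hq : ∀ i, solCoord P i (solMul !₂[m₁ * P.κ, (n₁ : ℝ),
        P.P 0 0 * v₁ 0 + P.P 0 1 * v₁ 1, P.P 1 0 * v₁ 0 + P.P 1 1 * v₁ 1] a) ∈
          Set.Ico (0 : ℝ) 1 := hD
      simp only [solCoord_mul, int_add_mem_Ico] at hq
      obtain rfl : m₁ = m := (hq 0).trans hm.symm
      rw [← ha'] at hq
      have q1 : n₁ = _ := hq 1
      have q2 : v₁ 0 = _ := hq 2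
      have q3 : v₁ 1 = _ := hq 3
      rw [q1, q2, q3]
      rfl

/-! ### The three examples and the theorem -/

theorem examples (S : FramedQuotient) (hS : S = kodaira ∨ S = nil4 ∨ ∃ D : SolParameters, S = solR D) :
    ∃ (c : Fin 4 → Fin 4 → Fin 4 → ℝ) (D : Set R4), S.HasStructureConstants c ∧ IsUnimodular c ∧
      S.HasBoundedDomain D ∧ S.ClosedFormsConstant ∧
      ∃ F : S.Quot → ℝ, ContMDiff 𝓘(ℝ, R4) 𝓘(ℝ, ℝ) ∞ F ∧ ∃ a : R4, S.V1bar F a ≠ 0 := by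
  obtain rfl | rfl | ⟨P, rfl⟩ := hS
  · exact ⟨_, _, hasStructureConstants_kodaira, isUnimodular_kodairaBracket,
      hasBoundedDomain_kodaira, closedFormsConstant_nilpotent hasStructureConstants_kodaira
        hasBoundedDomain_kodaira.isInvariantIntegral (ε := 0) (by simp [kodairaBracket]),
      exists_V1bar_ne_zero_kodaira⟩
  · exact ⟨_, _, hasStructureConstants_nil4, isUnimodular_nil4Bracket,
      hasBoundedDomain_nil4, closedFormsConstant_nilpotent hasStructureConstants_nil4
        hasBoundedDomain_nil4.isInvariantIntegral (ε := 1) (by simp [nil4Bracket]),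
      exists_V1bar_ne_zero_nil4⟩
  · exact ⟨_, _, hasStructureConstants_sol, isUnimodular_solBracket,
      hasBoundedDomain_sol, closedFormsConstant_sol hasStructureConstants_sol
        hasBoundedDomain_sol.isInvariantIntegral, exists_V1bar_ne_zero_sol⟩

end FramedQuotient

theorem mainTheorem4 :
    -- the number is not an almost complex invariant in dimension 4
    ¬ H10dIsAlmostComplexInvariant ∧
    -- a lattice `Γ_A` exists for every integral `A` of determinant 1 with trace at least 3
    (∀ A : Matrix.SpecialLinearGroup (Fin 2) ℤ, 3 ≤ A.1.trace → ∃ D : SolParameters, D.A = A) ∧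
    -- the three families of examples
    ∀ S : FramedQuotient, (S = kodaira ∨ S = nil4 ∨ ∃ D : SolParameters, S = solR D) →
      T2Space S.Quot ∧ CompactSpace S.Quot ∧ ConnectedSpace S.Quot ∧
      ∃ (J : AlmostComplexStructure S.Quot) (φ₁ φ₂ : CForm S.Quot 1),
        S.IsCoframe φ₁ φ₂ ∧ φ₁.IsSmooth ∧ φ₂.IsSmooth ∧ J.IsType10 φ₁ ∧ J.IsType10 φ₂ ∧
        -- the closed (1,0)-forms are the constant multiples of `φ₁`
        (∀ σ : CForm S.Quot 1, σ.IsSmooth → J.IsType10 σ →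
          (σ.d = 0 ↔ ∃ c : ℂ, σ = c • φ₁)) ∧
        -- left-invariant Hermitian metrics
        (∃ g : HermitianMetric J, S.IsLeftInvariant g) ∧
        (∀ g : HermitianMetric J, S.IsLeftInvariant g → g.h10d = 1) ∧
        -- metrics with `s = e^F`, `F` a function of the first two coordinates, and `u` constant
        (∀ (F r : S.Quot → ℝ) (u : ℂ),
          ContMDiff 𝓘(ℝ, R4) 𝓘(ℝ, ℝ) ∞ F → ContMDiff 𝓘(ℝ, R4) 𝓘(ℝ, ℝ) ∞ r →
          (∀ a b : R4, a 0 = b 0 → a 1 = b 1 → F (S.proj a) = F (S.proj b)) →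
          (∀ p, 0 < r p) → (∀ p, ‖u‖ < r p * Real.exp (F p)) →
          ∃ g : HermitianMetric J,
            g.HasCoefficients φ₁ φ₂ r (fun p => Real.exp (F p)) (fun _ => u) ∧
            (g.h10d = 0 ↔ ∃ a : R4, S.V1bar F a ≠ 0)) ∧
        -- some metric that is not left-invariant has value 0
        (∃ g : HermitianMetric J, ¬ S.IsLeftInvariant g ∧ g.h10d = 0) := by
  -- The failure of invariance is a consequence of the examples, so these are established first.
  have derive {p q r : Prop} (hr : r) (hq : q) (hp : r → p) : p ∧ q ∧ r := ⟨hp hr, hq, hr⟩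
  refine derive (fun S hS => ?_) exists_solParameters fun main h => ?_
  · obtain ⟨c, D, hc, hu, hD, hcl, hF⟩ := FramedQuotient.examples S hS
    obtain ⟨J, φ₁, φ₂, h₁, h₂, h₃, h₄, h₅, h₆, h₇, h₈, h₉, h₁₀⟩ :=
      FramedQuotient.exists_almostComplexStructure hc hu hD.isInvariantIntegral hcl hF
    exact ⟨S.t2Space, hD.compactSpace, S.connectedSpace, J, φ₁, φ₂, h₁, h₂, h₃, h₄, h₅, h₆, h₇, h₈,
      fun F r u hF hr _ => h₉ F r u hF hr, h₁₀⟩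
  -- On the Kodaira surface, with one and the same `J`, a left-invariant metric has value 1 and `g'`
  -- has value 0.
  · obtain ⟨h₁, h₂, h₃, J, -, -, -, -, -, -, -, -, ⟨g, hg⟩, h₄, -, g', -, hg'⟩ :=
      main kodaira (Or.inl rfl)
    exact one_ne_zero ((h₄ g hg).symm.trans ((h kodaira.Quot J g g').trans hg'))
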